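/- **Setting.** Let $H,G_{\rm c},\ell,\kappa,\theta_\infty>0$, $v_\infty\in\mathbb R$, $D=[-H,H]$. Let $\mu:\mathbb R^2\to\mathbb R$ be continuous, $\mu(\cdot,\theta)$ non-decreasing on $[0,\infty)$ and non-increasing on $(-\infty,0]$ for every $\theta$, $\inf_{\theta}\mu(0,\theta)>0$; let $\mathbb C\in C^1(\mathbb R)$, $\mathbb C'=0$ on $[1,\infty)$, $\inf\mathbb C>0$; let $f_0,f_1:\mathbb R\to\mathbb R$ be continuous, $f_0$ non-increasing with $f_0'<0$ on $(0,\theta_\infty)$ and $f_0(\theta_\infty)=0$, $f_1$ non-decreasing with $f_1'>0$ on $(0,\theta_\infty)$ and $f_1(0)=0$ (so both are non-negative on $[0,\theta_\infty]$). Put $R(\pi,\theta)=\int_0^\pi\mu(s,\theta)\,\mathrm{sign}(s)\,ds$, so that $\partial_\pi R(\pi,\theta)=\mu(\pi,\theta)\,\mathrm{Sign}(\pi)$, where $\mathrm{Sign}(\pi)=\{1\}$ for $\pi>0$, $\{-1\}$ for $\pi<0$, and $[-1,1]$ for $\pi=0$. For $\eta>0$ a (classical) *steady state* is a tuple $(\varepsilon,v,\pi,\alpha,\theta,\sigma)$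 with $\sigma\in\mathbb R$, $\varepsilon\in W^{1,\infty}(D)$, $v\in W^{3,\infty}(D)$, $\pi,\alpha,\theta\in W^{2,\infty}(D)$, such that everywhere on $D$ $$\text{(a) } \mathbb C(\alpha)\varepsilon=\sigma,\ (\mathbb C(\alpha)\varepsilon)_x=0,\qquad \text{(b) } v_x=\pi,$$ $$\text{(d) } \tfrac12\mathbb C'(\alpha)\varepsilon^2+G_{\rm c}\tfrac{\alpha-1}{\ell^2}=G_{\rm c}\ell^2\alpha_{xx},\qquad \text{(e) } |\pi|f_1(\theta)-f_0(\theta)=\kappa\theta_{xx},$$ with $v(\pm H)=\pm v_\infty$, $\alpha(\pm H)=1$, $\theta(\pm H)=\theta_\infty$, $\pi(\pm H)=0$, and for a.e. $x\in D$ $$\text{(c) } R(\widetilde\pi,\theta)-\sigma(\widetilde\pi-\pi)-\eta\,\pi_{xx}(\widetilde\pi-\pi)\ge R(\pi,\theta)\quad\text{for all }\widetilde\pi\in\mathbb R .$$ **Proposition (convergence for $\eta\to0$).** Assume in addition that * there is a continuous $\varPhi:\mathbb R\to[0,\infty)$ with $\varPhi(\pi)/|\pi|\to\infty$ as $|\pi|\to\infty$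 and $R(\pi,\theta)\ge\varPhi(\pi)$ for all $(\pi,\theta)$; * there is a continuous $o:[0,\infty)\to[0,\infty)$ with $o(0)=0$ and $|\mu(\pi,\theta)-\mu(\pi,\widetilde\theta)|\le o(|\theta-\widetilde\theta|)$ for all $\pi,\theta,\widetilde\theta$. Let $\eta_n>0$, $\eta_n\to0$, and let $(\varepsilon_n,v_n,\pi_n,\alpha_n,\theta_n,\sigma_n)$ be any steady states for $\eta=\eta_n$. Then there are a subsequence (not relabelled), $\pi\in L^1(D)$, $v\in W^{1,1}(D)$, $\alpha\in W^{2,\infty}(D)$, $\varepsilon\in W^{1,\infty}(D)$, $\theta\in W^{1,\infty}(D)$ and $\sigma\in\mathbb R$ such that $\varepsilon_n\to\varepsilon$ weakly* in $W^{1,\infty}(D)$ (and weakly* in $W^{2,\infty}(D)$ if $\mathbb C\in C^2(\mathbb R)$), $v_n\to v$ weakly in $W^{1,1}(D)$, $\pi_n\to\pi$ weakly in $L^1(D)$, $\alpha_n\to\alpha$ weakly* in $W^{2,\infty}(D)$, $\theta_n\to\theta$ strongly in $H^1(D)$, $\sigma_n\to\sigma$ in $\mathbb R$, and $\sigma\in\mu(\pi(x),\theta(x))\,\mathrm{Sign}(\pi(x))$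 for a.e. $x\in D$. If moreover $R(\cdot,\theta)$ is strictly convex for every $\theta$, then for all $(s,t)\in\mathbb R^2$ there is exactly one $p=:\varPi(s,t)$ with $s\in\mu(p,t)\,\mathrm{Sign}(p)$, the limit functions (with $\pi$ represented suitably) satisfy $\pi(x)=\varPi(\sigma,\theta(x))$ on $D$, and $(\varepsilon,v,\pi,\alpha,\theta,\sigma)$ is a classical steady state with $\eta=0$: (a), (b), (d), (e) and $$R(\widetilde\pi,\theta(x))-\sigma(\widetilde\pi-\pi(x))\ge R(\pi(x),\theta(x))\quad\text{for all }\widetilde\pi\in\mathbb R$$ hold at every $x\in D$, with $v(\pm H)=\pm v_\infty$, $\alpha(\pm H)=1$, $\theta(\pm H)=\theta_\infty$ (no boundary condition for $\pi$). In particular $\pi\in C(D)$ and $v\in C^1(D)$. -/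

import Mathlib

open MeasureTheory Set Filter Topology
open scoped NNReal ENNReal ContDiff

namespace FaultModel

/-! ### Function spaces on the interval `D = [-H, H]` -/

/-- Lebesgue measure on `D = [-H, H]`. -/
noncomputable abbrev volD (H : ℝ) : Measure ℝ := volume.restrict (Icc (-H) H)

/-- `g` is the distributional derivative of `u` on the interior of `D`. -/
def IsWeakDeriv (H : ℝ) (u g : ℝ → ℝ) : Prop :=
  ∀ φ : ℝ → ℝ, ContDiff ℝ ∞ φ → HasCompactSupport φ → tsupport φ ⊆ Ioo (-H) H →
    ∫ x, u x * deriv φ x ∂(volD H) = - ∫ x, g x * φ x ∂(volD H)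

/-- The Sobolev space `W^{k,p}(D)`. -/
def MemW (H : ℝ) (p : ℝ≥0∞) : ℕ → (ℝ → ℝ) → Prop
  | 0, u => MemLp u p (volD H)
  | k + 1, u => MemLp u p (volD H) ∧ ∃ g, IsWeakDeriv H u g ∧ MemW H p k g

/-- Convergence in `L^p(D)` tested with all functions of `L^q(D)`. With `(p, q) = (1, ∞)` it is
weak convergence in `L^1(D)`, with `(p, q) = (∞, 1)` weak* convergence in `L^∞(D)`. -/
def TendstoWeakL (H : ℝ) (p q : ℝ≥0∞) (u : ℕ → ℝ → ℝ) (w : ℝ → ℝ) : Prop :=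
  (∀ n, MemLp (u n) p (volD H)) ∧ MemLp w p (volD H) ∧
    ∀ g : ℝ → ℝ, MemLp g q (volD H) →
      Tendsto (fun n => ∫ x, u n x * g x ∂(volD H)) atTop (𝓝 (∫ x, w x * g x ∂(volD H)))

/-- Convergence in `W^{k,p}(D)` of the functions and of their distributional derivatives up to
order `k`, each in the sense of `TendstoWeakL`. With `(p, q) = (1, ∞)` it is weak convergence in
`W^{k,1}(D)`, with `(p, q) = (∞, 1)` weak* convergence in `W^{k,∞}(D)`. -/
def TendstoWeakW (H : ℝ) (p q : ℝ≥0∞) : ℕ → (ℕ → ℝ → ℝ) → (ℝ → ℝ) → Prop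
  | 0, u, w => TendstoWeakL H p q u w
  | k + 1, u, w => TendstoWeakL H p q u w ∧
      ∃ (u' : ℕ → ℝ → ℝ) (w' : ℝ → ℝ), (∀ n, IsWeakDeriv H (u n) (u' n)) ∧ IsWeakDeriv H w w' ∧
        TendstoWeakW H p q k u' w'

/-- Strong convergence in `L^p(D)`. -/
def TendstoL (H : ℝ) (p : ℝ≥0∞) (u : ℕ → ℝ → ℝ) (w : ℝ → ℝ) : Prop :=
  (∀ n, MemLp (u n) p (volD H)) ∧ MemLp w p (volD H) ∧
    Tendsto (fun n => eLpNorm (fun x => u n x - w x) p (volD H)) atTop (𝓝 0)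

/-- Strong convergence in `H^1(D) = W^{1,2}(D)`. -/
def TendstoH1 (H : ℝ) (u : ℕ → ℝ → ℝ) (w : ℝ → ℝ) : Prop :=
  TendstoL H 2 u w ∧
    ∃ (u' : ℕ → ℝ → ℝ) (w' : ℝ → ℝ), (∀ n, IsWeakDeriv H (u n) (u' n)) ∧ IsWeakDeriv H w w' ∧
      TendstoL H 2 u' w'

/-- `w` is the classical second derivative of `u` at every point of `D` (one-sided at `±H`). -/
def HasSecondDerivOn (H : ℝ) (u w : ℝ → ℝ) : Prop :=
  ∃ u' : ℝ → ℝ, (∀ x ∈ Icc (-H) H, HasDerivWithinAt u (u' x) (Icc (-H) H) x) ∧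
    ∀ x ∈ Icc (-H) H, HasDerivWithinAt u' (w x) (Icc (-H) H) x

/-! ### The steady-state fault model -/

/-- The data of the model: half-width `H`, fracture toughness `Gc`, length-scale parameters `ℓ`
and `κ`, boundary values `vInf` and `thInf`, yield stress `μ = μ(π, θ)`, elastic modulus `C`,
aging rate `f₀` and contra-aging coefficient `f₁`. -/
structure Data where
  H : ℝ
  Gc : ℝ
  ℓ : ℝ
  κ : ℝ
  vInf : ℝ
  thInf : ℝ
  μ : ℝ → ℝ → ℝ
  C : ℝ → ℝ
  f₀ : ℝ → ℝ
  f₁ : ℝ → ℝ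

/-- The set-valued sign function. -/
noncomputable def SignSet (p : ℝ) : Set ℝ :=
  if 0 < p then {1} else if p < 0 then {-1} else Icc (-1) 1

namespace Data

variable (P : Data)

/-- The set `μ(p, t) Sign(p)`. -/
noncomputable def flowSet (p t : ℝ) : Set ℝ := (fun s => P.μ p t * s) '' SignSet p

/-- The dissipation potential, i.e. the primitive of `μ(·, t) Sign(·)` with `R(0, t) = 0`. -/
noncomputable def R (p t : ℝ) : ℝ := ∫ s in (0 : ℝ)..p, P.μ s t * Real.sign s

/-- The inverse `[μ(·, t) Sign(·)]⁻¹(s)`: a chosen `p` with `s ∈ μ(p, t) Sign(p)`. -/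
noncomputable def flowInv (s t : ℝ) : ℝ := Classical.epsilon fun p => s ∈ P.flowSet p t

/-- The standing assumptions on the data. The functions `f₀`, `f₁` matter on `[0, thInf]`, where
they are non-negative and strictly monotone; outside they are only required to be monotone. -/
structure Standing : Prop where
  H_pos : 0 < P.H
  Gc_pos : 0 < P.Gc
  ℓ_pos : 0 < P.ℓ
  κ_pos : 0 < P.κ
  thInf_pos : 0 < P.thInf
  μ_cont : Continuous fun z : ℝ × ℝ => P.μ z.1 z.2
  μ_mono : ∀ t, MonotoneOn (fun p => P.μ p t) (Ici 0)
  μ_anti : ∀ t, AntitoneOn (fun p => P.μ p t) (Iic 0)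
  μ_pos : ∃ m > 0, ∀ t, m ≤ P.μ 0 t
  C_smooth : ContDiff ℝ 1 P.C
  C_deriv : ∀ a, 1 ≤ a → deriv P.C a = 0
  C_pos : ∃ c > 0, ∀ a, c ≤ P.C a
  f₀_cont : Continuous P.f₀
  f₁_cont : Continuous P.f₁
  f₀_anti : Antitone P.f₀
  f₁_mono : Monotone P.f₁
  f₀_deriv : ∀ t ∈ Ioo 0 P.thInf, deriv P.f₀ t < 0
  f₁_deriv : ∀ t ∈ Ioo 0 P.thInf, 0 < deriv P.f₁ t
  f₀_thInf : P.f₀ P.thInf = 0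
  f₁_zero : P.f₁ 0 = 0

/-- Uniform superlinear lower bound: `R(p, t) ≥ Φ(p)` with `Φ ≥ 0` continuous and superlinear. -/
def SuperlinearBound : Prop :=
  ∃ Φ : ℝ → ℝ, Continuous Φ ∧ (∀ p, 0 ≤ Φ p) ∧
    Tendsto (fun p => Φ p / |p|) (cocompact ℝ) atTop ∧ ∀ p t, Φ p ≤ P.R p t

/-- Modulus of continuity of `μ` in its second variable, uniform in the first one. -/
def UniformModulus : Prop :=
  ∃ m : ℝ≥0 → ℝ≥0, Continuous m ∧ m 0 = 0 ∧
    ∀ p t t' : ℝ, |P.μ p t - P.μ p t'| ≤ m ‖t - t'‖₊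

/-- The equations and boundary conditions in which `η` does not enter: momentum equilibrium (with
the constant stress `σ`), plastic shear rate, damage flow rule, aging flow rule, all of them
everywhere on `D`, and the boundary conditions for `v`, `α`, `θ`. -/
structure Balance (ε v π α θ : ℝ → ℝ) (σ : ℝ) : Prop where
  stress : ∀ x ∈ Icc (-P.H) P.H, P.C (α x) * ε x = σ
  momentum : ∀ x ∈ Icc (-P.H) P.H,
    HasDerivWithinAt (fun y => P.C (α y) * ε y) 0 (Icc (-P.H) P.H) x
  rate : ∀ x ∈ Icc (-P.H) P.H, HasDerivWithinAt v (π x) (Icc (-P.H) P.H) x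
  damage : ∃ α₂, HasSecondDerivOn P.H α α₂ ∧ ∀ x ∈ Icc (-P.H) P.H,
    1 / 2 * deriv P.C (α x) * ε x ^ 2 + P.Gc * ((α x - 1) / P.ℓ ^ 2) = P.Gc * P.ℓ ^ 2 * α₂ x
  aging : ∃ θ₂, HasSecondDerivOn P.H θ θ₂ ∧ ∀ x ∈ Icc (-P.H) P.H,
    |π x| * P.f₁ (θ x) - P.f₀ (θ x) = P.κ * θ₂ x
  v_left : v (-P.H) = -P.vInf
  v_right : v P.H = P.vInf
  α_left : α (-P.H) = 1
  α_right : α P.H = 1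
  θ_left : θ (-P.H) = P.thInf
  θ_right : θ P.H = P.thInf

/-- Classical steady states for `η > 0`: the plastic flow rule `μ(π,θ) Sign(π) ∋ σ + η π_xx` holds
almost everywhere on `D` as a variational inequality with `π_xx ∈ L^∞(D)`, and `π(±H) = 0`. -/
structure IsSteadyState (η : ℝ) (ε v π α θ : ℝ → ℝ) (σ : ℝ) : Prop
    extends P.Balance ε v π α θ σ where
  ε_mem : MemW P.H ∞ 1 ε
  v_mem : MemW P.H ∞ 3 v
  α_mem : MemW P.H ∞ 2 α
  θ_mem : MemW P.H ∞ 2 θ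
  π_cont : ContinuousOn π (Icc (-P.H) P.H)
  π_left : π (-P.H) = 0
  π_right : π P.H = 0
  flow : ∃ π₁ π₂ : ℝ → ℝ, MemLp π ∞ (volD P.H) ∧ MemLp π₁ ∞ (volD P.H) ∧
    MemLp π₂ ∞ (volD P.H) ∧ IsWeakDeriv P.H π π₁ ∧ IsWeakDeriv P.H π₁ π₂ ∧
    ∀ᵐ x ∂(volD P.H), ∀ q : ℝ,
      P.R (π x) (θ x) ≤ P.R q (θ x) - σ * (q - π x) - η * π₂ x * (q - π x)

/-- Classical steady states for `η = 0`: everything holds everywhere on `D`, and there is no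
boundary condition for `π`. -/
structure IsLimitSteadyState (ε v π α θ : ℝ → ℝ) (σ : ℝ) : Prop
    extends P.Balance ε v π α θ σ where
  flow : ∀ x ∈ Icc (-P.H) P.H, ∀ q : ℝ, P.R (π x) (θ x) ≤ P.R q (θ x) - σ * (q - π x)

end Data

end FaultModel

/-! The proof has three stages: bounds uniform in `η`, compactness, and passage to the limit in the
flow rule.

Since `R(·, t)` is convex, the flow rule is equivalent to the variational inequality
(`mem_flowSet_iff`). Testing it with `q = 0` gives `(σ + η π'') π ≥ R(π, θ) ≥ 0`. A minimum
principle turns this into a sign: `π` does not change sign on `D`, and its sign is that of the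
driving velocity (`abs_pi_eq`). Hence `∫ |π| = 2 |vInf|`. Integrating the flow rule against smooth
`φ` and moving both derivatives of the viscous term onto `φ` then bounds `σ` (`exists_sigma_bound`).
With `σ` bounded, superlinearity of `R` makes `π'' π > 0` wherever `|π|` is large, so the same
minimum principle bounds `π` uniformly (`exists_pi_bound`). The age stays in `[0, thInf]`
(`theta_mem`), and a conserved energy of the damage equation bounds `α` (`sq_alpha_sub_one_le`). The
equations then bound second derivatives, and Arzelà–Ascoli gives pointwise convergence of `v`, `α`,
`α'`, `θ`, `θ'` along a subsequence. The rates converge only weakly, to the density `p` of the limit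
of the velocities.

Two terms are nonlinear in the rate. In the aging equation `|π|` equals a fixed sign times `π`, so
the term is linear in `π` and is a product of a weakly and a strongly convergent factor
(`theta'_eq`). In the flow rule, `R` is bounded below by its tangent at `p`, whose slope converges
strongly; this yields lower semicontinuity, while the viscous term vanishes against smooth test
functions (`integral_R_le_test`). Extending the tests to bounded functions and localising gives the
flow rule almost everywhere (`ae_mem_flowSet`).

If `R` is strictly convex, the flow rule can be solved for the rate, continuously in the age
(`flowInv_eq_iff`, `flowInv_continuous`). Thus `π` has a continuous representative, and the
equations hold at every point. -/

namespace FaultModel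

/-! ### Convex analysis of the dissipation potential. -/

namespace Data

variable {P : Data}

/-- The single-valued selection `μ(p, t) sign p` of the flow rule, with value `0` at `p = 0`. -/
noncomputable def flowSel (P : Data) (p t : ℝ) : ℝ := P.μ p t * Real.sign p

theorem flowSel_zero (t : ℝ) : P.flowSel 0 t = 0 := by simp [flowSel]

theorem flowSel_of_pos {p : ℝ} (hp : 0 < p) (t : ℝ) : P.flowSel p t = P.μ p t := by
  simp [flowSel, Real.sign_of_pos hp]

theorem flowSel_of_neg {p : ℝ} (hp : p < 0) (t : ℝ) : P.flowSel p t = -P.μ p t := by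
  simp [flowSel, Real.sign_of_neg hp]

theorem Standing.mu_zero_pos (hP : P.Standing) (t : ℝ) : 0 < P.μ 0 t := by
  obtain ⟨m, hm, h⟩ := hP.μ_pos
  exact hm.trans_le (h t)

theorem Standing.mu_zero_le (hP : P.Standing) (p t : ℝ) : P.μ 0 t ≤ P.μ p t := by
  rcases le_total 0 p with h | h
  · exact hP.μ_mono t (mem_Ici.2 le_rfl) h h
  · exact hP.μ_anti t h (mem_Iic.2 le_rfl) h

theorem Standing.mu_cont_left (hP : P.Standing) (t : ℝ) : Continuous fun p => P.μ p t :=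
  hP.μ_cont.comp (continuous_id.prodMk continuous_const)

theorem Standing.mu_cont_right (hP : P.Standing) (p : ℝ) : Continuous fun t => P.μ p t :=
  hP.μ_cont.comp (continuous_const.prodMk continuous_id)

/-- On each half-line this is the monotonicity of `μ`; across zero it is the positivity of `μ`,
which makes the jump go upwards. It is the source of the convexity of `R(·, t)`. -/
theorem Standing.flowSel_mono (hP : P.Standing) (t : ℝ) : Monotone fun p => P.flowSel p t := by
  intro p q hpq
  have hp := (hP.mu_zero_pos t).trans_le (hP.mu_zero_le p t)
  have hq := (hP.mu_zero_pos t).trans_le (hP.mu_zero_le q t)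
  rcases lt_trichotomy p 0 with h | h | h <;> rcases lt_trichotomy q 0 with h' | h' | h'
  · simp only [flowSel_of_neg h, flowSel_of_neg h']
    exact neg_le_neg (hP.μ_anti t h.le h'.le hpq)
  · subst h'; simp only [flowSel_of_neg h, flowSel_zero]; linarith
  · simp only [flowSel_of_neg h, flowSel_of_pos h']; linarith
  · linarith
  · subst h; subst h'; rfl
  · subst h; simp only [flowSel_zero, flowSel_of_pos h']; exact hq.le
  · linarith
  · linarith
  · simp only [flowSel_of_pos h, flowSel_of_pos h']
    exact hP.μ_mono t h.le h'.le hpq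

theorem Standing.R_sub (hP : P.Standing) (p q t : ℝ) :
    P.R q t - P.R p t = ∫ s in p..q, P.flowSel s t := by
  have h (a b : ℝ) : IntervalIntegrable (fun s => P.flowSel s t) volume a b :=
    (hP.flowSel_mono t).intervalIntegrable
  have := intervalIntegral.integral_add_adjacent_intervals (h 0 p) (h p q)
  unfold R
  unfold flowSel at this ⊢
  linarith

theorem R_zero (t : ℝ) : P.R 0 t = 0 := by simp [R]

/-- `flowSel p t` is a subgradient of `R(·, t)` at `p`. -/
theorem Standing.R_subgradient (hP : P.Standing) (p q t : ℝ) :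
    P.flowSel p t * (q - p) ≤ P.R q t - P.R p t := by
  have h (a b : ℝ) : IntervalIntegrable (fun s => P.flowSel s t) volume a b :=
    (hP.flowSel_mono t).intervalIntegrable
  rw [hP.R_sub]
  rcases le_total p q with hpq | hpq
  · have := intervalIntegral.integral_mono_on hpq (f := fun _ => P.flowSel p t) (by simp)
      (h p q) (fun x hx => hP.flowSel_mono t hx.1)
    simpa [mul_comm] using this
  · have := intervalIntegral.integral_mono_on hpq (g := fun _ => P.flowSel p t) (h q p) (by simp)
      (fun x hx => hP.flowSel_mono t hx.2)
    rw [intervalIntegral.integral_symm]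
    simp only [intervalIntegral.integral_const, smul_eq_mul] at this
    linarith

theorem Standing.R_nonneg (hP : P.Standing) (p t : ℝ) : 0 ≤ P.R p t := by
  have := hP.R_subgradient 0 p t
  rw [flowSel_zero, R_zero] at this
  linarith

theorem Standing.mu_zero_mul_abs_le_R (hP : P.Standing) (p t : ℝ) : P.μ 0 t * |p| ≤ P.R p t := by
  have h (a b : ℝ) : IntervalIntegrable (fun s => P.flowSel s t) volume a b :=
    (hP.flowSel_mono t).intervalIntegrable
  have hR := hP.R_sub 0 p t
  rw [R_zero, sub_zero] at hR
  rw [hR]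
  rcases le_total 0 p with hp | hp
  · have := intervalIntegral.integral_mono_on_of_le_Ioo hp (f := fun _ => P.μ 0 t) (by simp)
      (h 0 p) (fun x hx => by rw [flowSel_of_pos hx.1]; exact hP.mu_zero_le x t)
    simpa [mul_comm, abs_of_nonneg hp] using this
  · have := intervalIntegral.integral_mono_on_of_le_Ioo hp (g := fun _ => -P.μ 0 t) (h p 0)
      (by simp) (fun x hx => by rw [flowSel_of_neg hx.2]; exact neg_le_neg (hP.mu_zero_le x t))
    rw [intervalIntegral.integral_symm, abs_of_nonpos hp]
    simp only [intervalIntegral.integral_const, smul_eq_mul] at this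
    linarith

theorem Standing.R_cont (hP : P.Standing) : Continuous fun z : ℝ × ℝ => P.R z.1 z.2 := by
  have hG : Continuous fun z : ℝ × ℝ => ∫ s in (0 : ℝ)..z.1, P.μ s z.2 := by
    refine intervalIntegral.continuous_parametric_intervalIntegral_of_continuous (μ := volume)
      (f := fun (z : ℝ × ℝ) s => P.μ s z.2) ?_ continuous_fst
    exact hP.μ_cont.comp (continuous_snd.prodMk (continuous_snd.comp continuous_fst))
  -- The integrand jumps at `s = 0`. Splitting there leaves integrals of the continuous `μ` whose
  -- end points `max z.1 0` and `min z.1 0` depend continuously on `z`.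
  have key : (fun z : ℝ × ℝ => P.R z.1 z.2) = fun z : ℝ × ℝ =>
      (∫ s in (0 : ℝ)..(max z.1 0), P.μ s z.2) - ∫ s in (0 : ℝ)..(min z.1 0), P.μ s z.2 := by
    ext ⟨p, t⟩
    unfold R
    rcases le_total 0 p with hp | hp
    · simp only [max_eq_left hp, min_eq_right hp, intervalIntegral.integral_same, sub_zero]
      refine intervalIntegral.integral_congr_ae (Eventually.of_forall fun s hs => ?_)
      rw [uIoc_of_le hp] at hs
      rw [Real.sign_of_pos hs.1, mul_one]
    · simp only [max_eq_right hp, min_eq_left hp, intervalIntegral.integral_same, zero_sub]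
      rw [← intervalIntegral.integral_neg]
      refine intervalIntegral.integral_congr_ae ?_
      have : ∀ᵐ s : ℝ, s ≠ 0 := by simp [ae_iff]
      filter_upwards [this] with s hs0 hs
      rw [uIoc_of_ge hp] at hs
      rw [Real.sign_of_neg (lt_of_le_of_ne hs.2 hs0)]
      ring
  rw [key]
  exact (hG.comp ((continuous_fst.max continuous_const).prodMk continuous_snd)).sub
    (hG.comp ((continuous_fst.min continuous_const).prodMk continuous_snd))

/-- The flow rule as a variational inequality. -/
theorem Standing.mem_flowSet_iff (hP : P.Standing) {s p t : ℝ} :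
    s ∈ P.flowSet p t ↔ ∀ q, P.R p t ≤ P.R q t - s * (q - p) := by
  unfold flowSet SignSet
  constructor
  · rintro ⟨r, hr, rfl⟩ q
    have hsub := hP.R_subgradient p q t
    rcases lt_trichotomy p 0 with h | h | h
    · simp only [not_lt.2 h.le, if_false, h, if_true, mem_singleton_iff] at hr
      rw [flowSel_of_neg h] at hsub
      subst hr; linarith
    · subst h
      simp only [lt_irrefl, if_false] at hr
      have := hP.mu_zero_mul_abs_le_R q t
      rw [R_zero]
      have h2 : r * q ≤ |q| := by
        refine (le_abs_self _).trans ?_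
        rw [abs_mul]
        exact mul_le_of_le_one_left (abs_nonneg q) (abs_le.2 hr)
      have h3 := mul_le_mul_of_nonneg_left h2 (hP.mu_zero_pos t).le
      linarith
    · simp only [h, if_true, mem_singleton_iff] at hr
      rw [flowSel_of_pos h] at hsub
      subst hr; linarith
  · intro H
    -- The subgradient inequality based at `q` and tested at `p`, added to the variational
    -- inequality, traps `s` between the values of `flowSel` to the left and to the right of `p`.
    -- Continuity of `μ` then identifies the one-sided limits.
    have hup : ∀ q, p < q → s ≤ P.flowSel q t := by
      intro q hq
      have h1 := hP.R_subgradient q p t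
      have h2 := H q
      have : s * (q - p) ≤ P.flowSel q t * (q - p) := by linarith
      exact le_of_mul_le_mul_right this (by linarith)
    have hlo : ∀ q, q < p → P.flowSel q t ≤ s := by
      intro q hq
      have h1 := hP.R_subgradient q p t
      have h2 := H q
      have : P.flowSel q t * (p - q) ≤ s * (p - q) := by linarith
      exact le_of_mul_le_mul_right this (by linarith)
    have hc : Tendsto (fun q => P.μ q t) (𝓝 p) (𝓝 (P.μ p t)) := (hP.mu_cont_left t).tendsto p
    have hcr := hc.mono_left (nhdsWithin_le_nhds (s := Ioi p))
    have hcl := hc.mono_left (nhdsWithin_le_nhds (s := Iio p))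
    rcases lt_trichotomy p 0 with h | h | h
    · refine ⟨-1, by simp [h, not_lt.2 h.le], ?_⟩
      have h1 : -s ≥ P.μ p t := by
        refine le_of_tendsto hcr ?_
        filter_upwards [Ioo_mem_nhdsGT h] with q hq
        have := hup q hq.1
        rw [flowSel_of_neg hq.2] at this; linarith
      have h2 : -s ≤ P.μ p t := by
        refine ge_of_tendsto hcl ?_
        filter_upwards [self_mem_nhdsWithin] with q hq
        have := hlo q hq
        rw [flowSel_of_neg (lt_trans hq h)] at this; linarith
      simp only; linarith
    · subst h
      have hpos := hP.mu_zero_pos t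
      have h1 : s ≤ P.μ 0 t := by
        refine ge_of_tendsto hcr ?_
        filter_upwards [self_mem_nhdsWithin] with q hq
        have := hup q hq
        rwa [flowSel_of_pos hq] at this
      have h2 : -s ≤ P.μ 0 t := by
        refine ge_of_tendsto hcl ?_
        filter_upwards [self_mem_nhdsWithin] with q hq
        have := hlo q hq
        rw [flowSel_of_neg hq] at this; linarith
      refine ⟨s / P.μ 0 t, ?_, ?_⟩
      · simp only [lt_irrefl, if_false, mem_Icc]
        rw [le_div_iff₀ hpos, div_le_one hpos]
        constructor <;> linarith
      · field_simp
    · refine ⟨1, by simp [h], ?_⟩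
      have h1 : s ≤ P.μ p t := by
        refine ge_of_tendsto hcr ?_
        filter_upwards [self_mem_nhdsWithin] with q hq
        have := hup q hq
        rwa [flowSel_of_pos (h.trans hq)] at this
      have h2 : P.μ p t ≤ s := by
        refine le_of_tendsto hcl ?_
        filter_upwards [Ioo_mem_nhdsLT h] with q hq
        have := hlo q hq.2
        rwa [flowSel_of_pos hq.1] at this
      simp only; linarith

/-- Superlinear growth bounds the points where `R(·, t)` stays below a linear function. -/
theorem SuperlinearBound.exists_bound (hΦ : P.SuperlinearBound) (S : ℝ) :
    ∃ K > 0, ∀ p t, K < |p| → S * |p| < P.R p t := by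
  obtain ⟨Φ, -, -, hlim, hle⟩ := hΦ
  have h := hlim.eventually (eventually_gt_atTop S)
  rw [Metric.cobounded_eq_cocompact.symm, ← comap_norm_atTop, eventually_comap] at h
  obtain ⟨K, hK⟩ := eventually_atTop.1 h
  refine ⟨max K 1, by positivity, fun p t hp => ?_⟩
  have hp0 : 0 < |p| := by linarith [le_max_right K 1]
  have h1 := hK |p| ((le_max_left _ _).trans hp.le) p (Real.norm_eq_abs p)
  rw [lt_div_iff₀ hp0] at h1
  exact h1.trans_le (hle p t)


end Data

/-! ### Weak derivatives and primitives -/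

theorem integral_volD {H : ℝ} (hH : 0 ≤ H) (f : ℝ → ℝ) :
    ∫ x, f x ∂(volD H) = ∫ x in (-H)..H, f x := by
  rw [intervalIntegral.integral_of_le (by linarith), ← integral_Icc_eq_integral_Ioc]

theorem integrable_volD_iff {H : ℝ} (hH : 0 ≤ H) (f : ℝ → ℝ) :
    Integrable f (volD H) ↔ IntervalIntegrable f volume (-H) H := by
  rw [intervalIntegrable_iff_integrableOn_Icc_of_le (by linarith)]; rfl

theorem ae_volD_iff {H : ℝ} {p : ℝ → Prop} :
    (∀ᵐ x ∂(volD H), p x) ↔ ∀ᵐ x, x ∈ Icc (-H) H → p x :=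
  ae_restrict_iff' measurableSet_Icc

theorem ae_mem_volD (H : ℝ) : ∀ᵐ x ∂(volD H), x ∈ Icc (-H) H :=
  ae_restrict_mem measurableSet_Icc

theorem eq_zero_of_tsupport_subset {H : ℝ} {φ : ℝ → ℝ} (hφ : tsupport φ ⊆ Ioo (-H) H) {x : ℝ}
    (hx : x ∉ Ioo (-H) H) : φ x = 0 :=
  image_eq_zero_of_notMem_tsupport fun h => hx (hφ h)

/-- A primitive of an integrable function has that function as its weak derivative. -/
theorem isWeakDeriv_of_primitive {H : ℝ} (hH : 0 < H) {u g : ℝ → ℝ} {c : ℝ}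
    (hg : Integrable g (volD H))
    (hu : ∀ x ∈ Icc (-H) H, u x = c + ∫ y in (-H)..x, g y) : IsWeakDeriv H u g := by
  intro φ hφ _ hsupp
  rw [integral_volD hH.le, integral_volD hH.le]
  have hH' : -H ≤ H := by linarith
  have hgi := (integrable_volD_iff hH.le g).1 hg
  have hG : AbsolutelyContinuousOnInterval (fun x => c + ∫ y in (-H)..x, g y) (-H) H :=
    ((LipschitzWith.const c).lipschitzOnWith.absolutelyContinuousOnInterval (K := 0)).add
      (hgi.absolutelyContinuousOnInterval_intervalIntegral left_mem_uIcc)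
  have hφ1 : ContDiff ℝ 1 φ := hφ.of_le (by simp)
  have hφac : AbsolutelyContinuousOnInterval φ (-H) H :=
    hφ1.contDiffOn.absolutelyContinuousOnInterval
  have key := hG.integral_mul_deriv_eq_deriv_mul hφac
  have h1 : φ H = 0 := eq_zero_of_tsupport_subset hsupp (by simp)
  have h2 : φ (-H) = 0 := eq_zero_of_tsupport_subset hsupp (by simp)
  rw [h1, h2, mul_zero, mul_zero, sub_zero, zero_sub] at key
  have e1 : ∫ x in (-H)..H, u x * deriv φ x =
      ∫ x in (-H)..H, (c + ∫ y in (-H)..x, g y) * deriv φ x := by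
    refine intervalIntegral.integral_congr fun x hx => ?_
    rw [uIcc_of_le hH'] at hx
    simp only [hu x hx]
  rw [e1, key, neg_inj]
  refine intervalIntegral.integral_congr_ae ?_
  filter_upwards [hgi.ae_hasDerivAt_integral] with x hx hx'
  have := ((hx (uIoc_subset_uIcc hx') (-H) left_mem_uIcc).const_add c).deriv
  rw [this]

theorem eq_add_integral_of_hasDerivWithinAt {a b : ℝ} {u u' : ℝ → ℝ}
    (hd : ∀ x ∈ Icc a b, HasDerivWithinAt u (u' x) (Icc a b) x) (hc : ContinuousOn u' (Icc a b))
    {x y : ℝ} (hx : x ∈ Icc a b) (hy : y ∈ Icc a b) : u y = u x + ∫ z in x..y, u' z := by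
  wlog hxy : x ≤ y generalizing x y
  · rw [intervalIntegral.integral_symm]
    linarith [this hy hx (le_of_not_ge hxy)]
  have hsub : Icc x y ⊆ Icc a b := Icc_subset_Icc hx.1 hy.2
  rw [intervalIntegral.integral_eq_sub_of_hasDerivAt_of_le hxy
    (fun z hz => (hd z (hsub hz)).continuousWithinAt.mono hsub)
    (fun z hz => (hd z (hsub (Ioo_subset_Icc_self hz))).hasDerivAt
      (Icc_mem_nhds (hx.1.trans_lt hz.1) (hz.2.trans_le hy.2)))
    ((hc.mono hsub).intervalIntegrable_of_Icc hxy)]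
  ring

theorem isWeakDeriv_of_hasDerivWithinAt {H : ℝ} (hH : 0 < H) {u u' : ℝ → ℝ}
    (hd : ∀ x ∈ Icc (-H) H, HasDerivWithinAt u (u' x) (Icc (-H) H) x)
    (hc : ContinuousOn u' (Icc (-H) H)) : IsWeakDeriv H u u' :=
  isWeakDeriv_of_primitive hH (c := u (-H)) (hc.integrableOn_compact isCompact_Icc)
    fun _ hx => eq_add_integral_of_hasDerivWithinAt hd hc (left_mem_Icc.2 (by linarith)) hx

/-- The primitive of a continuous function on an interval, at all points of the interval. -/
theorem hasDerivWithinAt_of_primitive {H : ℝ} {u g : ℝ → ℝ} {c : ℝ} (hg : ContinuousOn g (Icc (-H) H))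
    (hu : ∀ x ∈ Icc (-H) H, u x = c + ∫ y in (-H)..x, g y) {x : ℝ} (hx : x ∈ Icc (-H) H) :
    HasDerivWithinAt u (g x) (Icc (-H) H) x := by
  have hH' : -H ≤ H := hx.1.trans hx.2
  have hxf : Fact (x ∈ Icc (-H) H) := ⟨hx⟩
  have := intervalIntegral.integral_hasDerivWithinAt_right (a := -H) (b := x) (s := Icc (-H) H)
    (t := Icc (-H) H) ((hg.mono (Icc_subset_Icc le_rfl hx.2)).intervalIntegrable_of_Icc hx.1)
    (hg.stronglyMeasurableAtFilter_nhdsWithin measurableSet_Icc x) (hg x hx)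
  exact (this.const_add c).congr hu (hu x hx)

/-- A smooth function with integral zero, compactly supported in the interior of `D`, is the
derivative of another one. -/
theorem exists_test_primitive {H : ℝ} (hH : 0 < H) {f : ℝ → ℝ} (hf : ContDiff ℝ ∞ f)
    (hfc : HasCompactSupport f) (hfs : tsupport f ⊆ Ioo (-H) H) (h0 : ∫ x, f x ∂(volD H) = 0) :
    ∃ φ : ℝ → ℝ, ContDiff ℝ ∞ φ ∧ HasCompactSupport φ ∧ tsupport φ ⊆ Ioo (-H) H ∧
      deriv φ = f := by
  obtain ⟨a, b, ha, hb, hab, hsub⟩ : ∃ a b, -H < a ∧ b < H ∧ a ≤ b ∧ tsupport f ⊆ Icc a b := by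
    rcases (tsupport f).eq_empty_or_nonempty with he | hne
    · exact ⟨0, 0, by linarith, hH, le_rfl, by simp [he]⟩
    · obtain ⟨a, ha⟩ := IsCompact.exists_isLeast hfc hne
      obtain ⟨b, hb⟩ := IsCompact.exists_isGreatest hfc hne
      exact ⟨a, b, (hfs ha.1).1, (hfs hb.1).2, ha.2 hb.1, fun x hx => ⟨ha.2 hx, hb.2 hx⟩⟩
  have hz : ∀ x, x ∉ Icc a b → f x = 0 := fun x hx =>
    image_eq_zero_of_notMem_tsupport fun h => hx (hsub h)
  have hder : ∀ x, HasDerivAt (fun x => ∫ y in (-H)..x, f y) (f x) x := fun x =>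
    intervalIntegral.integral_hasDerivAt_right (hf.continuous.intervalIntegrable _ _)
      (hf.continuous.stronglyMeasurableAtFilter _ _) hf.continuous.continuousAt
  have hderiv : deriv (fun x => ∫ y in (-H)..x, f y) = f := funext fun x => (hder x).deriv
  -- The primitive vanishes left of `a` because `f` does, and right of `b` because the total
  -- integral of `f` is zero.
  have hzero : ∀ x, x ∉ Icc a b → ∫ y in (-H)..x, f y = 0 := by
    intro x hx
    rw [mem_Icc, not_and_or, not_le, not_le] at hx
    rcases hx with hx | hx
    · refine intervalIntegral.integral_zero_ae (Eventually.of_forall fun y hy => hz y fun hy' => ?_)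
      rcases mem_uIoc.1 hy with h | h
      · linarith [hy'.1, h.2]
      · linarith [hy'.1, h.2]
    · rw [integral_volD hH.le] at h0
      have h1 := intervalIntegral.integral_add_adjacent_intervals
        (hf.continuous.intervalIntegrable (-H) x) (hf.continuous.intervalIntegrable (μ := volume) x H)
      have h2 : ∫ y in x..H, f y = 0 := by
        refine intervalIntegral.integral_zero_ae (Eventually.of_forall fun y hy => hz y fun hy' => ?_)
        rcases mem_uIoc.1 hy with h | h
        · linarith [hy'.2, h.1]
        · linarith [hy'.2, h.1]
      linarith
  have hts : tsupport (fun x => ∫ y in (-H)..x, f y) ⊆ Icc a b :=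
    closure_minimal (fun x hx => by_contra fun h => hx (hzero x h)) isClosed_Icc
  refine ⟨fun x => ∫ y in (-H)..x, f y, ?_, ?_, ?_, hderiv⟩
  · rw [contDiff_infty_iff_deriv, hderiv]
    exact ⟨fun x => (hder x).differentiableAt, hf⟩
  · exact isCompact_Icc.of_isClosed_subset (isClosed_tsupport _) hts
  · exact hts.trans fun x hx => ⟨ha.trans_le hx.1, hx.2.trans_lt hb⟩

/-- A function with integrable weak derivative agrees a.e. with a primitive of it. -/
theorem IsWeakDeriv.ae_eq_primitive {H : ℝ} (hH : 0 < H) {u g : ℝ → ℝ}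
    (hu : Integrable u (volD H)) (hg : Integrable g (volD H)) (h : IsWeakDeriv H u g) :
    ∃ c, ∀ᵐ x ∂(volD H), u x = c + ∫ y in (-H)..x, g y := by
  set G : ℝ → ℝ := fun x => ∫ y in (-H)..x, g y with hG
  have hgi := (integrable_volD_iff hH.le g).1 hg
  have hGc : ContinuousOn G (Icc (-H) H) := by
    have := (hgi.absolutelyContinuousOnInterval_intervalIntegral left_mem_uIcc).continuousOn
    rwa [uIcc_of_le (by linarith)] at this
  have hGi : Integrable G (volD H) := hGc.integrableOn_compact isCompact_Icc
  have hGw : IsWeakDeriv H G g := isWeakDeriv_of_primitive hH (c := 0) hg (by simp [hG])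
  have hwi : Integrable (fun x => u x - G x) (volD H) := hu.sub hGi
  have bdd : ∀ φ : ℝ → ℝ, ContDiff ℝ ∞ φ → HasCompactSupport φ → ∀ w, Integrable w (volD H) →
      Integrable (fun x => w x * φ x) (volD H) := by
    intro φ hφ hφc w hw
    obtain ⟨M, hM⟩ := hφ.continuous.bounded_above_of_compact_support hφc
    exact hw.mul_bdd hφ.continuous.aestronglyMeasurable (Eventually.of_forall hM)
  have hw0 : ∀ φ : ℝ → ℝ, ContDiff ℝ ∞ φ → HasCompactSupport φ → tsupport φ ⊆ Ioo (-H) H →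
      ∫ x, (u x - G x) * deriv φ x ∂(volD H) = 0 := by
    intro φ hφ hφc hφs
    have hφ' : ContDiff ℝ ∞ (deriv φ) := (contDiff_infty_iff_deriv.1 hφ).2
    have hφ'c : HasCompactSupport (deriv φ) := hφc.deriv
    simp only [sub_mul]
    rw [integral_sub (bdd _ hφ' hφ'c u hu) (bdd _ hφ' hφ'c G hGi), h φ hφ hφc hφs,
      hGw φ hφ hφc hφs, sub_self]
  -- Du Bois-Reymond argument: `u - G` annihilates derivatives of test functions, that is, test
  -- functions of mean zero. Subtracting `m * r`, with `r` of integral one, gives any `ψ` mean zero,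
  -- so `u - G` minus its average against `r` annihilates every test function.
  let ρ : ContDiffBump (0 : ℝ) := ⟨H / 4, H / 2, by positivity, by linarith⟩
  set r : ℝ → ℝ := ρ.normed volume with hr
  have hrs : tsupport r ⊆ Ioo (-H) H := by
    rw [hr, ρ.tsupport_normed_eq, Real.closedBall_eq_Icc]
    intro x hx
    have h1 : ρ.rOut = H / 2 := rfl
    rw [h1] at hx
    constructor <;> linarith [hx.1, hx.2]
  have hrsm : ContDiff ℝ ∞ r := ρ.contDiff_normed
  have hrc : HasCompactSupport r := ρ.hasCompactSupport_normed
  have hr1 : ∫ x, r x ∂(volD H) = 1 := by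
    rw [← ρ.integral_normed (μ := volume)]
    refine setIntegral_eq_integral_of_forall_compl_eq_zero fun x hx => ?_
    exact eq_zero_of_tsupport_subset hrs fun h => hx (Ioo_subset_Icc_self h)
  refine ⟨∫ x, (u x - G x) * r x ∂(volD H), ?_⟩
  set c := ∫ x, (u x - G x) * r x ∂(volD H) with hc
  have hfin : Integrable (fun x => u x - G x - c) (volD H) := hwi.sub (integrable_const c)
  have key := isOpen_Ioo (a := -H) (b := H) |>.ae_eq_zero_of_integral_contDiff_smul_eq_zero
    (f := fun x => u x - G x - c) (μ := volD H) (hfin.locallyIntegrable.locallyIntegrableOn _) ?_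
  · have hI : ∀ᵐ x ∂(volD H), x ∈ Ioo (-H) H := by
      change ∀ᵐ x ∂(volume.restrict (Icc (-H) H)), _
      rw [← restrict_Ioo_eq_restrict_Icc]
      exact ae_restrict_mem measurableSet_Ioo
    filter_upwards [key, hI] with x hx hx'
    linarith [hx hx']
  · intro ψ hψ hψc hψs
    set m := ∫ x, ψ x ∂(volD H) with hm
    have hint : ∀ φ : ℝ → ℝ, ContDiff ℝ ∞ φ → HasCompactSupport φ → Integrable φ (volD H) :=
      fun φ hφ hφc => (hφ.continuous.integrable_of_hasCompactSupport hφc).restrict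
    have hfs : tsupport (fun x => ψ x - m * r x) ⊆ Ioo (-H) H := by
      refine (tsupport_sub ψ (fun x => m * r x)).trans (union_subset hψs ?_)
      exact (tsupport_mul_subset_right).trans hrs
    have hfc : HasCompactSupport (fun x => ψ x - m * r x) :=
      hψc.sub (hrc.mul_left (f := fun _ => m))
    obtain ⟨φ, hφ, hφc, hφs, hφd⟩ := exists_test_primitive hH (f := fun x => ψ x - m * r x)
      (hψ.sub (contDiff_const.mul hrsm)) hfc hfs (by
        rw [integral_sub (hint _ hψ hψc) ((hint _ hrsm hrc).const_mul m), integral_const_mul, hr1,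
          mul_one, sub_self])
    have h1 := hw0 φ hφ hφc hφs
    rw [hφd] at h1
    have h2 : ∀ x, ψ x • (u x - G x - c) =
        ((u x - G x) * (ψ x - m * r x)) + (m * ((u x - G x) * r x) - c * ψ x) := by
      intro x; simp only [smul_eq_mul]; ring
    simp only [h2]
    have i1 : Integrable (fun x => (u x - G x) * (ψ x - m * r x)) (volD H) :=
      bdd _ (hψ.sub (contDiff_const.mul hrsm)) hfc _ hwi
    have i2 : Integrable (fun x => m * ((u x - G x) * r x)) (volD H) :=
      (bdd _ hrsm hrc _ hwi).const_mul m
    have i3 : Integrable (fun x => c * ψ x) (volD H) := (hint _ hψ hψc).const_mul c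
    have i4 : Integrable (fun x => m * ((u x - G x) * r x) - c * ψ x) (volD H) := i2.sub i3
    beta_reduce at h1
    rw [integral_add i1 i4, integral_sub i2 i3, h1, integral_const_mul, integral_const_mul,
      ← hc, ← hm]
    ring

/-! ### Smooth approximation -/

/-- A bounded function is the a.e. limit of test functions with the same bound. -/
theorem exists_test_approx {H : ℝ} (hH : 0 < H) {g : ℝ → ℝ} {M : ℝ} (hM0 : 0 ≤ M)
    (hg : AEStronglyMeasurable g (volD H)) (hM : ∀ᵐ x ∂(volD H), |g x| ≤ M) :
    ∃ φ : ℕ → ℝ → ℝ, (∀ j, ContDiff ℝ ∞ (φ j) ∧ HasCompactSupport (φ j) ∧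
      tsupport (φ j) ⊆ Ioo (-H) H ∧ ∀ x, |φ j x| ≤ M) ∧
      ∀ᵐ x ∂(volD H), Tendsto (fun j => φ j x) atTop (𝓝 (g x)) := by
  set G : ℝ → ℝ := (Icc (-H) H).indicator g with hG
  have hGb : ∀ᵐ x, |G x| ≤ M := by
    filter_upwards [ae_volD_iff.1 hM] with x hx
    by_cases hxD : x ∈ Icc (-H) H
    · rw [hG, indicator_of_mem hxD]; exact hx hxD
    · rw [hG, indicator_of_notMem hxD]; simpa using hM0
  have hGi : Integrable G := by
    rw [hG, integrable_indicator_iff measurableSet_Icc]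
    exact Integrable.of_bound hg M hM
  -- The ratio of outer to inner radius is fixed at 2; almost everywhere convergence of the
  -- mollifications relies on a bounded ratio.
  let ρ : ℕ → ContDiffBump (0 : ℝ) := fun j =>
    ⟨1 / (j + 1), 2 / (j + 1), by positivity, by gcongr; norm_num⟩
  -- Cut-offs equal to one on intervals exhausting the interior of `D`. The shift by 3 keeps the
  -- inner radius positive already for `j = 0`.
  let χ : ℕ → ContDiffBump (0 : ℝ) := fun j =>
    ⟨H * (1 - 2 / (j + 3)), H * (1 - 1 / (j + 3)), by
      have : (2 : ℝ) / (j + 3) < 1 := by rw [div_lt_one (by positivity)]; linarith [j.cast_nonneg (α := ℝ)]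
      exact mul_pos hH (by linarith), by
      have : (1 : ℝ) / (j + 3) < 2 / (j + 3) := by gcongr; norm_num
      exact mul_lt_mul_of_pos_left (by linarith) hH⟩
  have hlim (c d : ℝ) : Tendsto (fun j : ℕ => c / ((j : ℝ) + d)) atTop (𝓝 0) :=
    tendsto_const_nhds.div_atTop (tendsto_natCast_atTop_atTop.atTop_add tendsto_const_nhds)
  have hconv := ContDiffBump.ae_convolution_tendsto_right_of_locallyIntegrable (φ := ρ) (K := 2)
    (l := atTop) (μ := volume) (hlim 2 1) (Eventually.of_forall fun j => le_of_eq (by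
      change (2 : ℝ) / (j + 1) = 2 * (1 / (j + 1)); ring)) hGi.locallyIntegrable
  set conv : ℕ → ℝ → ℝ := fun j =>
    (convolution ((ρ j).normed volume) G (ContinuousLinearMap.lsmul ℝ ℝ) volume) with hconvdef
  have hcb : ∀ j x, |conv j x| ≤ M := by
    intro j x
    have h1 : ∀ᵐ t, ‖(ContinuousLinearMap.lsmul ℝ ℝ) ((ρ j).normed volume t) (G (x - t))‖ ≤
        (ρ j).normed volume t * M := by
      have := (quasiMeasurePreserving_sub_left volume x).ae hGb
      filter_upwards [this] with t ht
      rw [ContinuousLinearMap.lsmul_apply, smul_eq_mul, norm_mul,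
        Real.norm_of_nonneg ((ρ j).nonneg_normed t)]
      exact mul_le_mul_of_nonneg_left ht ((ρ j).nonneg_normed t)
    have h2 := norm_integral_le_of_norm_le ((ρ j).integrable_normed.mul_const M) h1
    rw [integral_mul_const, (ρ j).integral_normed, one_mul] at h2
    exact h2
  have hts : ∀ j, tsupport (fun x => χ j x * conv j x) ⊆ Ioo (-H) H := by
    intro j
    refine (tsupport_mul_subset_left).trans ?_
    rw [(χ j).tsupport_eq, Real.closedBall_eq_Icc]
    intro x hx
    have h1 : (χ j).rOut < H := by
      change H * (1 - 1 / (j + 3)) < H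
      have : (0 : ℝ) < 1 / (j + 3) := by positivity
      nlinarith
    constructor <;> linarith [hx.1, hx.2]
  refine ⟨fun j x => χ j x * conv j x, fun j => ⟨?_, ?_, hts j, fun x => ?_⟩, ?_⟩
  · exact (χ j).contDiff.mul ((ρ j).hasCompactSupport_normed.contDiff_convolution_left _
      (ρ j).contDiff_normed hGi.locallyIntegrable)
  · exact (χ j).hasCompactSupport.mul_right
  · rw [abs_mul, abs_of_nonneg (χ j).nonneg]
    exact (mul_le_of_le_one_left (abs_nonneg _) (χ j).le_one).trans (hcb j x)
  · have hI : ∀ᵐ x ∂(volD H), x ∈ Ioo (-H) H := by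
      change ∀ᵐ x ∂(volume.restrict (Icc (-H) H)), _
      rw [← restrict_Ioo_eq_restrict_Icc]
      exact ae_restrict_mem measurableSet_Ioo
    filter_upwards [ae_restrict_of_ae hconv, hI] with x hx hxI
    have hGx : G x = g x := indicator_of_mem (Ioo_subset_Icc_self hxI) g
    rw [hGx] at hx
    refine hx.congr' ?_
    have h1 : Tendsto (fun j : ℕ => H * (1 - 2 / ((j : ℝ) + 3))) atTop (𝓝 (H * (1 - 0))) :=
      ((hlim 2 3).const_sub 1).const_mul H
    have h2 : |x| < H * (1 - 0) := by rw [sub_zero, mul_one]; exact abs_lt.2 hxI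
    filter_upwards [h1.eventually (lt_mem_nhds h2)] with j hj
    rw [(χ j).one_of_mem_closedBall (by
      rw [mem_closedBall_zero_iff]; exact hj.le), one_mul]

/-! ### Convergence criteria -/

theorem tendsto_integral_volD {H : ℝ} {F : ℕ → ℝ → ℝ} {f : ℝ → ℝ} {B : ℝ}
    (hF : ∀ n, AEStronglyMeasurable (F n) (volD H)) (hB : ∀ n, ∀ᵐ x ∂(volD H), |F n x| ≤ B)
    (hf : ∀ᵐ x ∂(volD H), Tendsto (fun n => F n x) atTop (𝓝 (f x))) :
    Tendsto (fun n => ∫ x, F n x ∂(volD H)) atTop (𝓝 (∫ x, f x ∂(volD H))) :=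
  tendsto_integral_of_dominated_convergence (fun _ => B) hF (integrable_const B) hB hf

/-- Weak convergence of bounded functions from convergence against test functions. -/
theorem tendsto_integral_mul_of_test {H : ℝ} (hH : 0 < H) {u : ℕ → ℝ → ℝ} {w : ℝ → ℝ} {K : ℝ}
    (hu : ∀ n, AEStronglyMeasurable (u n) (volD H)) (huK : ∀ n, ∀ᵐ x ∂(volD H), |u n x| ≤ K)
    (hw : AEStronglyMeasurable w (volD H)) (hwK : ∀ᵐ x ∂(volD H), |w x| ≤ K) (hK : 0 ≤ K)
    (h : ∀ φ : ℝ → ℝ, ContDiff ℝ ∞ φ → HasCompactSupport φ → tsupport φ ⊆ Ioo (-H) H →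
      Tendsto (fun n => ∫ x, u n x * φ x ∂(volD H)) atTop (𝓝 (∫ x, w x * φ x ∂(volD H))))
    {g : ℝ → ℝ} {M : ℝ} (hg : AEStronglyMeasurable g (volD H)) (hM0 : 0 ≤ M)
    (hM : ∀ᵐ x ∂(volD H), |g x| ≤ M) :
    Tendsto (fun n => ∫ x, u n x * g x ∂(volD H)) atTop (𝓝 (∫ x, w x * g x ∂(volD H))) := by
  obtain ⟨φ, hφ, hφg⟩ := exists_test_approx hH hM0 hg hM
  have hφm : ∀ j, AEStronglyMeasurable (φ j) (volD H) := fun j =>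
    (hφ j).1.continuous.aestronglyMeasurable
  have hgi : Integrable g (volD H) := Integrable.of_bound hg M hM
  have hφi : ∀ j, Integrable (φ j) (volD H) := fun j =>
    Integrable.of_bound (hφm j) M (Eventually.of_forall (hφ j).2.2.2)
  have hdi : ∀ j, Integrable (fun x => |g x - φ j x|) (volD H) := fun j => (hgi.sub (hφi j)).abs
  have hlim : Tendsto (fun j => ∫ x, |g x - φ j x| ∂(volD H)) atTop (𝓝 0) := by
    have := tendsto_integral_volD (H := H) (F := fun j x => |g x - φ j x|) (f := fun _ => 0)
      (B := 2 * M) (fun j => (hdi j).1) (fun j => by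
        filter_upwards [hM] with x hx
        rw [abs_abs]
        have := abs_sub (g x) (φ j x)
        linarith [(hφ j).2.2.2 x]) (by
        filter_upwards [hφg] with x hx
        have := (hx.const_sub (g x)).abs
        simpa using this)
    simpa using this
  -- Replacing `g` by `φ j` costs at most `K` times their `L^1` distance. The bound applies to `w`
  -- and to all `u n` at once, which permits choosing `j` before `n`.
  have hbound : ∀ v : ℝ → ℝ, AEStronglyMeasurable v (volD H) → (∀ᵐ x ∂(volD H), |v x| ≤ K) → ∀ j,
      |∫ x, v x * g x ∂(volD H) - ∫ x, v x * φ j x ∂(volD H)| ≤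
        K * ∫ x, |g x - φ j x| ∂(volD H) := by
    intro v hv hvK j
    have i1 : Integrable (fun x => v x * g x) (volD H) := hgi.bdd_mul hv hvK
    have i2 : Integrable (fun x => v x * φ j x) (volD H) := (hφi j).bdd_mul hv hvK
    rw [← integral_sub i1 i2, ← integral_const_mul]
    rw [← Real.norm_eq_abs]
    refine norm_integral_le_of_norm_le ((hdi j).const_mul K) ?_
    filter_upwards [hvK] with x hx
    rw [← mul_sub, norm_mul]
    exact mul_le_mul_of_nonneg_right hx (abs_nonneg _)
  rw [Metric.tendsto_atTop]
  intro ε hε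
  obtain ⟨j, hj⟩ := ((Metric.tendsto_atTop.1 hlim) (ε / (3 * (K + 1))) (by positivity))
  have hj' := hj j le_rfl
  have hnn : 0 ≤ ∫ x, |g x - φ j x| ∂(volD H) := integral_nonneg fun _ => abs_nonneg _
  rw [Real.dist_eq, sub_zero, abs_of_nonneg hnn, lt_div_iff₀ (by positivity)] at hj'
  obtain ⟨N, hN⟩ := Metric.tendsto_atTop.1 (h (φ j) (hφ j).1 (hφ j).2.1 (hφ j).2.2.1) (ε / 3)
    (by positivity)
  refine ⟨N, fun n hn => ?_⟩
  have h1 := hbound (u n) (hu n) (huK n) j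
  have h2 := hbound w hw hwK j
  have h3 := hN n hn
  rw [Real.dist_eq] at h3 ⊢
  rw [abs_le] at h1 h2
  rw [abs_lt] at h3 ⊢
  constructor <;> nlinarith

/-- `D` has finite measure, so `g` is integrable and `B * ‖g‖` dominates the products. -/
theorem tendstoWeakL_of_pointwise {H : ℝ} {p q : ℝ≥0∞} (hq : 1 ≤ q) {u : ℕ → ℝ → ℝ} {w : ℝ → ℝ}
    {B : ℝ} (hc : ∀ n, ContinuousOn (u n) (Icc (-H) H)) (hB : ∀ n, ∀ x ∈ Icc (-H) H, |u n x| ≤ B)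
    (hw : ∀ x ∈ Icc (-H) H, Tendsto (fun n => u n x) atTop (𝓝 (w x))) :
    TendstoWeakL H p q u w := by
  have hum : ∀ n, AEStronglyMeasurable (u n) (volD H) := fun n =>
    (hc n).aestronglyMeasurable measurableSet_Icc
  have hlim : ∀ᵐ x ∂(volD H), Tendsto (fun n => u n x) atTop (𝓝 (w x)) :=
    (ae_mem_volD H).mono hw
  have hub : ∀ n, ∀ᵐ x ∂(volD H), ‖u n x‖ ≤ B := fun n => (ae_mem_volD H).mono (hB n)
  have hwb : ∀ᵐ x ∂(volD H), ‖w x‖ ≤ B := by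
    filter_upwards [ae_mem_volD H] with x hx
    exact le_of_tendsto (hw x hx).norm (Eventually.of_forall fun n => hB n x hx)
  have hwm : AEStronglyMeasurable w (volD H) := aestronglyMeasurable_of_tendsto_ae _ hum hlim
  refine ⟨fun n => MemLp.of_bound (hum n) B (hub n), MemLp.of_bound hwm B hwb, fun g hg => ?_⟩
  have hgi : Integrable g (volD H) := memLp_one_iff_integrable.1 (hg.mono_exponent hq)
  refine tendsto_integral_of_dominated_convergence (fun x => B * ‖g x‖)
    (fun n => (hum n).mul hg.1) (hgi.norm.const_mul B) (fun n => ?_) ?_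
  · filter_upwards [hub n] with x hx
    rw [norm_mul]
    exact mul_le_mul_of_nonneg_right hx (norm_nonneg _)
  · filter_upwards [hlim] with x hx using hx.mul_const _

theorem tendstoL_two_of_pointwise {H : ℝ} {u : ℕ → ℝ → ℝ} {w : ℝ → ℝ}
    {B : ℝ} (hc : ∀ n, ContinuousOn (u n) (Icc (-H) H)) (hB : ∀ n, ∀ x ∈ Icc (-H) H, |u n x| ≤ B)
    (hw : ∀ x ∈ Icc (-H) H, Tendsto (fun n => u n x) atTop (𝓝 (w x))) :
    TendstoL H 2 u w := by
  obtain ⟨h1, h2, -⟩ := tendstoWeakL_of_pointwise (p := 2) (q := 1) le_rfl hc hB hw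
  refine ⟨h1, h2, ?_⟩
  have hwb : ∀ x ∈ Icc (-H) H, |w x| ≤ B := fun x hx =>
    le_of_tendsto (hw x hx).abs (Eventually.of_forall fun n => hB n x hx)
  have hm : ∀ n, MemLp (fun x => u n x - w x) 2 (volD H) := fun n => (h1 n).sub h2
  have hI : Tendsto (fun n => ∫ x, |u n x - w x| ^ (2 : ℝ) ∂(volD H)) atTop (𝓝 0) := by
    have := tendsto_integral_volD (H := H) (F := fun n x => |u n x - w x| ^ (2 : ℝ))
      (f := fun _ => 0) (B := (2 * B) ^ 2) (fun n => by
        simp only [Real.rpow_two]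
        exact ((hm n).1.norm.pow 2)) (fun n => by
        filter_upwards [ae_mem_volD H] with x hx
        rw [Real.rpow_two, abs_pow, abs_abs]
        have := abs_sub (u n x) (w x)
        have h3 := hB n x hx
        have h4 := hwb x hx
        gcongr
        linarith) (by
        filter_upwards [ae_mem_volD H] with x hx
        have := (((hw x hx).sub_const (w x)).abs).pow 2
        simpa using this)
    simpa using this
  have h2' : (2 : ℝ≥0∞) ≠ 0 := by norm_num
  have : ∀ n, eLpNorm (fun x => u n x - w x) 2 (volD H) =
      ENNReal.ofReal ((∫ x, |u n x - w x| ^ (2 : ℝ) ∂(volD H)) ^ (2 : ℝ)⁻¹) := fun n => by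
    rw [(hm n).eLpNorm_eq_integral_rpow_norm h2' (by norm_num)]
    simp [Real.norm_eq_abs]
  simp only [this]
  rw [← ENNReal.ofReal_zero]
  refine ENNReal.tendsto_ofReal ?_
  have := hI.rpow_const (p := (2 : ℝ)⁻¹) (Or.inr (by norm_num))
  simpa using this

/-- Sequential compactness of countable families of bounded, equi-Lipschitz sequences. -/
theorem exists_subseq_tendsto_of_lipschitz {ι : Type*} [Countable ι] {a b : ℝ} (hab : a ≤ b)
    (f : ι → ℕ → ℝ → ℝ) (B L : ι → ℝ)
    (hB : ∀ i n, ∀ x ∈ Icc a b, |f i n x| ≤ B i)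
    (hL : ∀ i n, ∀ x ∈ Icc a b, ∀ y ∈ Icc a b, |f i n x - f i n y| ≤ L i * |x - y|) :
    ∃ k : ℕ → ℕ, StrictMono k ∧ ∃ g : ι → ℝ → ℝ, ∀ i, ∀ x ∈ Icc a b,
      Tendsto (fun n => f i (k n) x) atTop (𝓝 (g i x)) := by
  set pr : ℝ → ℝ := fun x => projIcc a b hab x with hpr
  have hprm : ∀ x, pr x ∈ Icc a b := fun x => (projIcc a b hab x).2
  have hpre : ∀ x ∈ Icc a b, pr x = x := fun x hx => by rw [hpr]; simp [projIcc_of_mem hab hx]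
  have hprl : ∀ x y, |pr x - pr y| ≤ |x - y| := fun x y => by
    have := (LipschitzWith.projIcc (h := hab)).dist_le_mul x y
    simpa [Subtype.dist_eq, Real.dist_eq] using this
  -- The diagonal argument in the form of sequential compactness of a countable product: all values
  -- at rational points, projected into the interval, form a sequence in a product of compact
  -- intervals. The Lipschitz bounds carry the convergence over to all points.
  obtain ⟨w, -, k, hk, hw⟩ := (isCompact_univ_pi (X := fun _ : ι × ℚ => ℝ)
    (s := fun z => Icc (-B z.1) (B z.1)) fun z => isCompact_Icc).tendsto_subseq
    (x := fun n z => f z.1 n (pr z.2)) fun n z _ => abs_le.1 (hB z.1 n _ (hprm _))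
  rw [tendsto_pi_nhds] at hw
  refine ⟨k, hk, ?_⟩
  have key : ∀ i, ∀ x ∈ Icc a b, CauchySeq fun n => f i (k n) x := by
    intro i x hx
    rw [Metric.cauchySeq_iff]
    intro ε hε
    set l := |L i| + 1 with hl
    have hl0 : 0 < l := by positivity
    obtain ⟨q, hq1, hq2⟩ := exists_rat_btwn (show x < x + ε / (3 * l) by
      have : 0 < ε / (3 * l) := by positivity
      linarith)
    have hclose : ∀ n, |f i n x - f i n (pr q)| < ε / 3 := by
      intro n
      have h1 := hL i n x hx (pr q) (hprm _)
      have h2 : |x - pr q| ≤ |x - q| := by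
        have := hprl x q
        rwa [hpre x hx] at this
      have h3 : |x - (q : ℝ)| < ε / (3 * l) := by
        rw [abs_sub_comm, abs_of_pos (by linarith)]; linarith
      have h4 : |x - pr q| * l < ε / 3 := by
        have := h2.trans_lt h3
        rw [lt_div_iff₀ (by positivity)] at this
        linarith
      have h5 : L i * |x - pr q| ≤ |x - pr q| * l := by
        rw [mul_comm]
        exact mul_le_mul_of_nonneg_left (by linarith [le_abs_self (L i)]) (abs_nonneg _)
      linarith
    obtain ⟨N, hN⟩ := Metric.cauchySeq_iff.1 (hw (i, q)).cauchySeq (ε / 3) (by positivity)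
    refine ⟨N, fun m hm n hn => ?_⟩
    have h1 := hclose (k m)
    have h2 := hclose (k n)
    have h3 := hN m hm n hn
    simp only [Function.comp, Real.dist_eq] at h3 ⊢
    rw [abs_lt] at *
    constructor <;> linarith
  choose! g hg using fun i x hx => cauchySeq_tendsto_of_complete (key i x hx)
  exact ⟨g, hg⟩

/-! ### Pointwise estimates on an interval -/

theorem abs_sub_le_of_hasDerivWithinAt {a b : ℝ} {u u' : ℝ → ℝ} {L : ℝ}
    (hd : ∀ x ∈ Icc a b, HasDerivWithinAt u (u' x) (Icc a b) x)
    (hL : ∀ x ∈ Icc a b, |u' x| ≤ L) : ∀ x ∈ Icc a b, ∀ y ∈ Icc a b, |u x - u y| ≤ L * |x - y| :=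
  fun _ hx _ hy => (convex_Icc a b).norm_image_sub_le_of_norm_hasDerivWithin_le hd hL hy hx

/-- Equal boundary values and a bound on `u''` bound `u'`. -/
theorem abs_deriv_le_of_abs_deriv2_le {a b : ℝ} (hab : a < b) {u u' u'' : ℝ → ℝ} {L : ℝ}
    (hd : ∀ x ∈ Icc a b, HasDerivWithinAt u (u' x) (Icc a b) x)
    (hd' : ∀ x ∈ Icc a b, HasDerivWithinAt u' (u'' x) (Icc a b) x)
    (hL : ∀ x ∈ Icc a b, |u'' x| ≤ L) (huab : u a = u b) :
    ∀ x ∈ Icc a b, |u' x| ≤ L * (b - a) := by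
  obtain ⟨c, hc, hc0⟩ := exists_hasDerivAt_eq_zero hab
    (fun x hx => (hd x hx).continuousWithinAt) huab
    fun x hx => (hd x (Ioo_subset_Icc_self hx)).hasDerivAt (Icc_mem_nhds hx.1 hx.2)
  intro x hx
  have h := abs_sub_le_of_hasDerivWithinAt hd' hL x hx c (Ioo_subset_Icc_self hc)
  rw [hc0, sub_zero] at h
  have hL0 : 0 ≤ L := (abs_nonneg _).trans (hL x hx)
  refine h.trans (mul_le_mul_of_nonneg_left ?_ hL0)
  rw [abs_le]
  constructor <;> linarith [hx.1, hx.2, hc.1, hc.2]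

/-- Minimum principle: `u` is concave where it is negative, and non-negative at the end points. -/
theorem nonneg_of_concave_of_neg {a b : ℝ} {u u' : ℝ → ℝ}
    (hd : ∀ x ∈ Icc a b, HasDerivWithinAt u (u' x) (Icc a b) x) (ha : 0 ≤ u a) (hb : 0 ≤ u b)
    (h : ∀ x ∈ Icc a b, ∀ y ∈ Icc a b, x ≤ y → (∀ z ∈ Icc x y, u z < 0) → u' y ≤ u' x) :
    ∀ x ∈ Icc a b, 0 ≤ u x := by
  have hc : ContinuousOn u (Icc a b) := fun x hx => (hd x hx).continuousWithinAt
  intro x hx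
  -- At a negative interior minimum `m` the slope is zero. Up to the first `c > m` with `u c ≥ 0`
  -- the function is negative, so concavity keeps the slope non-positive and `u c ≤ u m < 0`, a
  -- contradiction.
  obtain ⟨m, hm, hmin⟩ := isCompact_Icc.exists_isMinOn ⟨x, hx⟩ hc
  refine le_trans ?_ (hmin hx)
  by_contra! hneg
  have hma : a < m := lt_of_le_of_ne hm.1 fun e => by rw [e] at ha; linarith
  have hmb : m < b := lt_of_le_of_ne hm.2 fun e => by rw [← e] at hb; linarith
  have hm0 : u' m = 0 := by
    have hloc : IsLocalMin u m := hmin.isLocalMin (Icc_mem_nhds hma hmb)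
    exact hloc.hasDerivAt_eq_zero ((hd m hm).hasDerivAt (Icc_mem_nhds hma hmb))
  have hmsub : Icc m b ⊆ Icc a b := Icc_subset_Icc hma.le le_rfl
  have hScl : IsClosed (Icc m b ∩ u ⁻¹' Ici 0) :=
    (hc.mono hmsub).preimage_isClosed_of_isClosed isClosed_Icc isClosed_Ici
  have hScp : IsCompact (Icc m b ∩ u ⁻¹' Ici 0) :=
    isCompact_Icc.of_isClosed_subset hScl inter_subset_left
  obtain ⟨c, ⟨hcI, hc0⟩, hcmin⟩ := hScp.exists_isLeast ⟨b, right_mem_Icc.2 hmb.le, hb⟩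
  have hmc : m < c := lt_of_le_of_ne hcI.1 fun e => by
    rw [← e] at hc0; exact absurd hc0 (not_le.2 hneg)
  have hcsub : Icc m c ⊆ Icc a b := (Icc_subset_Icc le_rfl hcI.2).trans hmsub
  have hlt : ∀ z ∈ Ico m c, u z < 0 := fun z hz => by
    by_contra! hz0
    exact absurd (hcmin ⟨⟨hz.1, hz.2.le.trans hcI.2⟩, hz0⟩) (not_le.2 hz.2)
  have hanti : AntitoneOn u (Icc m c) := by
    refine antitoneOn_of_hasDerivWithinAt_nonpos (convex_Icc m c) (hc.mono hcsub) (f' := u')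
      (fun z hz => ((hd z (hcsub (interior_subset hz))).mono (interior_subset.trans hcsub)))
      fun z hz => ?_
    rw [interior_Icc] at hz
    rw [← hm0]
    exact h m hm z (hcsub (Ioo_subset_Icc_self hz)) hz.1.le
      fun y hy => hlt y ⟨hy.1, hy.2.trans_lt hz.2⟩
  have h1 := hanti (left_mem_Icc.2 hmc.le) (right_mem_Icc.2 hmc.le) hmc.le
  have h2 : 0 ≤ u c := hc0
  linarith

theorem nonneg_of_deriv2_nonpos_of_neg {a b : ℝ} {u u' u'' : ℝ → ℝ}
    (hd : ∀ x ∈ Icc a b, HasDerivWithinAt u (u' x) (Icc a b) x)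
    (hd' : ∀ x ∈ Icc a b, HasDerivWithinAt u' (u'' x) (Icc a b) x) (ha : 0 ≤ u a) (hb : 0 ≤ u b)
    (h : ∀ x ∈ Icc a b, u x < 0 → u'' x ≤ 0) : ∀ x ∈ Icc a b, 0 ≤ u x := by
  refine nonneg_of_concave_of_neg hd ha hb fun x hx y hy hxy hneg => ?_
  have hsub : Icc x y ⊆ Icc a b := Icc_subset_Icc hx.1 hy.2
  have hanti : AntitoneOn u' (Icc x y) :=
    antitoneOn_of_hasDerivWithinAt_nonpos (convex_Icc x y)
      (fun z hz => (hd' z (hsub hz)).continuousWithinAt.mono hsub) (f' := u'')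
      (fun z hz => (hd' z (hsub (interior_subset hz))).mono (interior_subset.trans hsub))
      fun z hz => h z (hsub (interior_subset hz)) (hneg z (interior_subset hz))
  exact hanti (left_mem_Icc.2 hxy) (right_mem_Icc.2 hxy) hxy

/-- Minimum principle for functions whose derivative is a primitive of `w`. -/
theorem nonneg_of_weak_deriv2_nonpos_of_neg {H c : ℝ} (hH : 0 < H) {u u' w : ℝ → ℝ}
    (hd : ∀ x ∈ Icc (-H) H, HasDerivWithinAt u (u' x) (Icc (-H) H) x)
    (hw : Integrable w (volD H)) (hu' : ∀ x ∈ Icc (-H) H, u' x = c + ∫ y in (-H)..x, w y)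
    (ha : 0 ≤ u (-H)) (hb : 0 ≤ u H) (h : ∀ᵐ x ∂(volD H), u x < 0 → w x ≤ 0) :
    ∀ x ∈ Icc (-H) H, 0 ≤ u x := by
  refine nonneg_of_concave_of_neg hd ha hb fun x hx y hy hxy hneg => ?_
  have hwi := (integrable_volD_iff hH.le w).1 hw
  have hsubi : ∀ {a b : ℝ}, a ∈ Icc (-H) H → b ∈ Icc (-H) H → IntervalIntegrable w volume a b := by
    intro a b ha hb
    refine hwi.mono_set ?_
    rw [uIcc_of_le (by linarith : -H ≤ H)]
    exact uIcc_subset_Icc ha hb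
  have hadd := intervalIntegral.integral_add_adjacent_intervals
    (hsubi (left_mem_Icc.2 (by linarith)) hx) (hsubi hx hy)
  have hle : ∫ z in x..y, w z ≤ 0 := by
    rw [intervalIntegral.integral_of_le hxy]
    refine integral_nonpos_of_ae ?_
    rw [EventuallyLE, ae_restrict_iff' measurableSet_Ioc]
    filter_upwards [ae_volD_iff.1 h] with z hz hz'
    exact hz ⟨hx.1.trans hz'.1.le, hz'.2.trans hy.2⟩ (hneg z ⟨hz'.1.le, hz'.2⟩)
  rw [hu' x hx, hu' y hy]
  linarith

theorem exists_test_integral_one {H : ℝ} (hH : 0 < H) :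
    ∃ ρ : ℝ → ℝ, ContDiff ℝ ∞ ρ ∧ HasCompactSupport ρ ∧ tsupport ρ ⊆ Ioo (-H) H ∧
      ∫ x, ρ x ∂(volD H) = 1 := by
  let ρ : ContDiffBump (0 : ℝ) := ⟨H / 4, H / 2, by positivity, by linarith⟩
  have hrs : tsupport (ρ.normed volume) ⊆ Ioo (-H) H := by
    rw [ρ.tsupport_normed_eq, Real.closedBall_eq_Icc]
    intro x hx
    have h1 : ρ.rOut = H / 2 := rfl
    rw [h1] at hx
    constructor <;> linarith [hx.1, hx.2]
  refine ⟨ρ.normed volume, ρ.contDiff_normed, ρ.hasCompactSupport_normed, hrs, ?_⟩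
  rw [← ρ.integral_normed (μ := volume)]
  refine setIntegral_eq_integral_of_forall_compl_eq_zero fun x hx => ?_
  exact eq_zero_of_tsupport_subset hrs fun h => hx (Ioo_subset_Icc_self h)

/-! ### Regular representatives of the plastic rate. -/

/-- Second-order regularity of the plastic rate: `p₁` is the classical derivative of `p`, and
`p₂ ∈ L^∞` is the derivative of `p₁` in the sense of primitives. -/
structure IsRegularRate (H : ℝ) (p p₁ p₂ : ℝ → ℝ) : Prop where
  memLp : MemLp p₂ ∞ (volD H)
  primitive : ∃ c, ∀ x, p₁ x = c + ∫ y in (-H)..x, p₂ y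
  hasDeriv : ∀ x ∈ Icc (-H) H, HasDerivWithinAt p (p₁ x) (Icc (-H) H) x
  test : ∀ φ : ℝ → ℝ, ContDiff ℝ ∞ φ → HasCompactSupport φ → tsupport φ ⊆ Ioo (-H) H →
    ∫ x, p₂ x * φ x ∂(volD H) = ∫ x, p x * deriv (deriv φ) x ∂(volD H)

theorem IsRegularRate.integrable {H : ℝ} {p p₁ p₂ : ℝ → ℝ} (h : IsRegularRate H p p₁ p₂) :
    Integrable p₂ (volD H) := memLp_one_iff_integrable.1 (h.memLp.mono_exponent le_top)

/-- Weak derivatives are determined only almost everywhere, so `p₁` is replaced by the primitive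
`q₁` of `p₂`, which is continuous. Then `p` agrees almost everywhere with a primitive of `q₁`, and
by continuity of both sides everywhere, which makes `q₁` a classical derivative. -/
theorem isRegularRate_of_isWeakDeriv {H : ℝ} (hH : 0 < H) {p p₁ p₂ : ℝ → ℝ}
    (hc : ContinuousOn p (Icc (-H) H)) (h₁ : MemLp p₁ ∞ (volD H)) (h₂ : MemLp p₂ ∞ (volD H))
    (hw₁ : IsWeakDeriv H p p₁) (hw₂ : IsWeakDeriv H p₁ p₂) :
    ∃ q₁, IsRegularRate H p q₁ p₂ := by
  have i1 : Integrable p₁ (volD H) := memLp_one_iff_integrable.1 (h₁.mono_exponent le_top)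
  have i2 : Integrable p₂ (volD H) := memLp_one_iff_integrable.1 (h₂.mono_exponent le_top)
  obtain ⟨c, hcc⟩ := hw₂.ae_eq_primitive hH i1 i2
  set q₁ : ℝ → ℝ := fun x => c + ∫ y in (-H)..x, p₂ y with hq₁
  have hq₁c : ContinuousOn q₁ (Icc (-H) H) := by
    have := (((integrable_volD_iff hH.le _).1 i2).absolutelyContinuousOnInterval_intervalIntegral
      left_mem_uIcc).continuousOn
    rw [uIcc_of_le (by linarith)] at this
    exact continuousOn_const.add this
  have hq₁i : Integrable q₁ (volD H) := hq₁c.integrableOn_compact isCompact_Icc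
  have hw₁' : IsWeakDeriv H p q₁ := by
    intro φ hφ hφc hφs
    rw [hw₁ φ hφ hφc hφs, neg_inj]
    refine integral_congr_ae ?_
    filter_upwards [hcc] with x hx
    rw [hx]
  obtain ⟨d, hd⟩ := hw₁'.ae_eq_primitive hH (hc.integrableOn_compact isCompact_Icc) hq₁i
  have hGc : ContinuousOn (fun x => d + ∫ y in (-H)..x, q₁ y) (Icc (-H) H) := by
    have := (((integrable_volD_iff hH.le _).1 hq₁i).absolutelyContinuousOnInterval_intervalIntegral
      left_mem_uIcc).continuousOn
    rw [uIcc_of_le (by linarith)] at this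
    exact continuousOn_const.add this
  have heq := Measure.eqOn_Icc_of_ae_eq volume (by linarith : -H ≠ H) hd hc hGc
  refine ⟨q₁, h₂, ⟨c, fun _ => rfl⟩, fun x hx => hasDerivWithinAt_of_primitive hq₁c heq hx, ?_⟩
  intro φ hφ hφc hφs
  have hφs' : tsupport (deriv φ) ⊆ Ioo (-H) H :=
    tsupport_deriv_subset.trans hφs
  have e1 := hw₂ φ hφ hφc hφs
  have e2 := hw₁ _ (contDiff_infty_iff_deriv.1 hφ).2 hφc.deriv hφs'
  linarith

theorem IsRegularRate.absolutelyContinuous {H : ℝ} (hH : 0 < H) {p p₁ p₂ : ℝ → ℝ}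
    (h : IsRegularRate H p p₁ p₂) : AbsolutelyContinuousOnInterval p₁ (-H) H := by
  obtain ⟨c, hc⟩ := h.primitive
  rw [show p₁ = fun x => c + ∫ y in (-H)..x, p₂ y from funext hc]
  exact ((LipschitzWith.const c).lipschitzOnWith.absolutelyContinuousOnInterval (K := 0)).add
    (((integrable_volD_iff hH.le _).1 h.integrable).absolutelyContinuousOnInterval_intervalIntegral
      left_mem_uIcc)

/-- `∫ p p'' = -∫ (p')² ≤ 0` if `p` vanishes at the end points. -/
theorem IsRegularRate.integral_mul_nonpos {H : ℝ} (hH : 0 < H) {p p₁ p₂ : ℝ → ℝ}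
    (h : IsRegularRate H p p₁ p₂) (hl : p (-H) = 0) (hr : p H = 0) :
    ∫ x, p₂ x * p x ∂(volD H) ≤ 0 := by
  have hH' : -H ≤ H := by linarith
  have hac := h.absolutelyContinuous hH
  have hc : ContinuousOn p₁ (Icc (-H) H) := by
    have := hac.continuousOn
    rwa [uIcc_of_le hH'] at this
  obtain ⟨L, hL⟩ := isCompact_Icc.exists_bound_of_continuousOn hc
  have hpac : AbsolutelyContinuousOnInterval p (-H) H := by
    refine LipschitzOnWith.absolutelyContinuousOnInterval (K := L.toNNReal) ?_
    rw [uIcc_of_le hH']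
    refine LipschitzOnWith.of_dist_le_mul fun x hx y hy => ?_
    rw [Real.dist_eq, Real.dist_eq, Real.coe_toNNReal _ ((norm_nonneg _).trans (hL x hx))]
    exact abs_sub_le_of_hasDerivWithinAt h.hasDeriv hL x hx y hy
  -- Integration by parts for absolutely continuous functions: `p₁` is a primitive of an integrable
  -- function, and `p` is Lipschitz because `p₁` is bounded.
  have key := hac.integral_mul_deriv_eq_deriv_mul hpac
  rw [hl, hr, mul_zero, mul_zero, sub_zero, zero_sub] at key
  have e1 : ∫ x in (-H)..H, p₁ x * deriv p x = ∫ x in (-H)..H, p₁ x * p₁ x := by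
    refine intervalIntegral.integral_congr_ae ?_
    have hne : ∀ᵐ x : ℝ, x ≠ H := by simp [ae_iff]
    filter_upwards [hne] with x hx hx'
    rw [uIoc_of_le hH'] at hx'
    rw [((h.hasDeriv x ⟨hx'.1.le, hx'.2⟩).hasDerivAt
      (Icc_mem_nhds hx'.1 (lt_of_le_of_ne hx'.2 hx))).deriv]
  have e2 : ∫ x in (-H)..H, deriv p₁ x * p x = ∫ x in (-H)..H, p₂ x * p x := by
    obtain ⟨c, hc⟩ := h.primitive
    refine intervalIntegral.integral_congr_ae ?_
    filter_upwards [((integrable_volD_iff hH.le _).1 h.integrable).ae_hasDerivAt_integral]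
      with x hx hx'
    have := ((hx (uIoc_subset_uIcc hx') (-H) left_mem_uIcc).const_add c).deriv
    rw [show p₁ = fun x => c + ∫ y in (-H)..x, p₂ y from funext hc, this]
  rw [e1, e2] at key
  have hnn : 0 ≤ ∫ x in (-H)..H, p₁ x * p₁ x :=
    intervalIntegral.integral_nonneg hH' fun x _ => mul_self_nonneg _
  rw [integral_volD hH.le]
  linarith

/-! ### A priori estimates uniform in the viscosity. -/

namespace Data

variable {P : Data}

theorem Standing.neg_le (hP : P.Standing) : -P.H ≤ P.H := by linarith [hP.H_pos]

/-- The right-hand side of the damage equation solved for `α''`, at constant stress `s`. -/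
noncomputable def damageRhs (P : Data) (a s : ℝ) : ℝ :=
  (1 / 2 * deriv P.C a * (s / P.C a) ^ 2 + P.Gc * ((a - 1) / P.ℓ ^ 2)) / (P.Gc * P.ℓ ^ 2)

/-- The right-hand side of the aging equation solved for `θ''`. -/
noncomputable def agingRhs (P : Data) (p t : ℝ) : ℝ := (|p| * P.f₁ t - P.f₀ t) / P.κ

theorem Standing.C_ne (hP : P.Standing) (a : ℝ) : P.C a ≠ 0 := by
  obtain ⟨c, hc, h⟩ := hP.C_pos
  exact (hc.trans_le (h a)).ne'

theorem Standing.damageRhs_cont (hP : P.Standing) :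
    Continuous fun z : ℝ × ℝ => P.damageRhs z.1 z.2 := by
  have h1 : Continuous (deriv P.C) := hP.C_smooth.continuous_deriv le_rfl
  have h2 : Continuous P.C := hP.C_smooth.continuous
  unfold damageRhs
  refine Continuous.div_const (((continuous_const.mul (h1.comp continuous_fst)).mul
    ((continuous_snd.div (h2.comp continuous_fst) fun z => hP.C_ne _).pow 2)).add ?_) _
  fun_prop

theorem Standing.agingRhs_cont (hP : P.Standing) :
    Continuous fun z : ℝ × ℝ => P.agingRhs z.1 z.2 := by
  have h1 := hP.f₀_cont
  have h2 := hP.f₁_cont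
  unfold agingRhs
  fun_prop

namespace Balance

variable {ε v π α θ : ℝ → ℝ} {σ : ℝ}

/-- Constancy of the stress eliminates the strain, `ε = σ / C(α)`. The second derivative of `α`
becomes a continuous function of `(α, σ)` alone, suited to bounds and to limits. -/
theorem exists_damage_deriv (hP : P.Standing) (h : P.Balance ε v π α θ σ) :
    ∃ α₁ : ℝ → ℝ, (∀ x ∈ Icc (-P.H) P.H, HasDerivWithinAt α (α₁ x) (Icc (-P.H) P.H) x) ∧
      ∀ x ∈ Icc (-P.H) P.H,
        HasDerivWithinAt α₁ (P.damageRhs (α x) σ) (Icc (-P.H) P.H) x := by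
  obtain ⟨α₂, ⟨α₁, h1, h2⟩, heq⟩ := h.damage
  refine ⟨α₁, h1, fun x hx => ?_⟩
  have hG := hP.Gc_pos.ne'
  have hl := hP.ℓ_pos.ne'
  have hε : ε x = σ / P.C (α x) := by
    rw [eq_div_iff (hP.C_ne _), mul_comm]; exact h.stress x hx
  have : P.damageRhs (α x) σ = α₂ x := by
    have := heq x hx
    rw [hε] at this
    unfold damageRhs
    rw [this]
    field_simp
  rw [this]
  exact h2 x hx

theorem exists_aging_deriv (hP : P.Standing) (h : P.Balance ε v π α θ σ) :
    ∃ θ₁ : ℝ → ℝ, (∀ x ∈ Icc (-P.H) P.H, HasDerivWithinAt θ (θ₁ x) (Icc (-P.H) P.H) x) ∧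
      ∀ x ∈ Icc (-P.H) P.H,
        HasDerivWithinAt θ₁ (P.agingRhs (π x) (θ x)) (Icc (-P.H) P.H) x := by
  obtain ⟨θ₂, ⟨θ₁, h1, h2⟩, heq⟩ := h.aging
  refine ⟨θ₁, h1, fun x hx => ?_⟩
  have : P.agingRhs (π x) (θ x) = θ₂ x := by
    have := heq x hx
    unfold agingRhs
    rw [this, mul_div_cancel_left₀ _ hP.κ_pos.ne']
  rw [this]
  exact h2 x hx

/-- Minimum principle for `θ` and `thInf - θ`: where `θ < 0`, monotonicity gives `f₁ ≤ 0 ≤ f₀` and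
so `θ'' ≤ 0`; where `θ > thInf`, both signs are reversed. -/
theorem theta_mem (hP : P.Standing) (h : P.Balance ε v π α θ σ) :
    ∀ x ∈ Icc (-P.H) P.H, θ x ∈ Icc 0 P.thInf := by
  obtain ⟨θ₁, h1, h2⟩ := h.exists_aging_deriv hP
  have hκ := hP.κ_pos
  have hlow := nonneg_of_deriv2_nonpos_of_neg h1 h2 (by rw [h.θ_left]; exact hP.thInf_pos.le)
    (by rw [h.θ_right]; exact hP.thInf_pos.le) fun x _ hneg => by
      have e1 : P.f₁ (θ x) ≤ 0 := hP.f₁_zero ▸ hP.f₁_mono hneg.le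
      have e2 : 0 ≤ P.f₀ (θ x) := hP.f₀_thInf ▸ hP.f₀_anti (hneg.le.trans hP.thInf_pos.le)
      have := mul_nonpos_of_nonneg_of_nonpos (abs_nonneg (π x)) e1
      exact div_nonpos_of_nonpos_of_nonneg (by linarith) hκ.le
  have hup := nonneg_of_deriv2_nonpos_of_neg (u := fun x => P.thInf - θ x)
    (fun x hx => (h1 x hx).const_sub P.thInf) (fun x hx => (h2 x hx).neg)
    (by rw [h.θ_left, sub_self]) (by rw [h.θ_right, sub_self]) fun x _ hneg => by
      have hlt : P.thInf ≤ θ x := by linarith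
      have e1 : 0 ≤ P.f₁ (θ x) := hP.f₁_zero ▸ hP.f₁_mono (hP.thInf_pos.le.trans hlt)
      have e2 : P.f₀ (θ x) ≤ 0 := hP.f₀_thInf ▸ hP.f₀_anti hlt
      have := mul_nonneg (abs_nonneg (π x)) e1
      exact neg_nonpos.2 (div_nonneg (by linarith) hκ.le)
  exact fun x hx => ⟨hlow x hx, by linarith [hup x hx]⟩

theorem theta_cont (h : P.Balance ε v π α θ σ) : ContinuousOn θ (Icc (-P.H) P.H) := by
  obtain ⟨θ₂, ⟨θ₁, h1, h2⟩, heq⟩ := h.aging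
  exact fun x hx => (h1 x hx).continuousWithinAt

theorem alpha_cont (h : P.Balance ε v π α θ σ) : ContinuousOn α (Icc (-P.H) P.H) := by
  obtain ⟨α₂, ⟨α₁, h1, h2⟩, heq⟩ := h.damage
  exact fun x hx => (h1 x hx).continuousWithinAt

/-- The conserved energy of the damage equation bounds `α`. -/
theorem sq_alpha_sub_one_le (hP : P.Standing) (h : P.Balance ε v π α θ σ) {c : ℝ} (hc : 0 < c)
    (hC : ∀ a, c ≤ P.C a) :
    ∀ x ∈ Icc (-P.H) P.H, (α x - 1) ^ 2 ≤ P.ℓ ^ 2 * σ ^ 2 / (P.Gc * c) := by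
  obtain ⟨α₁, h1, h2⟩ := h.exists_damage_deriv hP
  have hG := hP.Gc_pos
  have hl := hP.ℓ_pos
  -- The damage equation is autonomous and second order at constant stress; this is its first
  -- integral, found by multiplying by `α₁`.
  set E : ℝ → ℝ := fun x => P.Gc * P.ℓ ^ 2 * α₁ x ^ 2 / 2 + σ ^ 2 / 2 * (P.C (α x))⁻¹ -
    P.Gc * (α x - 1) ^ 2 / (2 * P.ℓ ^ 2) with hE
  have hEd : ∀ x ∈ Icc (-P.H) P.H, HasDerivWithinAt E 0 (Icc (-P.H) P.H) x := by
    intro x hx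
    have hCd : HasDerivAt P.C (deriv P.C (α x)) (α x) :=
      (hP.C_smooth.differentiable (by norm_num) _).hasDerivAt
    have hCne := hP.C_ne (α x)
    have d1 := (((h2 x hx).fun_pow 2).const_mul (P.Gc * P.ℓ ^ 2)).div_const 2
    have d2 := ((hCd.comp_hasDerivWithinAt x (h1 x hx)).fun_inv hCne).const_mul (σ ^ 2 / 2)
    have d3 := ((((h1 x hx).sub_const 1).fun_pow 2).const_mul P.Gc).div_const (2 * P.ℓ ^ 2)
    refine ((d1.add d2).sub d3).congr_deriv ?_
    simp only [damageRhs, Function.comp]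
    field_simp
    ring
  have hEc : ∀ x ∈ Icc (-P.H) P.H, E x = E (-P.H) := by
    intro x hx
    have := abs_sub_le_of_hasDerivWithinAt hEd (L := 0) (by simp) x hx _
      (left_mem_Icc.2 hP.neg_le)
    rw [zero_mul] at this
    exact sub_eq_zero.1 (abs_nonpos_iff.1 this)
  have hc2 : ContinuousOn (fun x => (α x - 1) ^ 2) (Icc (-P.H) P.H) :=
    (h.alpha_cont.sub continuousOn_const).pow 2
  have hrhs : 0 ≤ P.ℓ ^ 2 * σ ^ 2 / (P.Gc * c) := by positivity
  intro x hx
  -- At a maximum of `(α - 1) ^ 2` with `α m ≠ 1` the kinetic term of `E` vanishes. Since `E` at the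
  -- left end point is non-negative, the quadratic term is at most the elastic term `σ ^ 2 / (2
  -- C(α))`.
  obtain ⟨m, hm, hmax⟩ := isCompact_Icc.exists_isMaxOn ⟨x, hx⟩ hc2
  refine (hmax hx).trans ?_
  by_cases hm1 : α m = 1
  · simpa [hm1] using hrhs
  have hma : -P.H < m := lt_of_le_of_ne hm.1 fun e => hm1 (e ▸ h.α_left)
  have hmb : m < P.H := lt_of_le_of_ne hm.2 fun e => hm1 (e ▸ h.α_right)
  have hnhds := Icc_mem_nhds hma hmb
  have hcrit := (hmax.isLocalMax hnhds).hasDerivAt_eq_zero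
    ((((h1 m hm).hasDerivAt hnhds).sub_const 1).fun_pow 2)
  have hα0 : α₁ m = 0 := by
    have : α m - 1 ≠ 0 := sub_ne_zero.2 hm1
    simpa [this] using hcrit
  have hen := hEc m hm
  simp only [hE, hα0, h.α_left, sub_self] at hen
  have hpos : 0 ≤ P.Gc * P.ℓ ^ 2 * α₁ (-P.H) ^ 2 / 2 + σ ^ 2 / 2 * (P.C 1)⁻¹ := by
    have := hc.trans_le (hC 1)
    positivity
  have hinv : (P.C (α m))⁻¹ ≤ c⁻¹ := inv_anti₀ hc (hC _)
  have hinv2 := mul_le_mul_of_nonneg_left hinv (by positivity : 0 ≤ σ ^ 2 / 2)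
  have hfin : P.Gc * (α m - 1) ^ 2 / (2 * P.ℓ ^ 2) ≤ σ ^ 2 / 2 * c⁻¹ := by
    simp only [ne_eq, OfNat.ofNat_ne_zero, not_false_eq_true, zero_pow, mul_zero, zero_div,
      zero_add, sub_zero] at hen
    linarith
  rw [div_le_iff₀ (by positivity)] at hfin
  rw [le_div_iff₀ (by positivity)]
  calc (α m - 1) ^ 2 * (P.Gc * c) = (P.Gc * (α m - 1) ^ 2) * c := by ring
    _ ≤ (σ ^ 2 / 2 * c⁻¹ * (2 * P.ℓ ^ 2)) * c := by gcongr
    _ = P.ℓ ^ 2 * σ ^ 2 := by field_simp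

end Balance

/-- The sign of the driving boundary velocity. -/
noncomputable def drivingSign (P : Data) : ℝ := if 0 ≤ P.vInf then 1 else -1

theorem drivingSign_cases (P : Data) : P.drivingSign = 1 ∨ P.drivingSign = -1 := by
  unfold drivingSign; split_ifs <;> simp

theorem drivingSign_mul_vInf (P : Data) : P.drivingSign * P.vInf = |P.vInf| := by
  unfold drivingSign
  split_ifs with h
  · rw [abs_of_nonneg h, one_mul]
  · rw [abs_of_neg (not_le.1 h), neg_one_mul]

namespace IsSteadyState

variable {η : ℝ} {ε v π α θ : ℝ → ℝ} {σ : ℝ}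

theorem exists_regularRate (hP : P.Standing) (h : P.IsSteadyState η ε v π α θ σ) :
    ∃ p₁ p₂ : ℝ → ℝ, IsRegularRate P.H π p₁ p₂ ∧ ∀ᵐ x ∂(volD P.H), ∀ q : ℝ,
      P.R (π x) (θ x) ≤ P.R q (θ x) - σ * (q - π x) - η * p₂ x * (q - π x) := by
  obtain ⟨p₁, p₂, -, h₁, h₂, hw₁, hw₂, hflow⟩ := h.flow
  obtain ⟨q₁, hq⟩ := isRegularRate_of_isWeakDeriv hP.H_pos h.π_cont h₁ h₂ hw₁ hw₂
  exact ⟨q₁, p₂, hq, hflow⟩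

theorem v_eq (h : P.IsSteadyState η ε v π α θ σ) {x y : ℝ}
    (hx : x ∈ Icc (-P.H) P.H) (hy : y ∈ Icc (-P.H) P.H) : v y = v x + ∫ z in x..y, π z :=
  eq_add_integral_of_hasDerivWithinAt h.rate h.π_cont hx hy

theorem integral_pi (hP : P.Standing) (h : P.IsSteadyState η ε v π α θ σ) :
    ∫ x, π x ∂(volD P.H) = 2 * P.vInf := by
  have := h.v_eq (left_mem_Icc.2 hP.neg_le) (right_mem_Icc.2 hP.neg_le)
  rw [h.v_left, h.v_right] at this
  rw [integral_volD hP.H_pos.le]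
  linarith

/-- Testing with `q = 0` gives `(σ + η π'') π ≥ R(π, θ) ≥ 0`. Where `π < 0` this forces `π'' ≤ 0`
when `σ ≥ 0`, so the minimum principle applies. -/
theorem pi_nonneg (hP : P.Standing) (hη : 0 < η) (h : P.IsSteadyState η ε v π α θ σ)
    (hσ : 0 ≤ σ) : ∀ x ∈ Icc (-P.H) P.H, 0 ≤ π x := by
  obtain ⟨p₁, p₂, hp, hflow⟩ := h.exists_regularRate hP
  obtain ⟨c, hc⟩ := hp.primitive
  refine nonneg_of_weak_deriv2_nonpos_of_neg hP.H_pos hp.hasDeriv hp.integrable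
    (fun x _ => hc x) h.π_left.ge h.π_right.ge ?_
  filter_upwards [hflow] with x hx hneg
  have h1 := hx 0
  have h2 := hP.R_nonneg (π x) (θ x)
  rw [R_zero] at h1
  by_contra! hpos
  have h3 : (σ + η * p₂ x) * π x < 0 := mul_neg_of_pos_of_neg (by positivity) hneg
  linarith

theorem pi_nonpos (hP : P.Standing) (hη : 0 < η) (h : P.IsSteadyState η ε v π α θ σ)
    (hσ : σ ≤ 0) : ∀ x ∈ Icc (-P.H) P.H, π x ≤ 0 := by
  obtain ⟨p₁, p₂, hp, hflow⟩ := h.exists_regularRate hP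
  obtain ⟨c, hc⟩ := hp.primitive
  have := nonneg_of_weak_deriv2_nonpos_of_neg (u := fun x => -π x) (u' := fun x => -p₁ x)
    (w := fun x => -p₂ x) (c := -c) hP.H_pos
    (fun x hx => (hp.hasDeriv x hx).neg) hp.integrable.neg
    (fun x _ => by rw [hc x, intervalIntegral.integral_neg]; ring)
    (by rw [h.π_left, neg_zero]) (by rw [h.π_right, neg_zero]) (by
      filter_upwards [hflow] with x hx hneg
      have h1 := hx 0
      have h2 := hP.R_nonneg (π x) (θ x)
      rw [R_zero] at h1
      by_contra! hpos
      have h3 : η * p₂ x < 0 := mul_neg_of_pos_of_neg hη (by linarith)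
      have h4 : (σ + η * p₂ x) * π x < 0 := mul_neg_of_neg_of_pos (by linarith) (by linarith)
      linarith)
  exact fun x hx => by linarith [this x hx]

/-- The plastic rate has the sign of the driving velocity. -/
theorem abs_pi_eq (hP : P.Standing) (hη : 0 < η) (h : P.IsSteadyState η ε v π α θ σ) :
    ∀ x ∈ Icc (-P.H) P.H, |π x| = P.drivingSign * π x := by
  have hint := h.integral_pi hP
  have hi : Integrable π (volD P.H) := h.π_cont.integrableOn_compact isCompact_Icc
  unfold drivingSign
  split_ifs with hv
  · rcases le_total 0 σ with hσ | hσ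
    · intro x hx
      rw [abs_of_nonneg (h.pi_nonneg hP hη hσ x hx), one_mul]
    -- Here `π ≤ 0` while its integral `2 * vInf` is non-negative, so `π` vanishes identically and
    -- either sign is correct.
    · have hn := h.pi_nonpos hP hη hσ
      have hI : ∫ x, -π x ∂(volD P.H) = 0 := by
        refine le_antisymm ?_ (integral_nonneg_of_ae ?_)
        · rw [integral_neg, hint]; linarith
        · filter_upwards [ae_mem_volD P.H] with x hx
          simpa using hn x hx
      have hae := (integral_eq_zero_iff_of_nonneg_ae (by
        filter_upwards [ae_mem_volD P.H] with x hx
        simpa using hn x hx) hi.neg).1 hI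
      have heq := Measure.eqOn_Icc_of_ae_eq volume (by linarith [hP.H_pos] : -P.H ≠ P.H) hae
        h.π_cont.neg continuousOn_const
      intro x hx
      have : π x = 0 := by simpa using heq hx
      simp [this]
  · rcases le_total 0 σ with hσ | hσ
    · have : 0 ≤ ∫ x, π x ∂(volD P.H) := integral_nonneg_of_ae (by
        filter_upwards [ae_mem_volD P.H] with x hx using h.pi_nonneg hP hη hσ x hx)
      exact absurd (show 0 ≤ P.vInf by linarith) hv
    · intro x hx
      rw [abs_of_nonpos (h.pi_nonpos hP hη hσ x hx)]; ring

theorem integral_abs_pi (hP : P.Standing) (hη : 0 < η) (h : P.IsSteadyState η ε v π α θ σ) :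
    ∫ x, |π x| ∂(volD P.H) = 2 * |P.vInf| := by
  have : ∫ x, |π x| ∂(volD P.H) = ∫ x, P.drivingSign * π x ∂(volD P.H) :=
    integral_congr_ae ((ae_mem_volD P.H).mono (h.abs_pi_eq hP hη))
  rw [this, integral_const_mul, h.integral_pi hP, ← P.drivingSign_mul_vInf]
  ring

theorem R_comp_integrable (hP : P.Standing) (h : P.IsSteadyState η ε v π α θ σ) :
    Integrable (fun x => P.R (π x) (θ x)) (volD P.H) :=
  (hP.R_cont.comp_continuousOn (h.π_cont.prodMk h.theta_cont)).integrableOn_compact isCompact_Icc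

theorem R_comp_test_integrable (hP : P.Standing) (h : P.IsSteadyState η ε v π α θ σ)
    {φ : ℝ → ℝ} (hφ : Continuous φ) : Integrable (fun x => P.R (φ x) (θ x)) (volD P.H) :=
  (hP.R_cont.comp_continuousOn (hφ.continuousOn.prodMk h.theta_cont)).integrableOn_compact
    isCompact_Icc

/-- The integrated flow rule tested with smooth functions. -/
theorem integral_R_le (hP : P.Standing) (hη : 0 < η) (h : P.IsSteadyState η ε v π α θ σ)
    {φ : ℝ → ℝ} (hφ : ContDiff ℝ ∞ φ) (hφc : HasCompactSupport φ)
    (hφs : tsupport φ ⊆ Ioo (-P.H) P.H) :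
    ∫ x, P.R (π x) (θ x) ∂(volD P.H) ≤ ∫ x, P.R (φ x) (θ x) ∂(volD P.H) -
      σ * (∫ x, φ x ∂(volD P.H) - 2 * P.vInf) -
      η * ∫ x, π x * deriv (deriv φ) x ∂(volD P.H) := by
  obtain ⟨p₁, p₂, hp, hflow⟩ := h.exists_regularRate hP
  have hπi : Integrable π (volD P.H) := h.π_cont.integrableOn_compact isCompact_Icc
  have hφi : Integrable φ (volD P.H) :=
    (hφ.continuous.integrable_of_hasCompactSupport hφc).restrict
  obtain ⟨M, hM⟩ := hφ.continuous.bounded_above_of_compact_support hφc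
  obtain ⟨K, hK⟩ := isCompact_Icc.exists_bound_of_continuousOn h.π_cont
  have i1 := h.R_comp_test_integrable hP hφ.continuous
  have i2 : Integrable (fun x => σ * (φ x - π x)) (volD P.H) := (hφi.sub hπi).const_mul σ
  have i3 : Integrable (fun x => p₂ x * φ x) (volD P.H) :=
    hp.integrable.mul_bdd hφi.1 (Eventually.of_forall hM)
  have i4 : Integrable (fun x => p₂ x * π x) (volD P.H) :=
    hp.integrable.mul_bdd hπi.1 ((ae_mem_volD P.H).mono hK)
  have i5 : Integrable (fun x => η * (p₂ x * φ x - p₂ x * π x)) (volD P.H) :=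
    (i3.sub i4).const_mul η
  have hle : ∫ x, P.R (π x) (θ x) ∂(volD P.H) ≤
      ∫ x, (P.R (φ x) (θ x) - σ * (φ x - π x)) - η * (p₂ x * φ x - p₂ x * π x) ∂(volD P.H) := by
    refine integral_mono_ae (h.R_comp_integrable hP) ((i1.sub i2).sub i5) ?_
    filter_upwards [hflow] with x hx
    have := hx (φ x)
    linarith
  have i12 : Integrable (fun x => P.R (φ x) (θ x) - σ * (φ x - π x)) (volD P.H) := i1.sub i2
  rw [integral_sub i12 i5, integral_sub i1 i2, integral_const_mul, integral_const_mul,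
    integral_sub i3 i4, integral_sub hφi hπi, h.integral_pi hP, hp.test φ hφ hφc hφs] at hle
  -- The part of the viscous term quadratic in `π` has a favourable sign and is dropped; only the
  -- part linear in `π` remains, with both derivatives on `φ`.
  have hen := hp.integral_mul_nonpos hP.H_pos h.π_left h.π_right
  have := mul_nonpos_of_nonneg_of_nonpos hη.le hen
  linarith

end IsSteadyState

/-- Uniform bound of the right-hand side of the tested flow rule. -/
theorem Standing.exists_test_bound (hP : P.Standing) (E : ℝ) {φ : ℝ → ℝ} (hφ : ContDiff ℝ ∞ φ)
    (hφc : HasCompactSupport φ) (hφs : tsupport φ ⊆ Ioo (-P.H) P.H) :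
    ∃ B, ∀ η ε v π α θ σ, 0 < η → η ≤ E → P.IsSteadyState η ε v π α θ σ →
      σ * (∫ x, φ x ∂(volD P.H) - 2 * P.vInf) ≤ B := by
  obtain ⟨M, hM⟩ := hφ.continuous.bounded_above_of_compact_support hφc
  have hφ2 : ContDiff ℝ ∞ (deriv (deriv φ)) :=
    (contDiff_infty_iff_deriv.1 (contDiff_infty_iff_deriv.1 hφ).2).2
  obtain ⟨M₂, hM₂⟩ := hφ2.continuous.bounded_above_of_compact_support hφc.deriv.deriv
  have hM₂0 : 0 ≤ M₂ := (norm_nonneg _).trans (hM₂ 0)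
  obtain ⟨CR, hCR⟩ := ((isCompact_Icc (a := -M) (b := M)).prod
    (isCompact_Icc (a := 0) (b := P.thInf))).exists_bound_of_continuousOn hP.R_cont.continuousOn
  refine ⟨∫ _, CR ∂(volD P.H) + E * (M₂ * (2 * |P.vInf|)), ?_⟩
  intro η ε v π α θ σ hη hηE h
  have hle := h.integral_R_le hP hη hφ hφc hφs
  have h0 : 0 ≤ ∫ x, P.R (π x) (θ x) ∂(volD P.H) := integral_nonneg fun x => hP.R_nonneg _ _
  have h1 : ∫ x, P.R (φ x) (θ x) ∂(volD P.H) ≤ ∫ _, CR ∂(volD P.H) := by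
    refine integral_mono_ae (h.R_comp_test_integrable hP hφ.continuous) (integrable_const _) ?_
    filter_upwards [ae_mem_volD P.H] with x hx
    exact (le_abs_self _).trans (hCR (φ x, θ x)
      ⟨abs_le.1 (hM x), h.theta_mem hP x hx⟩)
  -- The only control on `π` needed here is its `L^1` norm, which is `2 * |vInf|` exactly because
  -- `π` has one sign.
  have h2 : |∫ x, π x * deriv (deriv φ) x ∂(volD P.H)| ≤ M₂ * (2 * |P.vInf|) := by
    rw [← h.integral_abs_pi hP hη, ← integral_const_mul, ← Real.norm_eq_abs]
    have hi : Integrable π (volD P.H) := h.π_cont.integrableOn_compact isCompact_Icc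
    refine norm_integral_le_of_norm_le (hi.abs.const_mul M₂) (Eventually.of_forall fun x => ?_)
    rw [norm_mul, mul_comm]
    exact mul_le_mul_of_nonneg_right (hM₂ x) (abs_nonneg _)
  have h3 : -(η * ∫ x, π x * deriv (deriv φ) x ∂(volD P.H)) ≤ E * (M₂ * (2 * |P.vInf|)) := by
    have h4 := neg_le_of_abs_le h2
    have h5 : 0 ≤ M₂ * (2 * |P.vInf|) := by positivity
    have h6 := mul_le_mul_of_nonneg_right hηE h5
    nlinarith
  linarith

/-- Multiples of one bump, with integrals `2 * vInf + 1` and `2 * vInf - 1`, turn the tested flow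
rule into upper bounds for `σ` and for `-σ`. -/
theorem Standing.exists_sigma_bound (hP : P.Standing) (E : ℝ) :
    ∃ S > 0, ∀ η ε v π α θ σ, 0 < η → η ≤ E → P.IsSteadyState η ε v π α θ σ → |σ| ≤ S := by
  obtain ⟨ρ, h1, h2, h3, h4⟩ := exists_test_integral_one hP.H_pos
  have hscale (l : ℝ) := hP.exists_test_bound E (φ := fun x => l * ρ x) (contDiff_const.mul h1)
    (h2.mul_left (f := fun _ => l)) (tsupport_mul_subset_right.trans h3)
  simp only [integral_const_mul, h4, mul_one] at hscale
  obtain ⟨B₁, hB₁⟩ := hscale (2 * P.vInf + 1)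
  obtain ⟨B₂, hB₂⟩ := hscale (2 * P.vInf - 1)
  refine ⟨max (max B₁ B₂) 1, by positivity, fun η ε v π α θ σ hη hE h => ?_⟩
  have e1 := hB₁ η ε v π α θ σ hη hE h
  have e2 := hB₂ η ε v π α θ σ hη hE h
  have m1 := le_max_left B₁ B₂
  have m2 := le_max_right B₁ B₂
  have m3 := le_max_left (max B₁ B₂) 1
  rw [abs_le]
  constructor <;> linarith

/-- Choose `K` so that `R > S |π|` for `|π| > K`, where `S` bounds `|σ|`. Testing with `q = 0` gives
`(σ + η π'') π ≥ R > σ π`, hence `π'' π > 0` there, and the minimum principle applies to `K - π` and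
`K + π`. The value of `η > 0` does not affect `K`. -/
theorem Standing.exists_pi_bound (hP : P.Standing) (hΦ : P.SuperlinearBound) (E : ℝ) :
    ∃ K > 0, ∀ η ε v π α θ σ, 0 < η → η ≤ E → P.IsSteadyState η ε v π α θ σ →
      ∀ x ∈ Icc (-P.H) P.H, |π x| ≤ K := by
  obtain ⟨S, hS, hSb⟩ := hP.exists_sigma_bound E
  obtain ⟨K, hK, hKR⟩ := hΦ.exists_bound S
  refine ⟨K, hK, fun η ε v π α θ σ hη hE h => ?_⟩
  have hσ := hSb η ε v π α θ σ hη hE h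
  obtain ⟨p₁, p₂, hp, hflow⟩ := h.exists_regularRate hP
  obtain ⟨c, hc⟩ := hp.primitive
  have hpos : ∀ᵐ x ∂(volD P.H), K < |π x| → 0 < p₂ x * π x := by
    filter_upwards [hflow] with x hx hlt
    have h1 := hx 0
    rw [R_zero] at h1
    have h2 := hKR (π x) (θ x) hlt
    have h3 : σ * π x ≤ S * |π x| := by
      refine (le_abs_self _).trans ?_
      rw [abs_mul]
      exact mul_le_mul_of_nonneg_right hσ (abs_nonneg _)
    have h4 : 0 < η * (p₂ x * π x) := by linarith
    exact (mul_pos_iff_of_pos_left hη).1 h4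
  have hup := nonneg_of_weak_deriv2_nonpos_of_neg (u := fun x => K - π x) (u' := fun x => -p₁ x)
    (w := fun x => -p₂ x) (c := -c) hP.H_pos
    (fun x hx => (hp.hasDeriv x hx).const_sub K) hp.integrable.neg
    (fun x _ => by rw [hc x, intervalIntegral.integral_neg]; ring)
    (by rw [h.π_left]; linarith) (by rw [h.π_right]; linarith) (by
      filter_upwards [hpos] with x hx hneg
      have hgt : K < π x := by linarith
      have := hx (hgt.trans_le (le_abs_self _))
      have := (pos_iff_pos_of_mul_pos this).2 (by linarith)
      linarith)
  have hlow := nonneg_of_weak_deriv2_nonpos_of_neg (u := fun x => K + π x) (u' := p₁)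
    (w := p₂) (c := c) hP.H_pos
    (fun x hx => (hp.hasDeriv x hx).const_add K) hp.integrable (fun x _ => hc x)
    (by rw [h.π_left]; linarith) (by rw [h.π_right]; linarith) (by
      filter_upwards [hpos] with x hx hneg
      have hgt : π x < -K := by linarith
      have := hx (by rw [abs_of_neg (by linarith)]; linarith)
      have := (neg_iff_neg_of_mul_pos this).2 (by linarith)
      exact this.le)
  intro x hx
  rw [abs_le]
  constructor <;> linarith [hup x hx, hlow x hx]

/-- Bounds for a steady state and the first derivatives `α₁`, `θ₁` of `α`, `θ`. -/
structure Estimates (P : Data) (B : ℝ) (v π α θ : ℝ → ℝ) (σ : ℝ) (α₁ θ₁ : ℝ → ℝ) : Prop where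
  sigma_le : |σ| ≤ B
  pi_le : ∀ x ∈ Icc (-P.H) P.H, |π x| ≤ B
  v_le : ∀ x ∈ Icc (-P.H) P.H, |v x| ≤ B
  alpha_le : ∀ x ∈ Icc (-P.H) P.H, |α x| ≤ B
  theta_le : ∀ x ∈ Icc (-P.H) P.H, |θ x| ≤ B
  alpha₁_le : ∀ x ∈ Icc (-P.H) P.H, |α₁ x| ≤ B
  theta₁_le : ∀ x ∈ Icc (-P.H) P.H, |θ₁ x| ≤ B
  damage_le : ∀ x ∈ Icc (-P.H) P.H, |P.damageRhs (α x) σ| ≤ B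
  aging_le : ∀ x ∈ Icc (-P.H) P.H, |P.agingRhs (π x) (θ x)| ≤ B
  alpha_deriv : ∀ x ∈ Icc (-P.H) P.H, HasDerivWithinAt α (α₁ x) (Icc (-P.H) P.H) x
  alpha₁_deriv : ∀ x ∈ Icc (-P.H) P.H,
    HasDerivWithinAt α₁ (P.damageRhs (α x) σ) (Icc (-P.H) P.H) x
  theta_deriv : ∀ x ∈ Icc (-P.H) P.H, HasDerivWithinAt θ (θ₁ x) (Icc (-P.H) P.H) x
  theta₁_deriv : ∀ x ∈ Icc (-P.H) P.H,
    HasDerivWithinAt θ₁ (P.agingRhs (π x) (θ x)) (Icc (-P.H) P.H) x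

/-- The bounds on `σ`, `π`, `α`, `θ` confine the arguments of the two continuous right-hand sides to
compact sets. This bounds `α''` and `θ''`; equal boundary values then bound `α'` and `θ'`. -/
theorem Standing.exists_estimates (hP : P.Standing) (hΦ : P.SuperlinearBound) (E : ℝ) :
    ∃ B > 0, ∀ η ε v π α θ σ, 0 < η → η ≤ E → P.IsSteadyState η ε v π α θ σ →
      ∃ α₁ θ₁, P.Estimates B v π α θ σ α₁ θ₁ := by
  obtain ⟨S, hS, hSb⟩ := hP.exists_sigma_bound E
  obtain ⟨K, hK, hKb⟩ := hP.exists_pi_bound hΦ E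
  obtain ⟨c, hc, hC⟩ := hP.C_pos
  have hG := hP.Gc_pos
  have hH := hP.H_pos
  set A := 1 + √(P.ℓ ^ 2 * S ^ 2 / (P.Gc * c)) with hA
  have hA0 : 0 ≤ A := by positivity
  obtain ⟨D₂, hD₂⟩ := ((isCompact_Icc (a := -A) (b := A)).prod
    (isCompact_Icc (a := -S) (b := S))).exists_bound_of_continuousOn
      hP.damageRhs_cont.continuousOn
  obtain ⟨T₂, hT₂⟩ := ((isCompact_Icc (a := -K) (b := K)).prod
    (isCompact_Icc (a := 0) (b := P.thInf))).exists_bound_of_continuousOn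
      hP.agingRhs_cont.continuousOn
  have hD₂0 : 0 ≤ D₂ := (norm_nonneg _).trans (hD₂ (0, 0) ⟨⟨by linarith, hA0⟩, by
    constructor <;> simp [hS.le]⟩)
  have hT₂0 : 0 ≤ T₂ := (norm_nonneg _).trans (hT₂ (0, 0) ⟨⟨by simp [hK.le], hK.le⟩,
    ⟨le_rfl, hP.thInf_pos.le⟩⟩)
  have hth := hP.thInf_pos
  have hv0 : 0 ≤ |P.vInf| + K * (P.H - -P.H) := by
    have : 0 ≤ P.H - -P.H := by linarith
    positivity
  have hd0 : 0 ≤ D₂ * (P.H - -P.H) := mul_nonneg hD₂0 (by linarith)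
  have ht0 : 0 ≤ T₂ * (P.H - -P.H) := mul_nonneg hT₂0 (by linarith)
  -- Every summand is non-negative, so the sum dominates each individual bound.
  refine ⟨S + K + (|P.vInf| + K * (P.H - -P.H)) + A + P.thInf + D₂ * (P.H - -P.H) +
    T₂ * (P.H - -P.H) + D₂ + T₂, by linarith, fun η ε v π α θ σ hη hE h => ?_⟩
  have hσ := hSb η ε v π α θ σ hη hE h
  have hπ := hKb η ε v π α θ σ hη hE h
  obtain ⟨α₁, hα₁, hα₂⟩ := h.exists_damage_deriv hP
  obtain ⟨θ₁, hθ₁, hθ₂⟩ := h.exists_aging_deriv hP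
  have hθ := h.theta_mem hP
  have hα : ∀ x ∈ Icc (-P.H) P.H, |α x| ≤ A := by
    intro x hx
    have h1 := h.sq_alpha_sub_one_le hP hc hC x hx
    have h2 : σ ^ 2 ≤ S ^ 2 := sq_le_sq' (by linarith [neg_le_of_abs_le hσ]) (le_of_abs_le hσ)
    have h3 : (α x - 1) ^ 2 ≤ P.ℓ ^ 2 * S ^ 2 / (P.Gc * c) := h1.trans (by gcongr)
    have h4 := Real.abs_le_sqrt h3
    rw [hA]
    rw [abs_le] at h4 ⊢
    constructor <;> linarith
  have hdam : ∀ x ∈ Icc (-P.H) P.H, |P.damageRhs (α x) σ| ≤ D₂ := fun x hx =>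
    hD₂ (α x, σ) ⟨abs_le.1 (hα x hx), abs_le.1 hσ⟩
  have hag : ∀ x ∈ Icc (-P.H) P.H, |P.agingRhs (π x) (θ x)| ≤ T₂ := fun x hx =>
    hT₂ (π x, θ x) ⟨abs_le.1 (hπ x hx), hθ x hx⟩
  have hlt : -P.H < P.H := by linarith
  have hα₁b := abs_deriv_le_of_abs_deriv2_le hlt hα₁ hα₂ hdam (by rw [h.α_left, h.α_right])
  have hθ₁b := abs_deriv_le_of_abs_deriv2_le hlt hθ₁ hθ₂ hag (by rw [h.θ_left, h.θ_right])
  have hvb : ∀ x ∈ Icc (-P.H) P.H, |v x| ≤ |P.vInf| + K * (P.H - -P.H) := by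
    intro x hx
    have h1 := abs_sub_le_of_hasDerivWithinAt h.rate hπ x hx _ (left_mem_Icc.2 hP.neg_le)
    rw [h.v_left] at h1
    have h2 : K * |x - -P.H| ≤ K * (P.H - -P.H) := by
      rw [abs_of_nonneg (by linarith [hx.1])]
      exact mul_le_mul_of_nonneg_left (by linarith [hx.2]) hK.le
    have h3 := abs_sub_abs_le_abs_sub (v x) (-P.vInf)
    rw [abs_neg] at h3
    linarith
  refine ⟨α₁, θ₁, ⟨by linarith, fun x hx => ?_, fun x hx => ?_, fun x hx => ?_, fun x hx => ?_,
    fun x hx => ?_, fun x hx => ?_, fun x hx => ?_, fun x hx => ?_, hα₁, hα₂, hθ₁, hθ₂⟩⟩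
  · linarith [hπ x hx]
  · linarith [hvb x hx]
  · linarith [hα x hx]
  · rw [abs_of_nonneg (hθ x hx).1]; linarith [(hθ x hx).2]
  · linarith [hα₁b x hx]
  · linarith [hθ₁b x hx]
  · linarith [hdam x hx]
  · linarith [hag x hx]

end Data

/-! ### Limits of products, primitives and derivatives. -/

theorem tendsto_integral_mul_of_weak_strong {H B M : ℝ} {u g : ℕ → ℝ → ℝ} {w f : ℝ → ℝ}
    (hu : ∀ n, AEStronglyMeasurable (u n) (volD H)) (huB : ∀ n, ∀ᵐ x ∂(volD H), |u n x| ≤ B)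
    (hg : ∀ n, AEStronglyMeasurable (g n) (volD H)) (hgM : ∀ n, ∀ᵐ x ∂(volD H), |g n x| ≤ M)
    (hgf : ∀ᵐ x ∂(volD H), Tendsto (fun n => g n x) atTop (𝓝 (f x)))
    (hw : Tendsto (fun n => ∫ x, u n x * f x ∂(volD H)) atTop (𝓝 (∫ x, w x * f x ∂(volD H)))) :
    Tendsto (fun n => ∫ x, u n x * g n x ∂(volD H)) atTop (𝓝 (∫ x, w x * f x ∂(volD H))) := by
  have hf : AEStronglyMeasurable f (volD H) := aestronglyMeasurable_of_tendsto_ae _ hg hgf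
  have hfM : ∀ᵐ x ∂(volD H), |f x| ≤ M := by
    filter_upwards [hgf, ae_all_iff.2 hgM] with x hx hx'
    exact le_of_tendsto hx.abs (Eventually.of_forall hx')
  -- In the splitting `u n * g n = u n * (g n - f) + u n * f` the first term vanishes by dominated
  -- convergence, and the second is covered by `hw`.
  have hd : Tendsto (fun n => ∫ x, u n x * (g n x - f x) ∂(volD H)) atTop (𝓝 0) := by
    have := tendsto_integral_volD (H := H) (F := fun n x => u n x * (g n x - f x)) (f := fun _ => 0)
      (B := |B| * (2 * M)) (fun n => (hu n).mul ((hg n).sub hf)) (fun n => by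
        filter_upwards [huB n, hgM n, hfM] with x h1 h2 h3
        rw [abs_mul]
        have h4 := abs_sub (g n x) (f x)
        exact mul_le_mul (h1.trans (le_abs_self B)) (by linarith) (abs_nonneg _) (abs_nonneg _)) (by
        filter_upwards [hgf, ae_all_iff.2 huB] with x hx hx'
        have h1 := hx.sub_const (f x)
        rw [sub_self] at h1
        refine squeeze_zero_norm (a := fun n => |B| * |g n x - f x|) (fun n => ?_) ?_
        · rw [norm_mul]
          exact mul_le_mul_of_nonneg_right ((hx' n).trans (le_abs_self B)) (abs_nonneg _)
        · simpa using h1.abs.const_mul |B|)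
    simpa using this
  have hsum : ∀ n, ∫ x, u n x * g n x ∂(volD H) =
      ∫ x, u n x * (g n x - f x) ∂(volD H) + ∫ x, u n x * f x ∂(volD H) := by
    intro n
    have ig : Integrable (g n) (volD H) := Integrable.of_bound (hg n) M (hgM n)
    have jf : Integrable f (volD H) := Integrable.of_bound hf M hfM
    have i1 : Integrable (fun x => u n x * (g n x - f x)) (volD H) :=
      (ig.sub jf).bdd_mul (hu n) (huB n)
    have i2 : Integrable (fun x => u n x * f x) (volD H) := jf.bdd_mul (hu n) (huB n)
    rw [← integral_add i1 i2]
    exact integral_congr_ae (Eventually.of_forall fun x => by ring)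
  simp only [hsum]
  simpa using hd.add hw

/-- With the variable end point moved into an indicator, a primitive becomes a pairing on all of
`D`, to which weak convergence applies. -/
theorem setIntegral_volD_eq {H : ℝ} {x : ℝ} (hx : x ∈ Icc (-H) H) (f : ℝ → ℝ) :
    ∫ y in (-H)..x, f y = ∫ y, (Icc (-H) x).indicator f y ∂(volD H) := by
  rw [intervalIntegral.integral_of_le hx.1, ← integral_Icc_eq_integral_Ioc,
    integral_indicator measurableSet_Icc, Measure.restrict_restrict measurableSet_Icc,
    inter_eq_left.2 (Icc_subset_Icc le_rfl hx.2)]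

theorem tendsto_primitive {H B : ℝ} {u : ℕ → ℝ → ℝ} {w : ℝ → ℝ}
    (hu : ∀ n, ContinuousOn (u n) (Icc (-H) H)) (hB : ∀ n, ∀ y ∈ Icc (-H) H, |u n y| ≤ B)
    (hw : ∀ y ∈ Icc (-H) H, Tendsto (fun n => u n y) atTop (𝓝 (w y))) {x : ℝ}
    (hx : x ∈ Icc (-H) H) :
    Tendsto (fun n => ∫ y in (-H)..x, u n y) atTop (𝓝 (∫ y in (-H)..x, w y)) := by
  simp only [setIntegral_volD_eq hx]
  refine tendsto_integral_volD (B := |B|) (fun n =>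
    ((hu n).aestronglyMeasurable measurableSet_Icc).indicator measurableSet_Icc) (fun n => ?_) ?_
  · filter_upwards [ae_mem_volD H] with y hy
    by_cases h : y ∈ Icc (-H) x
    · rw [indicator_of_mem h]; exact (hB n y hy).trans (le_abs_self B)
    · rw [indicator_of_notMem h]; simp
  · filter_upwards [ae_mem_volD H] with y hy
    by_cases h : y ∈ Icc (-H) x
    · simp only [indicator_of_mem h]; exact hw y hy
    · simp only [indicator_of_notMem h]; exact tendsto_const_nhds

theorem lipschitzOnWith_of_tendsto {a b B : ℝ} {u : ℕ → ℝ → ℝ} {w : ℝ → ℝ}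
    (hL : ∀ n, ∀ x ∈ Icc a b, ∀ y ∈ Icc a b, |u n x - u n y| ≤ B * |x - y|)
    (hw : ∀ y ∈ Icc a b, Tendsto (fun n => u n y) atTop (𝓝 (w y))) :
    LipschitzOnWith B.toNNReal w (Icc a b) := by
  refine LipschitzOnWith.of_dist_le_mul fun x hx y hy => ?_
  rw [Real.dist_eq, Real.dist_eq]
  refine (le_of_tendsto ((hw x hx).sub (hw y hy)).abs
    (Eventually.of_forall fun n => hL n x hx y hy)).trans ?_
  exact mul_le_mul_of_nonneg_right (Real.le_coe_toNNReal B) (abs_nonneg _)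

/-- Pointwise limits of functions with bounded, pointwise convergent derivatives. -/
theorem hasDerivWithinAt_of_pointwise {H B : ℝ} {u u' : ℕ → ℝ → ℝ} {w w' : ℝ → ℝ}
    (hd : ∀ n, ∀ x ∈ Icc (-H) H, HasDerivWithinAt (u n) (u' n x) (Icc (-H) H) x)
    (hc : ∀ n, ContinuousOn (u' n) (Icc (-H) H)) (hB : ∀ n, ∀ x ∈ Icc (-H) H, |u' n x| ≤ B)
    (hw : ∀ x ∈ Icc (-H) H, Tendsto (fun n => u n x) atTop (𝓝 (w x)))
    (hw' : ∀ x ∈ Icc (-H) H, Tendsto (fun n => u' n x) atTop (𝓝 (w' x)))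
    (hwc : ContinuousOn w' (Icc (-H) H)) :
    ∀ x ∈ Icc (-H) H, HasDerivWithinAt w (w' x) (Icc (-H) H) x := by
  intro x hx
  refine hasDerivWithinAt_of_primitive (c := w (-H)) hwc (fun y hy => ?_) hx
  have hl : -H ∈ Icc (-H) H := left_mem_Icc.2 (hy.1.trans hy.2)
  refine tendsto_nhds_unique (hw y hy) ?_
  have := (hw _ hl).add (tendsto_primitive hc hB hw' hy)
  refine this.congr fun n => ?_
  exact (eq_add_integral_of_hasDerivWithinAt (hd n) (hc n) hl hy).symm

/-- The limit of uniformly Lipschitz functions has a bounded density; if the functions are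
monotone in the direction `s`, the density has sign `s`. -/
theorem exists_density {H B s : ℝ} (hH : 0 < H) (hB : 0 ≤ B) {u : ℕ → ℝ → ℝ} {w : ℝ → ℝ}
    (hL : ∀ n, ∀ x ∈ Icc (-H) H, ∀ y ∈ Icc (-H) H, |u n x - u n y| ≤ B * |x - y|)
    (hmono : ∀ n, MonotoneOn (fun x => s * u n x) (Icc (-H) H))
    (hw : ∀ y ∈ Icc (-H) H, Tendsto (fun n => u n y) atTop (𝓝 (w y))) :
    ∃ p : ℝ → ℝ, Measurable p ∧ (∀ x, |p x| ≤ B) ∧ (∀ x, 0 ≤ s * p x) ∧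
      ∀ x ∈ Icc (-H) H, w x = w (-H) + ∫ y in (-H)..x, p y := by
  have hab : -H ≤ H := by linarith
  have hlip := lipschitzOnWith_of_tendsto hL hw
  -- The constant extension beyond `D` is Lipschitz and monotone on the whole line, so the
  -- properties of its derivative need no exceptions at `±H`.
  set W : ℝ → ℝ := fun x => w (projIcc (-H) H hab x) with hW
  have hWe : ∀ x ∈ Icc (-H) H, W x = w x := fun x hx => by rw [hW]; simp [projIcc_of_mem hab hx]
  have hWl : LipschitzWith B.toNNReal W := by
    have := (lipschitzOnWith_iff_restrict.1 hlip).comp (LipschitzWith.projIcc (h := hab))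
    rw [mul_one] at this
    exact this
  have hWm : Monotone fun x => s * W x := by
    intro x y hxy
    have hmw : MonotoneOn (fun x => s * w x) (Icc (-H) H) := fun x hx y hy hxy =>
      le_of_tendsto_of_tendsto ((hw x hx).const_mul s) ((hw y hy).const_mul s)
        (Eventually.of_forall fun n => hmono n hx hy hxy)
    exact hmw (projIcc (-H) H hab x).2 (projIcc (-H) H hab y).2 (monotone_projIcc hab hxy)
  -- Where `W` is not differentiable `deriv W` is zero, so the bound and the sign hold at every
  -- point. A Lipschitz function is absolutely continuous, hence recovered from this derivative.
  refine ⟨deriv W, measurable_deriv W, fun x => ?_, fun x => ?_, fun x hx => ?_⟩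
  · have := norm_deriv_le_of_lipschitz (x₀ := x) hWl
    rwa [Real.norm_eq_abs, Real.coe_toNNReal _ hB] at this
  · rw [← deriv_const_mul_field]
    exact hWm.deriv_nonneg
  · have hac : AbsolutelyContinuousOnInterval W (-H) x :=
      (hWl.lipschitzOnWith).absolutelyContinuousOnInterval
    rw [hac.integral_deriv_eq_sub, hWe x hx, hWe _ (left_mem_Icc.2 hab)]
    ring

/-- A sequence that converges against test functions converges weakly; here for derivatives of
pointwise convergent functions. -/
theorem tendsto_integral_mul_of_primitive {H B : ℝ} (hH : 0 < H) (hB : 0 ≤ B)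
    {u u' : ℕ → ℝ → ℝ} {w p : ℝ → ℝ}
    (hd : ∀ n, ∀ x ∈ Icc (-H) H, HasDerivWithinAt (u n) (u' n x) (Icc (-H) H) x)
    (hc : ∀ n, ContinuousOn (u' n) (Icc (-H) H)) (hu' : ∀ n, ∀ x ∈ Icc (-H) H, |u' n x| ≤ B)
    (hu : ∀ n, ∀ x ∈ Icc (-H) H, |u n x| ≤ B)
    (hw : ∀ x ∈ Icc (-H) H, Tendsto (fun n => u n x) atTop (𝓝 (w x)))
    (hp : AEStronglyMeasurable p (volD H)) (hpB : ∀ᵐ x ∂(volD H), |p x| ≤ B)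
    (hwp : ∀ x ∈ Icc (-H) H, w x = w (-H) + ∫ y in (-H)..x, p y)
    {g : ℝ → ℝ} {M : ℝ} (hg : AEStronglyMeasurable g (volD H)) (hM0 : 0 ≤ M)
    (hM : ∀ᵐ x ∂(volD H), |g x| ≤ M) :
    Tendsto (fun n => ∫ x, u' n x * g x ∂(volD H)) atTop (𝓝 (∫ x, p x * g x ∂(volD H))) := by
  refine tendsto_integral_mul_of_test hH (fun n => (hc n).aestronglyMeasurable measurableSet_Icc)
    (fun n => (ae_mem_volD H).mono (hu' n)) hp hpB hB (fun φ hφ hφc hφs => ?_) hg hM0 hM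
  have hwd := isWeakDeriv_of_primitive hH (Integrable.of_bound hp B hpB) hwp φ hφ hφc hφs
  have hud := fun n => isWeakDeriv_of_hasDerivWithinAt hH (hd n) (hc n) φ hφ hφc hφs
  have e1 : ∀ n, ∫ x, u' n x * φ x ∂(volD H) = -∫ x, u n x * deriv φ x ∂(volD H) :=
    fun n => by rw [hud n, neg_neg]
  have e2 : ∫ x, p x * φ x ∂(volD H) = -∫ x, w x * deriv φ x ∂(volD H) := by rw [hwd, neg_neg]
  simp only [e1, e2]
  refine Tendsto.neg ?_
  have huc : ∀ n, ContinuousOn (u n) (Icc (-H) H) := fun n x hx =>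
    (hd n x hx).continuousWithinAt
  have hφ' : Continuous (deriv φ) := (contDiff_infty_iff_deriv.1 hφ).2.continuous
  obtain ⟨N, hN⟩ := hφ'.bounded_above_of_compact_support hφc.deriv
  exact (tendstoWeakL_of_pointwise (p := ∞) (q := ∞) le_top huc hu hw).2.2 _
    (memLp_top_of_bound hφ'.aestronglyMeasurable N (Eventually.of_forall hN))

/-! ### Convergent subsequences and the limit of the aging equation. -/

namespace Data

variable {P : Data}

/-- Steady states for `η n → 0` with uniform estimates whose unknowns, and the first derivatives
`αs'`, `θs'`, converge pointwise. -/
structure ConvergentStates (P : Data) (B : ℝ) (η : ℕ → ℝ) (εs vs πs αs θs : ℕ → ℝ → ℝ)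
    (σs : ℕ → ℝ) (αs' θs' : ℕ → ℝ → ℝ) (v α α' θ θ' : ℝ → ℝ) (σ : ℝ) : Prop where
  B_nonneg : 0 ≤ B
  η_pos : ∀ n, 0 < η n
  η_lim : Tendsto η atTop (𝓝 0)
  sol : ∀ n, P.IsSteadyState (η n) (εs n) (vs n) (πs n) (αs n) (θs n) (σs n)
  est : ∀ n, P.Estimates B (vs n) (πs n) (αs n) (θs n) (σs n) (αs' n) (θs' n)
  σ_lim : Tendsto σs atTop (𝓝 σ)
  v_lim : ∀ x ∈ Icc (-P.H) P.H, Tendsto (fun n => vs n x) atTop (𝓝 (v x))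
  α_lim : ∀ x ∈ Icc (-P.H) P.H, Tendsto (fun n => αs n x) atTop (𝓝 (α x))
  α'_lim : ∀ x ∈ Icc (-P.H) P.H, Tendsto (fun n => αs' n x) atTop (𝓝 (α' x))
  θ_lim : ∀ x ∈ Icc (-P.H) P.H, Tendsto (fun n => θs n x) atTop (𝓝 (θ x))
  θ'_lim : ∀ x ∈ Icc (-P.H) P.H, Tendsto (fun n => θs' n x) atTop (𝓝 (θ' x))

/-- Subsequences of steady states satisfying the estimates are convergent. -/
theorem exists_convergentStates (hP : P.Standing) (hΦ : P.SuperlinearBound) {η : ℕ → ℝ}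
    (hη : ∀ n, 0 < η n) (hη0 : Tendsto η atTop (𝓝 0)) {εs vs πs αs θs : ℕ → ℝ → ℝ} {σs : ℕ → ℝ}
    (hsol : ∀ n, P.IsSteadyState (η n) (εs n) (vs n) (πs n) (αs n) (θs n) (σs n)) :
    ∃ k : ℕ → ℕ, StrictMono k ∧ ∃ B αs' θs' v α α' θ θ' σ,
      P.ConvergentStates B (fun n => η (k n)) (fun n => εs (k n)) (fun n => vs (k n))
        (fun n => πs (k n)) (fun n => αs (k n)) (fun n => θs (k n)) (fun n => σs (k n))
        αs' θs' v α α' θ θ' σ := by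
  obtain ⟨E, hE⟩ := hη0.bddAbove_range
  obtain ⟨B, hB, hest⟩ := hP.exists_estimates hΦ E
  choose αs' θs' hαθ using fun n => hest _ _ _ _ _ _ _ (hη n) (hE (mem_range_self n)) (hsol n)
  -- One extraction serves all six sequences. The stresses enter as constant functions of `x`, and
  -- their limit is read off at `P.H`.
  obtain ⟨k, hk, g, hg⟩ := exists_subseq_tendsto_of_lipschitz hP.neg_le
    (f := fun (i : Fin 6) n x => ![σs n, vs n x, αs n x, αs' n x, θs n x, θs' n x] i)
    (fun _ => B) (fun _ => B) (fun i n x hx => by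
      fin_cases i
      exacts [(hαθ n).sigma_le, (hαθ n).v_le x hx, (hαθ n).alpha_le x hx, (hαθ n).alpha₁_le x hx,
        (hαθ n).theta_le x hx, (hαθ n).theta₁_le x hx])
    (fun i n x hx y hy => by
      fin_cases i
      · simp only [Fin.zero_eta, Matrix.cons_val_zero, sub_self, abs_zero]
        positivity
      · exact abs_sub_le_of_hasDerivWithinAt (hsol n).rate (hαθ n).pi_le x hx y hy
      · exact abs_sub_le_of_hasDerivWithinAt (hαθ n).alpha_deriv (hαθ n).alpha₁_le x hx y hy
      · exact abs_sub_le_of_hasDerivWithinAt (hαθ n).alpha₁_deriv (hαθ n).damage_le x hx y hy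
      · exact abs_sub_le_of_hasDerivWithinAt (hαθ n).theta_deriv (hαθ n).theta₁_le x hx y hy
      · exact abs_sub_le_of_hasDerivWithinAt (hαθ n).theta₁_deriv (hαθ n).aging_le x hx y hy)
  exact ⟨k, hk, B, fun n => αs' (k n), fun n => θs' (k n), g 1, g 2, g 3, g 4, g 5, g 0 P.H,
    hB.le, fun n => hη _, hη0.comp hk.tendsto_atTop, fun n => hsol _, fun n => hαθ _,
    hg 0 P.H (right_mem_Icc.2 hP.neg_le), hg 1, hg 2, hg 3, hg 4, hg 5⟩

namespace ConvergentStates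

variable {B : ℝ} {η : ℕ → ℝ} {εs vs πs αs θs : ℕ → ℝ → ℝ} {σs : ℕ → ℝ} {αs' θs' : ℕ → ℝ → ℝ}
  {v α α' θ θ' : ℝ → ℝ} {σ : ℝ}

/-- The rates have a common sign, so the velocities are monotone in one direction and so is their
limit. The weak limit of the rates therefore has that sign as well, and `|π n|` converges weakly to
`|p|`. -/
theorem exists_rate (hP : P.Standing)
    (h : P.ConvergentStates B η εs vs πs αs θs σs αs' θs' v α α' θ θ' σ) :
    ∃ p : ℝ → ℝ, Measurable p ∧ (∀ x, |p x| ≤ B) ∧ (∀ x, |p x| = P.drivingSign * p x) ∧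
      ∀ x ∈ Icc (-P.H) P.H, v x = v (-P.H) + ∫ y in (-P.H)..x, p y := by
  obtain ⟨p, h1, h2, h3, h4⟩ := exists_density (s := P.drivingSign) hP.H_pos h.B_nonneg
    (fun n => abs_sub_le_of_hasDerivWithinAt (h.sol n).rate (h.est n).pi_le) (fun n => by
      have hd := fun x hx => ((h.sol n).rate x hx).const_mul P.drivingSign
      refine monotoneOn_of_hasDerivWithinAt_nonneg (f' := fun x => P.drivingSign * πs n x)
        (convex_Icc _ _) (fun x hx => (hd x hx).continuousWithinAt)
        (fun x hx => (hd x (interior_subset hx)).mono interior_subset) fun x hx => ?_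
      rw [← (h.sol n).abs_pi_eq hP (h.η_pos n) x (interior_subset hx)]
      exact abs_nonneg _) h.v_lim
  refine ⟨p, h1, h2, fun x => ?_, h4⟩
  rw [← abs_of_nonneg (h3 x), abs_mul]
  rcases P.drivingSign_cases with e | e <;> simp [e]

theorem theta_abs_le (h : P.ConvergentStates B η εs vs πs αs θs σs αs' θs' v α α' θ θ' σ) :
    ∀ x ∈ Icc (-P.H) P.H, |θ x| ≤ B := fun x hx =>
  le_of_tendsto (h.θ_lim x hx).abs (Eventually.of_forall fun n => (h.est n).theta_le x hx)

theorem theta_continuousOn (h : P.ConvergentStates B η εs vs πs αs θs σs αs' θs' v α α' θ θ' σ) :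
    ContinuousOn θ (Icc (-P.H) P.H) :=
  (lipschitzOnWith_of_tendsto (fun n =>
    abs_sub_le_of_hasDerivWithinAt (h.est n).theta_deriv (h.est n).theta₁_le) h.θ_lim).continuousOn

theorem theta'_continuousOn (h : P.ConvergentStates B η εs vs πs αs θs σs αs' θs' v α α' θ θ' σ) :
    ContinuousOn θ' (Icc (-P.H) P.H) :=
  (lipschitzOnWith_of_tendsto (fun n =>
    abs_sub_le_of_hasDerivWithinAt (h.est n).theta₁_deriv (h.est n).aging_le)
      h.θ'_lim).continuousOn

theorem alpha_continuousOn (h : P.ConvergentStates B η εs vs πs αs θs σs αs' θs' v α α' θ θ' σ) :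
    ContinuousOn α (Icc (-P.H) P.H) :=
  (lipschitzOnWith_of_tendsto (fun n =>
    abs_sub_le_of_hasDerivWithinAt (h.est n).alpha_deriv (h.est n).alpha₁_le) h.α_lim).continuousOn

theorem alpha'_continuousOn (h : P.ConvergentStates B η εs vs πs αs θs σs αs' θs' v α α' θ θ' σ) :
    ContinuousOn α' (Icc (-P.H) P.H) :=
  (lipschitzOnWith_of_tendsto (fun n =>
    abs_sub_le_of_hasDerivWithinAt (h.est n).alpha₁_deriv (h.est n).damage_le)
      h.α'_lim).continuousOn

theorem tendsto_integral_pi_mul (hP : P.Standing)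
    (h : P.ConvergentStates B η εs vs πs αs θs σs αs' θs' v α α' θ θ' σ) {p : ℝ → ℝ}
    (hp : Measurable p) (hpB : ∀ x, |p x| ≤ B)
    (hv : ∀ x ∈ Icc (-P.H) P.H, v x = v (-P.H) + ∫ y in (-P.H)..x, p y) {g : ℝ → ℝ} {M : ℝ}
    (hg : AEStronglyMeasurable g (volD P.H)) (hM0 : 0 ≤ M) (hM : ∀ᵐ x ∂(volD P.H), |g x| ≤ M) :
    Tendsto (fun n => ∫ x, πs n x * g x ∂(volD P.H)) atTop (𝓝 (∫ x, p x * g x ∂(volD P.H))) :=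
  tendsto_integral_mul_of_primitive hP.H_pos h.B_nonneg (fun n => (h.sol n).rate)
    (fun n => (h.sol n).π_cont) (fun n => (h.est n).pi_le) (fun n => (h.est n).v_le) h.v_lim
    hp.aestronglyMeasurable (Eventually.of_forall hpB) hv hg hM0 hM

theorem v_boundary (hP : P.Standing)
    (h : P.ConvergentStates B η εs vs πs αs θs σs αs' θs' v α α' θ θ' σ) :
    v (-P.H) = -P.vInf ∧ v P.H = P.vInf := by
  constructor
  · refine tendsto_nhds_unique (h.v_lim _ (left_mem_Icc.2 hP.neg_le)) ?_
    simp only [(h.sol _).v_left, tendsto_const_nhds]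
  · refine tendsto_nhds_unique (h.v_lim _ (right_mem_Icc.2 hP.neg_le)) ?_
    simp only [(h.sol _).v_right, tendsto_const_nhds]

/-- The right-hand side of the aging equation passes to the limit in integrated form. -/
theorem theta'_eq (hP : P.Standing)
    (h : P.ConvergentStates B η εs vs πs αs θs σs αs' θs' v α α' θ θ' σ) {p : ℝ → ℝ}
    (hp : Measurable p) (hpB : ∀ x, |p x| ≤ B) (hps : ∀ x, |p x| = P.drivingSign * p x)
    (hv : ∀ x ∈ Icc (-P.H) P.H, v x = v (-P.H) + ∫ y in (-P.H)..x, p y) :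
    ∀ x ∈ Icc (-P.H) P.H, θ' x = θ' (-P.H) + ∫ y in (-P.H)..x, P.agingRhs (p y) (θ y) := by
  intro x hx
  have hl := left_mem_Icc.2 hP.neg_le
  refine tendsto_nhds_unique (h.θ'_lim x hx) ?_
  have haging : ∀ n, ContinuousOn (fun y => P.agingRhs (πs n y) (θs n y)) (Icc (-P.H) P.H) :=
    fun n => hP.agingRhs_cont.comp_continuousOn ((h.sol n).π_cont.prodMk (h.sol n).theta_cont)
  have e1 : ∀ n, θs' n x = θs' n (-P.H) + ∫ y in (-P.H)..x, P.agingRhs (πs n y) (θs n y) :=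
    fun n => eq_add_integral_of_hasDerivWithinAt (h.est n).theta₁_deriv (haging n) hl hx
  simp only [e1]
  refine (h.θ'_lim _ hl).add ?_
  set χ : (ℝ → ℝ) → ℝ → ℝ := fun f => (Icc (-P.H) x).indicator f with hχ
  set s := P.drivingSign with hs
  obtain ⟨M₁, hM₁⟩ := isCompact_Icc (a := -B) (b := B) |>.exists_bound_of_continuousOn
    hP.f₁_cont.continuousOn
  obtain ⟨M₀, hM₀⟩ := isCompact_Icc (a := -B) (b := B) |>.exists_bound_of_continuousOn
    hP.f₀_cont.continuousOn
  have hM₁0 : 0 ≤ M₁ := (norm_nonneg _).trans (hM₁ 0 (by simp [h.B_nonneg]))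
  have hM₀0 : 0 ≤ M₀ := (norm_nonneg _).trans (hM₀ 0 (by simp [h.B_nonneg]))
  have hcase : ∀ f : ℝ → ℝ, ∀ y, χ f y = f y ∨ χ f y = 0 := fun f y => by
    by_cases hy : y ∈ Icc (-P.H) x
    · exact Or.inl (indicator_of_mem hy f)
    · exact Or.inr (indicator_of_notMem hy f)
  have hχm : ∀ (f : ℝ → ℝ) (t : ℝ → ℝ), Continuous f → ContinuousOn t (Icc (-P.H) P.H) →
      AEStronglyMeasurable (χ fun y => f (t y)) (volD P.H) := fun f t hf ht =>
    ((hf.comp_continuousOn ht).aestronglyMeasurable measurableSet_Icc).indicator measurableSet_Icc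
  have hχB : ∀ (f : ℝ → ℝ) (t : ℝ → ℝ) (M : ℝ), 0 ≤ M → (∀ r ∈ Icc (-B) B, ‖f r‖ ≤ M) →
      (∀ y ∈ Icc (-P.H) P.H, |t y| ≤ B) → ∀ᵐ y ∂(volD P.H), |χ (fun y => f (t y)) y| ≤ M := by
    intro f t M hM hf ht
    filter_upwards [ae_mem_volD P.H] with y hy
    rcases hcase (fun y => f (t y)) y with e | e <;> rw [e]
    · exact hf _ (abs_le.1 (ht y hy))
    · simpa using hM
  have hχl : ∀ f : ℝ → ℝ, Continuous f → ∀ᵐ y ∂(volD P.H),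
      Tendsto (fun n => χ (fun y => f (θs n y)) y) atTop (𝓝 (χ (fun y => f (θ y)) y)) := by
    intro f hf
    filter_upwards [ae_mem_volD P.H] with y hy
    by_cases hy' : y ∈ Icc (-P.H) x
    · simp only [hχ, indicator_of_mem hy']
      exact (hf.tendsto _).comp (h.θ_lim y hy)
    · simp only [hχ, indicator_of_notMem hy', tendsto_const_nhds]
  -- Writing `|q|` as `s * q` makes the integral linear in the rate. The coefficient `f₁ (t y)`
  -- converges strongly, so weak convergence of the rates suffices.
  have split : ∀ q t : ℝ → ℝ, (∀ y ∈ Icc (-P.H) P.H, |q y| = s * q y) →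
      AEStronglyMeasurable q (volD P.H) → (∀ y ∈ Icc (-P.H) P.H, |q y| ≤ B) →
      ContinuousOn t (Icc (-P.H) P.H) → (∀ y ∈ Icc (-P.H) P.H, |t y| ≤ B) →
      ∫ y in (-P.H)..x, P.agingRhs (q y) (t y) =
        (s * ∫ y, q y * χ (fun y => P.f₁ (t y)) y ∂(volD P.H) -
          ∫ y, χ (fun y => P.f₀ (t y)) y ∂(volD P.H)) / P.κ := by
    intro q t hqs hqm hqB ht htB
    have i0 : Integrable (χ fun y => P.f₀ (t y)) (volD P.H) :=
      Integrable.of_bound (hχm _ _ hP.f₀_cont ht) M₀ (hχB _ _ M₀ hM₀0 hM₀ htB)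
    have i1 : Integrable (χ fun y => P.f₁ (t y)) (volD P.H) :=
      Integrable.of_bound (hχm _ _ hP.f₁_cont ht) M₁ (hχB _ _ M₁ hM₁0 hM₁ htB)
    have i2 : Integrable (fun y => q y * χ (fun y => P.f₁ (t y)) y) (volD P.H) :=
      i1.bdd_mul hqm ((ae_mem_volD P.H).mono hqB)
    rw [setIntegral_volD_eq hx, ← integral_const_mul, ← integral_sub (i2.const_mul s) i0,
      ← integral_div]
    refine integral_congr_ae ?_
    filter_upwards [ae_mem_volD P.H] with y hy
    by_cases hy' : y ∈ Icc (-P.H) x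
    · simp only [hχ, indicator_of_mem hy', agingRhs, hqs y hy]
      ring
    · simp only [hχ, indicator_of_notMem hy']
      ring
  rw [split p θ (fun y _ => hps y) hp.aestronglyMeasurable (fun y _ => hpB y)
    h.theta_continuousOn h.theta_abs_le]
  have hsplit : ∀ n, ∫ y in (-P.H)..x, P.agingRhs (πs n y) (θs n y) =
        (s * ∫ y, πs n y * χ (fun y => P.f₁ (θs n y)) y ∂(volD P.H) -
          ∫ y, χ (fun y => P.f₀ (θs n y)) y ∂(volD P.H)) / P.κ := fun n =>
    split _ _ ((h.sol n).abs_pi_eq hP (h.η_pos n))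
      ((h.sol n).π_cont.aestronglyMeasurable measurableSet_Icc) (h.est n).pi_le
      (h.sol n).theta_cont (h.est n).theta_le
  simp only [hsplit]
  refine Tendsto.div_const (Tendsto.sub (Tendsto.const_mul s ?_) ?_) _
  · refine tendsto_integral_mul_of_weak_strong (B := B) (M := M₁)
      (fun n => (h.sol n).π_cont.aestronglyMeasurable measurableSet_Icc)
      (fun n => (ae_mem_volD P.H).mono (h.est n).pi_le)
      (fun n => hχm _ _ hP.f₁_cont (h.sol n).theta_cont)
      (fun n => hχB _ _ M₁ hM₁0 hM₁ (h.est n).theta_le) (hχl _ hP.f₁_cont) ?_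
    exact h.tendsto_integral_pi_mul hP hp hpB hv (hχm _ _ hP.f₁_cont h.theta_continuousOn) hM₁0
      (hχB _ _ M₁ hM₁0 hM₁ h.theta_abs_le)
  · exact tendsto_integral_volD (B := M₀) (fun n => hχm _ _ hP.f₀_cont (h.sol n).theta_cont)
      (fun n => hχB _ _ M₀ hM₀0 hM₀ (h.est n).theta_le) (hχl _ hP.f₀_cont)

end ConvergentStates

/-! ### The limit of the flow rule. -/

theorem Standing.R_comp_aestronglyMeasurable (hP : P.Standing) {q t : ℝ → ℝ}
    (hq : AEStronglyMeasurable q (volD P.H)) (ht : AEStronglyMeasurable t (volD P.H)) :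
    AEStronglyMeasurable (fun x => P.R (q x) (t x)) (volD P.H) :=
  hP.R_cont.comp_aestronglyMeasurable (hq.prodMk ht)

theorem measurable_sign : Measurable Real.sign := by
  have : Real.sign = fun x : ℝ => if x < 0 then (-1 : ℝ) else if 0 < x then 1 else 0 := rfl
  rw [this]
  exact Measurable.ite measurableSet_Iio measurable_const
    (Measurable.ite measurableSet_Ioi measurable_const measurable_const)

theorem Standing.flowSel_comp_aestronglyMeasurable (hP : P.Standing) {q t : ℝ → ℝ}
    (hq : Measurable q) (ht : AEStronglyMeasurable t (volD P.H)) :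
    AEStronglyMeasurable (fun x => P.flowSel (q x) (t x)) (volD P.H) :=
  (hP.μ_cont.comp_aestronglyMeasurable (hq.aestronglyMeasurable.prodMk ht)).mul
    (measurable_sign.comp hq).aestronglyMeasurable

theorem Standing.exists_R_bound (hP : P.Standing) (M : ℝ) :
    ∃ N, ∀ p t, |p| ≤ M → |t| ≤ M → |P.R p t| ≤ N := by
  obtain ⟨N, hN⟩ := ((isCompact_Icc (a := -M) (b := M)).prod
    (isCompact_Icc (a := -M) (b := M))).exists_bound_of_continuousOn hP.R_cont.continuousOn
  exact ⟨N, fun p t hp ht => hN (p, t) ⟨abs_le.1 hp, abs_le.1 ht⟩⟩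

theorem Standing.exists_flowSel_bound (hP : P.Standing) (M : ℝ) :
    ∃ N, ∀ p t, |p| ≤ M → |t| ≤ M → |P.flowSel p t| ≤ N := by
  obtain ⟨N, hN⟩ := ((isCompact_Icc (a := -M) (b := M)).prod
    (isCompact_Icc (a := -M) (b := M))).exists_bound_of_continuousOn hP.μ_cont.continuousOn
  refine ⟨N, fun p t hp ht => ?_⟩
  have h1 := hN (p, t) ⟨abs_le.1 hp, abs_le.1 ht⟩
  rw [flowSel, abs_mul]
  refine (mul_le_of_le_one_right (abs_nonneg _) ?_).trans h1
  rcases Real.sign_apply_eq p with e | e | e <;> rw [e] <;> norm_num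

theorem Standing.flowSel_cont_right (hP : P.Standing) (p : ℝ) :
    Continuous fun t => P.flowSel p t := (hP.mu_cont_right p).mul continuous_const

namespace ConvergentStates

variable {B : ℝ} {η : ℕ → ℝ} {εs vs πs αs θs : ℕ → ℝ → ℝ} {σs : ℕ → ℝ} {αs' θs' : ℕ → ℝ → ℝ}
  {v α α' θ θ' : ℝ → ℝ} {σ : ℝ}

theorem integral_rate_eq (hP : P.Standing)
    (h : P.ConvergentStates B η εs vs πs αs θs σs αs' θs' v α α' θ θ' σ) {p : ℝ → ℝ}
    (hv : ∀ x ∈ Icc (-P.H) P.H, v x = v (-P.H) + ∫ y in (-P.H)..x, p y) :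
    ∫ x, p x ∂(volD P.H) = 2 * P.vInf := by
  have h1 := hv _ (right_mem_Icc.2 hP.neg_le)
  rw [(h.v_boundary hP).1, (h.v_boundary hP).2, ← integral_volD hP.H_pos.le] at h1
  linarith

/-- The limit flow rule tested with smooth functions. -/
theorem integral_R_le_test (hP : P.Standing)
    (h : P.ConvergentStates B η εs vs πs αs θs σs αs' θs' v α α' θ θ' σ) {p : ℝ → ℝ}
    (hp : Measurable p) (hpB : ∀ x, |p x| ≤ B)
    (hv : ∀ x ∈ Icc (-P.H) P.H, v x = v (-P.H) + ∫ y in (-P.H)..x, p y)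
    {φ : ℝ → ℝ} (hφ : ContDiff ℝ ∞ φ) (hφc : HasCompactSupport φ)
    (hφs : tsupport φ ⊆ Ioo (-P.H) P.H) :
    ∫ x, P.R (p x) (θ x) ∂(volD P.H) ≤ ∫ x, P.R (φ x) (θ x) ∂(volD P.H) -
      σ * (∫ x, φ x ∂(volD P.H) - 2 * P.vInf) := by
  have hpm : AEStronglyMeasurable p (volD P.H) := hp.aestronglyMeasurable
  have hθm : ∀ n, AEStronglyMeasurable (θs n) (volD P.H) := fun n =>
    (h.sol n).theta_cont.aestronglyMeasurable measurableSet_Icc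
  have hθm' : AEStronglyMeasurable θ (volD P.H) :=
    h.theta_continuousOn.aestronglyMeasurable measurableSet_Icc
  have hπm : ∀ n, AEStronglyMeasurable (πs n) (volD P.H) := fun n =>
    (h.sol n).π_cont.aestronglyMeasurable measurableSet_Icc
  obtain ⟨M, hM⟩ := hφ.continuous.bounded_above_of_compact_support hφc
  obtain ⟨N, hN⟩ := hP.exists_R_bound (max B M)
  obtain ⟨Z, hZ⟩ := hP.exists_flowSel_bound B
  have hZ0 : 0 ≤ Z := (abs_nonneg _).trans (hZ 0 0 (by simpa using h.B_nonneg)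
    (by simpa using h.B_nonneg))
  have hRlim : ∀ q : ℝ → ℝ, AEStronglyMeasurable q (volD P.H) → (∀ x, |q x| ≤ max B M) →
      Tendsto (fun n => ∫ x, P.R (q x) (θs n x) ∂(volD P.H)) atTop
        (𝓝 (∫ x, P.R (q x) (θ x) ∂(volD P.H))) := fun q hq hqM =>
    tendsto_integral_volD (B := N) (fun n => hP.R_comp_aestronglyMeasurable hq (hθm n))
      (fun n => (ae_mem_volD P.H).mono fun x hx =>
        hN _ _ (hqM x) (((h.est n).theta_le x hx).trans (le_max_left _ _)))
      ((ae_mem_volD P.H).mono fun x hx => (hP.R_cont.tendsto (q x, θ x)).comp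
        (tendsto_const_nhds.prodMk_nhds (h.θ_lim x hx)))
  -- Lower semicontinuity with a moving age: `R(π n, θ n)` lies above `R(p, θ n) + flowSel(p, θ n)
  -- (π n - p)`. The slope is taken at the fixed `p`, where it is continuous in the age, so it
  -- converges strongly and the linear correction tends to zero.
  have hsel : Tendsto (fun n => ∫ x, (πs n x - p x) * P.flowSel (p x) (θs n x) ∂(volD P.H)) atTop
      (𝓝 (∫ x, (0 : ℝ) * P.flowSel (p x) (θ x) ∂(volD P.H))) := by
    have hsm : ∀ t, AEStronglyMeasurable t (volD P.H) →
        AEStronglyMeasurable (fun x => P.flowSel (p x) (t x)) (volD P.H) := fun t ht =>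
      hP.flowSel_comp_aestronglyMeasurable hp ht
    have hsZ : ∀ᵐ x ∂(volD P.H), |P.flowSel (p x) (θ x)| ≤ Z :=
      (ae_mem_volD P.H).mono fun x hx => hZ _ _ (hpB x) (h.theta_abs_le x hx)
    refine tendsto_integral_mul_of_weak_strong (u := fun n x => πs n x - p x) (w := fun _ => 0)
      (f := fun x => P.flowSel (p x) (θ x)) (B := 2 * B) (M := Z)
      (fun n => (hπm n).sub hpm) (fun n => (ae_mem_volD P.H).mono fun x hx => ?_)
      (fun n => hsm _ (hθm n)) (fun n => (ae_mem_volD P.H).mono fun x hx =>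
        hZ _ _ (hpB x) ((h.est n).theta_le x hx))
      ((ae_mem_volD P.H).mono fun x hx =>
        ((hP.flowSel_cont_right (p x)).tendsto _).comp (h.θ_lim x hx)) ?_
    · have := abs_sub (πs n x) (p x)
      linarith [(h.est n).pi_le x hx, hpB x]
    · have hw := h.tendsto_integral_pi_mul hP hp hpB hv (hsm _ hθm') hZ0 hsZ
      have hgi : Integrable (fun x => P.flowSel (p x) (θ x)) (volD P.H) :=
        Integrable.of_bound (hsm _ hθm') Z hsZ
      have i2 : Integrable (fun x => p x * P.flowSel (p x) (θ x)) (volD P.H) :=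
        hgi.bdd_mul hpm (Eventually.of_forall hpB)
      have := hw.sub_const (∫ x, p x * P.flowSel (p x) (θ x) ∂(volD P.H))
      rw [sub_self] at this
      simp only [zero_mul, integral_zero]
      refine this.congr fun n => ?_
      have i1 : Integrable (fun x => πs n x * P.flowSel (p x) (θ x)) (volD P.H) :=
        hgi.bdd_mul (hπm n) ((ae_mem_volD P.H).mono (h.est n).pi_le)
      simp only [sub_mul]
      rw [integral_sub i1 i2]
  simp only [zero_mul, integral_zero] at hsel
  have hφ2 : ContDiff ℝ ∞ (deriv (deriv φ)) :=
    (contDiff_infty_iff_deriv.1 (contDiff_infty_iff_deriv.1 hφ).2).2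
  obtain ⟨M₂, hM₂⟩ := hφ2.continuous.bounded_above_of_compact_support hφc.deriv.deriv
  -- The integral converges because `φ''` is bounded, so the factor `η n` sends the viscous term to
  -- zero.
  have hvisc := h.η_lim.mul (h.tendsto_integral_pi_mul hP hp hpB hv
    hφ2.continuous.aestronglyMeasurable ((norm_nonneg _).trans (hM₂ 0))
    (Eventually.of_forall hM₂))
  have hleft := (hRlim p hpm fun x => (hpB x).trans (le_max_left _ _)).add hsel
  have hright := ((hRlim φ hφ.continuous.aestronglyMeasurable
    fun x => (hM x).trans (le_max_right _ _)).sub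
      (h.σ_lim.mul_const (∫ x, φ x ∂(volD P.H) - 2 * P.vInf))).sub hvisc
  rw [add_zero] at hleft
  rw [zero_mul, sub_zero] at hright
  refine le_of_tendsto_of_tendsto hleft hright (Eventually.of_forall fun n => ?_)
  refine le_trans ?_ ((h.sol n).integral_R_le hP (h.η_pos n) hφ hφc hφs)
  have i1 : Integrable (fun x => P.R (p x) (θs n x)) (volD P.H) :=
    Integrable.of_bound (hP.R_comp_aestronglyMeasurable hpm (hθm n)) N
      ((ae_mem_volD P.H).mono fun x hx => hN _ _ ((hpB x).trans (le_max_left _ _))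
        (((h.est n).theta_le x hx).trans (le_max_left _ _)))
  have i2 : Integrable (fun x => (πs n x - p x) * P.flowSel (p x) (θs n x)) (volD P.H) := by
    have j : Integrable (fun x => P.flowSel (p x) (θs n x)) (volD P.H) :=
      Integrable.of_bound (hP.flowSel_comp_aestronglyMeasurable hp (hθm n)) Z
        ((ae_mem_volD P.H).mono fun x hx => hZ _ _ (hpB x) ((h.est n).theta_le x hx))
    refine j.bdd_mul (c := 2 * B) ((hπm n).sub hpm) ((ae_mem_volD P.H).mono fun x hx => ?_)
    have := abs_sub (πs n x) (p x)
    rw [Real.norm_eq_abs]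
    linarith [(h.est n).pi_le x hx, hpB x]
  simp only
  rw [← integral_add i1 i2]
  refine integral_mono (i1.add i2) ((h.sol n).R_comp_integrable hP) fun x => ?_
  have := hP.R_subgradient (p x) (πs n x) (θs n x)
  linarith

/-- The limit flow rule tested with bounded functions. -/
theorem integral_R_le_bounded (hP : P.Standing)
    (h : P.ConvergentStates B η εs vs πs αs θs σs αs' θs' v α α' θ θ' σ) {p : ℝ → ℝ}
    (hp : Measurable p) (hpB : ∀ x, |p x| ≤ B)
    (hv : ∀ x ∈ Icc (-P.H) P.H, v x = v (-P.H) + ∫ y in (-P.H)..x, p y)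
    {q : ℝ → ℝ} {M : ℝ} (hq : AEStronglyMeasurable q (volD P.H)) (hM0 : 0 ≤ M)
    (hqM : ∀ x, |q x| ≤ M) :
    ∫ x, P.R (p x) (θ x) ∂(volD P.H) ≤ ∫ x, P.R (q x) (θ x) ∂(volD P.H) -
      σ * (∫ x, q x ∂(volD P.H) - 2 * P.vInf) := by
  obtain ⟨φ, hφ, hφq⟩ := exists_test_approx hP.H_pos hM0 hq (Eventually.of_forall hqM)
  have hφm : ∀ j, AEStronglyMeasurable (φ j) (volD P.H) := fun j =>
    (hφ j).1.continuous.aestronglyMeasurable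
  have hθm : AEStronglyMeasurable θ (volD P.H) :=
    h.theta_continuousOn.aestronglyMeasurable measurableSet_Icc
  obtain ⟨N, hN⟩ := hP.exists_R_bound (max B M)
  have l1 := tendsto_integral_volD (B := N)
    (fun j => hP.R_comp_aestronglyMeasurable (hφm j) hθm)
    (fun j => (ae_mem_volD P.H).mono fun x hx => hN _ _ (((hφ j).2.2.2 x).trans (le_max_right _ _))
      ((h.theta_abs_le x hx).trans (le_max_left _ _)))
    (hφq.mono fun x hx => (hP.R_cont.tendsto (q x, θ x)).comp (hx.prodMk_nhds tendsto_const_nhds))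
  have l2 := tendsto_integral_volD (B := M) hφm
    (fun j => Eventually.of_forall (hφ j).2.2.2) hφq
  exact ge_of_tendsto (l1.sub ((l2.sub_const (2 * P.vInf)).const_mul σ)) (Eventually.of_forall
    fun j => h.integral_R_le_test hP hp hpB hv (hφ j).1 (hφ j).2.1 (hφ j).2.2.1)

/-- The limit flow rule holds almost everywhere. -/
theorem ae_mem_flowSet (hP : P.Standing)
    (h : P.ConvergentStates B η εs vs πs αs θs σs αs' θs' v α α' θ θ' σ) {p : ℝ → ℝ}
    (hp : Measurable p) (hpB : ∀ x, |p x| ≤ B)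
    (hv : ∀ x ∈ Icc (-P.H) P.H, v x = v (-P.H) + ∫ y in (-P.H)..x, p y) :
    ∀ᵐ x ∂(volD P.H), σ ∈ P.flowSet (p x) (θ x) := by
  have hpm : AEStronglyMeasurable p (volD P.H) := hp.aestronglyMeasurable
  have hθm : AEStronglyMeasurable θ (volD P.H) :=
    h.theta_continuousOn.aestronglyMeasurable measurableSet_Icc
  have hRi : ∀ q : ℝ → ℝ, AEStronglyMeasurable q (volD P.H) → ∀ M, (∀ x, |q x| ≤ M) →
      Integrable (fun x => P.R (q x) (θ x)) (volD P.H) := fun q hq M hqM => by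
    obtain ⟨N, hN⟩ := hP.exists_R_bound (max B M)
    exact Integrable.of_bound (hP.R_comp_aestronglyMeasurable hq hθm) N
      ((ae_mem_volD P.H).mono fun x hx => hN _ _ ((hqM x).trans (le_max_right _ _))
        ((h.theta_abs_le x hx).trans (le_max_left _ _)))
  have hpi : Integrable p (volD P.H) := Integrable.of_bound hpm B (Eventually.of_forall hpB)
  have key : ∀ q₀ : ℝ, ∀ᵐ x ∂(volD P.H),
      0 ≤ P.R q₀ (θ x) - σ * (q₀ - p x) - P.R (p x) (θ x) := by
    intro q₀
    have j1 := hRi (fun _ => q₀) aestronglyMeasurable_const |q₀| fun _ => le_rfl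
    have j2 := hRi p hpm B hpB
    have j3 : Integrable (fun x => σ * (q₀ - p x)) (volD P.H) :=
      ((integrable_const q₀).sub hpi).const_mul σ
    refine ae_nonneg_of_forall_setIntegral_nonneg ((j1.sub j3).sub j2) fun A hA _ => ?_
    classical
    -- This competitor differs from `p` only on `A`, so the integrated inequality reduces to an
    -- integral over `A`. The constraint term `2 * vInf` is the integral of `p` and combines with
    -- that of `q`.
    set q : ℝ → ℝ := A.piecewise (fun _ => q₀) p with hq
    have hqmeas : Measurable q := Measurable.piecewise hA measurable_const hp
    have hqM : ∀ x, |q x| ≤ max |q₀| B := fun x => by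
      by_cases hx : x ∈ A
      · rw [hq, piecewise_eq_of_mem _ _ _ hx]; exact le_max_left _ _
      · rw [hq, piecewise_eq_of_notMem _ _ _ hx]; exact (hpB x).trans (le_max_right _ _)
    have hle := h.integral_R_le_bounded hP hp hpB hv hqmeas.aestronglyMeasurable
      ((abs_nonneg q₀).trans (le_max_left _ B)) hqM
    rw [← h.integral_rate_eq hP hv] at hle
    have hqi : Integrable q (volD P.H) :=
      Integrable.of_bound hqmeas.aestronglyMeasurable _ (Eventually.of_forall hqM)
    have j4 := hRi q hqmeas.aestronglyMeasurable _ hqM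
    have j5 : Integrable (fun x => σ * (q x - p x)) (volD P.H) := (hqi.sub hpi).const_mul σ
    rw [← integral_indicator hA]
    have heq : ∀ x, A.indicator (fun x => P.R q₀ (θ x) - σ * (q₀ - p x) - P.R (p x) (θ x)) x =
        P.R (q x) (θ x) - σ * (q x - p x) - P.R (p x) (θ x) := fun x => by
      by_cases hx : x ∈ A
      · rw [indicator_of_mem hx, hq, piecewise_eq_of_mem _ _ _ hx]
      · rw [indicator_of_notMem hx, hq, piecewise_eq_of_notMem _ _ _ hx]; ring
    have j6 : Integrable (fun x => P.R (q x) (θ x) - σ * (q x - p x)) (volD P.H) := j4.sub j5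
    have hint : ∫ x, A.indicator (fun x => P.R q₀ (θ x) - σ * (q₀ - p x) - P.R (p x) (θ x)) x
        ∂(volD P.H) = ∫ x, P.R (q x) (θ x) ∂(volD P.H) -
          σ * (∫ x, q x ∂(volD P.H) - ∫ x, p x ∂(volD P.H)) -
            ∫ x, P.R (p x) (θ x) ∂(volD P.H) := by
      rw [← integral_sub hqi hpi, ← integral_const_mul, ← integral_sub j4 j5,
        ← integral_sub j6 j2]
      exact integral_congr_ae (Eventually.of_forall heq)
    change 0 ≤ ∫ x, A.indicator (fun x => P.R q₀ (θ x) - σ * (q₀ - p x) - P.R (p x) (θ x)) x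
      ∂(volD P.H)
    rw [hint]
    linarith
  -- The exceptional null set depends on `q₀`; rational values give a common one, and continuity of
  -- `R` in the rate recovers all real values.
  have hQ : ∀ᵐ x ∂(volD P.H), ∀ q₀ : ℚ,
      0 ≤ P.R q₀ (θ x) - σ * (q₀ - p x) - P.R (p x) (θ x) := ae_all_iff.2 fun q₀ => key q₀
  filter_upwards [hQ] with x hx
  rw [hP.mem_flowSet_iff]
  intro q
  have hcl : IsClosed {q : ℝ | 0 ≤ P.R q (θ x) - σ * (q - p x) - P.R (p x) (θ x)} := by
    have : Continuous fun q : ℝ => P.R q (θ x) :=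
      hP.R_cont.comp (continuous_id.prodMk continuous_const)
    exact isClosed_le continuous_const (by fun_prop)
  have hmem : q ∈ {q : ℝ | 0 ≤ P.R q (θ x) - σ * (q - p x) - P.R (p x) (θ x)} := by
    have := closure_minimal (s := range ((↑) : ℚ → ℝ)) (by rintro _ ⟨r, rfl⟩; exact hx r) hcl
    exact this (Rat.denseRange_cast (𝕜 := ℝ) q)
  have hmem' : 0 ≤ P.R q (θ x) - σ * (q - p x) - P.R (p x) (θ x) := hmem
  linarith

end ConvergentStates

/-! ### The strictly convex case -/

/-- Solutions are the minimisers of `R(·, t) - s ·`. Superlinear growth makes this function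
coercive, and strict convexity at the midpoint excludes two minimisers. -/
theorem Standing.flowInv_eq_iff (hP : P.Standing) (hΦ : P.SuperlinearBound)
    (hc : ∀ t, StrictConvexOn ℝ univ fun p => P.R p t) (s t p : ℝ) :
    P.flowInv s t = p ↔ s ∈ P.flowSet p t := by
  have hRc : Continuous fun q => P.R q t - s * q :=
    (hP.R_cont.comp (continuous_id.prodMk continuous_const)).sub (continuous_const.mul continuous_id)
  obtain ⟨K, hK, hKR⟩ := hΦ.exists_bound |s|
  have hex : ∃ p, s ∈ P.flowSet p t := by
    obtain ⟨p, hp⟩ := hRc.exists_forall_le_of_isBounded 0 (by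
      refine (Metric.isBounded_Icc (-K) K).subset fun q hq => ?_
      have hq' : P.R q t - s * q ≤ P.R 0 t - s * 0 := hq
      rw [R_zero] at hq'
      by_contra hn
      have h1 := hKR q t (by rwa [← not_le, abs_le])
      have h2 : s * q ≤ |s| * |q| := by rw [← abs_mul]; exact le_abs_self _
      linarith)
    exact ⟨p, hP.mem_flowSet_iff.2 fun q => by linarith [hp q]⟩
  have huniq : ∀ p q, s ∈ P.flowSet p t → s ∈ P.flowSet q t → p = q := by
    intro p q hp hq
    rw [hP.mem_flowSet_iff] at hp hq
    by_contra hne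
    have h1 := (hc t).2 (mem_univ p) (mem_univ q) hne (by norm_num : (0 : ℝ) < 1 / 2)
      (by norm_num : (0 : ℝ) < 1 / 2) (by norm_num)
    simp only [smul_eq_mul] at h1
    have h2 := hp (1 / 2 * p + 1 / 2 * q)
    have h3 := hq (1 / 2 * p + 1 / 2 * q)
    linarith
  have hspec : s ∈ P.flowSet (P.flowInv s t) t := Classical.epsilon_spec hex
  exact ⟨fun e => e ▸ hspec, fun hp => huniq _ _ hspec hp⟩

/-- The minimisers lie in a compact interval independent of `t`. By joint continuity of `R` every
cluster point minimises the limit functional, and uniqueness identifies it. -/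
theorem Standing.flowInv_continuous (hP : P.Standing) (hΦ : P.SuperlinearBound)
    (hc : ∀ t, StrictConvexOn ℝ univ fun p => P.R p t) (s : ℝ) :
    Continuous fun t => P.flowInv s t := by
  obtain ⟨K, hK, hKR⟩ := hΦ.exists_bound |s|
  have hspec : ∀ t q, P.R (P.flowInv s t) t ≤ P.R q t - s * (q - P.flowInv s t) := fun t =>
    hP.mem_flowSet_iff.1 ((hP.flowInv_eq_iff hΦ hc s t _).1 rfl)
  have hbd : ∀ t, P.flowInv s t ∈ Icc (-K) K := by
    intro t
    refine abs_le.1 ?_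
    by_contra hn
    have h1 := hKR _ t (not_le.1 hn)
    have h2 := hspec t 0
    rw [R_zero] at h2
    have h3 : s * P.flowInv s t ≤ |s| * |P.flowInv s t| := by
      rw [← abs_mul]; exact le_abs_self _
    linarith
  rw [continuous_iff_seqContinuous]
  intro ts t hts
  refine tendsto_of_subseq_tendsto fun ns hns => ?_
  obtain ⟨p, -, k, hk, hlim⟩ := isCompact_Icc.tendsto_subseq fun n => hbd (ts (ns n))
  refine ⟨k, ?_⟩
  have htk : Tendsto (fun n => ts (ns (k n))) atTop (𝓝 t) :=
    hts.comp (hns.comp hk.tendsto_atTop)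
  have hp : P.flowInv s t = p := by
    rw [hP.flowInv_eq_iff hΦ hc, hP.mem_flowSet_iff]
    intro q
    have l1 := (hP.R_cont.tendsto (p, t)).comp (hlim.prodMk_nhds htk)
    have l2 := ((hP.R_cont.tendsto (q, t)).comp ((tendsto_const_nhds (x := q)).prodMk_nhds htk)).sub
      ((hlim.const_sub q).const_mul s)
    exact le_of_tendsto_of_tendsto l1 l2 (Eventually.of_forall fun n => hspec _ q)
  change Tendsto _ _ (𝓝 (P.flowInv s t))
  rw [hp]
  exact hlim

end Data

/-! ### Convergence of the unknowns and the limit balance equations. -/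

theorem exists_bound_of_memLp_top {H : ℝ} {g : ℝ → ℝ} (hg : MemLp g (∞ : ℝ≥0∞) (volD H)) :
    ∃ M, 0 ≤ M ∧ ∀ᵐ x ∂(volD H), |g x| ≤ M := by
  have hfin : eLpNormEssSup g (volD H) ≠ (∞ : ℝ≥0∞) := by
    rw [← eLpNorm_exponent_top]; exact hg.2.ne
  refine ⟨(eLpNormEssSup g (volD H)).toReal, ENNReal.toReal_nonneg, ?_⟩
  filter_upwards [ae_le_eLpNormEssSup (f := g) (μ := volD H)] with x hx
  have := ENNReal.toReal_mono hfin hx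
  rwa [toReal_enorm, Real.norm_eq_abs] at this

theorem integral_congr_of_ae_volD {H : ℝ} {p q : ℝ → ℝ} (h : ∀ᵐ y ∂(volD H), p y = q y) {x : ℝ}
    (hx : x ∈ Icc (-H) H) : ∫ y in (-H)..x, p y = ∫ y in (-H)..x, q y := by
  refine intervalIntegral.integral_congr_ae ?_
  filter_upwards [ae_volD_iff.1 h] with y hy hy'
  rw [uIoc_of_le hx.1] at hy'
  exact hy ⟨hy'.1.le, hy'.2.trans hx.2⟩

namespace Data

variable {P : Data}

/-- The derivative of the strain `s / C(α)` in terms of `a = α` and `a' = α'`. -/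
noncomputable def strainSlope (P : Data) (a s a' : ℝ) : ℝ :=
  -(s * (deriv P.C a * a')) / P.C a ^ 2

/-- The second derivative of the strain `s / C(α)` in terms of `α`, `α'` and `α''`. -/
noncomputable def strainCurv (P : Data) (a s a' a'' : ℝ) : ℝ :=
  (-(s * (deriv (deriv P.C) a * a' * a' + deriv P.C a * a'')) * P.C a ^ 2 -
    -(s * (deriv P.C a * a')) * (2 * P.C a * (deriv P.C a * a'))) / (P.C a ^ 2) ^ 2

theorem Standing.hasDerivWithinAt_strain (hP : P.Standing) {s x : ℝ} {D : Set ℝ} {α ε : ℝ → ℝ}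
    {a' : ℝ} (hx : x ∈ D) (hε : ∀ y ∈ D, P.C (α y) * ε y = s) (hα : HasDerivWithinAt α a' D x) :
    HasDerivWithinAt ε (P.strainSlope (α x) s a') D x := by
  have hCd : HasDerivAt P.C (deriv P.C (α x)) (α x) :=
    (hP.C_smooth.differentiable (by norm_num) _).hasDerivAt
  have h1 := ((hCd.comp_hasDerivWithinAt x hα).fun_inv (hP.C_ne _)).const_mul s
  have heq : ∀ y ∈ D, ε y = s * ((P.C ∘ α) y)⁻¹ := fun y hy => by
    rw [← hε y hy, Function.comp]
    have := hP.C_ne (α y)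
    field_simp
  refine (h1.congr heq (heq x hx)).congr_deriv ?_
  simp only [strainSlope, Function.comp]
  ring

theorem Standing.hasDerivWithinAt_strainSlope (hP : P.Standing) (hC : ContDiff ℝ 2 P.C)
    {s x : ℝ} {D : Set ℝ} {α α' : ℝ → ℝ} {a'' : ℝ} (hα : HasDerivWithinAt α (α' x) D x)
    (hα' : HasDerivWithinAt α' a'' D x) :
    HasDerivWithinAt (fun y => P.strainSlope (α y) s (α' y))
      (P.strainCurv (α x) s (α' x) a'') D x := by
  have hC1 : ContDiff ℝ 1 (deriv P.C) := (contDiff_succ_iff_deriv (n := 1).1 hC).2.2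
  have hCd : HasDerivAt P.C (deriv P.C (α x)) (α x) :=
    (hP.C_smooth.differentiable (by norm_num) _).hasDerivAt
  have hCd' : HasDerivAt (deriv P.C) (deriv (deriv P.C) (α x)) (α x) :=
    (hC1.differentiable (by norm_num) _).hasDerivAt
  have h1 := (((hCd'.comp_hasDerivWithinAt x hα).mul hα').const_mul s).fun_neg
  have h2 := (hCd.comp_hasDerivWithinAt x hα).fun_pow 2
  have h3 := h1.fun_div h2 (pow_ne_zero 2 (hP.C_ne _))
  refine h3.congr_deriv ?_
  simp only [strainCurv, Function.comp, Pi.mul_apply]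
  push_cast
  ring

theorem Standing.strainSlope_cont (hP : P.Standing) :
    Continuous fun z : ℝ × ℝ × ℝ => P.strainSlope z.1 z.2.1 z.2.2 := by
  have h1 : Continuous (deriv P.C) := hP.C_smooth.continuous_deriv le_rfl
  have h2 : Continuous P.C := hP.C_smooth.continuous
  unfold strainSlope
  exact Continuous.div (by fun_prop) (by fun_prop) fun z => pow_ne_zero 2 (hP.C_ne _)

/-- Inserting the damage equation for `α''` leaves a continuous function of `(α, σ, α')`, all of
which converge pointwise. -/
theorem Standing.strainCurv_cont (hP : P.Standing) (hC : ContDiff ℝ 2 P.C) :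
    Continuous fun z : ℝ × ℝ × ℝ =>
      P.strainCurv z.1 z.2.1 z.2.2 (P.damageRhs z.1 z.2.1) := by
  have hC1 : ContDiff ℝ 1 (deriv P.C) := (contDiff_succ_iff_deriv (n := 1).1 hC).2.2
  have h0 : Continuous (deriv (deriv P.C)) := hC1.continuous_deriv le_rfl
  have h1 : Continuous (deriv P.C) := hC1.continuous
  have h2 : Continuous P.C := hP.C_smooth.continuous
  have h3 : Continuous fun z : ℝ × ℝ × ℝ => P.damageRhs z.1 z.2.1 :=
    hP.damageRhs_cont.comp (continuous_fst.prodMk (continuous_fst.comp continuous_snd))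
  unfold strainCurv
  exact Continuous.div (by fun_prop) (by fun_prop)
    fun z => pow_ne_zero 2 (pow_ne_zero 2 (hP.C_ne _))

theorem Standing.tendsto_damageRhs (hP : P.Standing) {a s : ℕ → ℝ} {a₀ s₀ : ℝ}
    (ha : Tendsto a atTop (𝓝 a₀)) (hs : Tendsto s atTop (𝓝 s₀)) :
    Tendsto (fun n => P.damageRhs (a n) (s n)) atTop (𝓝 (P.damageRhs a₀ s₀)) := by
  have h := (hP.damageRhs_cont.tendsto (a₀, s₀)).comp (ha.prodMk_nhds hs)
  simpa only [Function.comp_def] using h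

namespace ConvergentStates

variable {B : ℝ} {η : ℕ → ℝ} {εs vs πs αs θs : ℕ → ℝ → ℝ} {σs : ℕ → ℝ} {αs' θs' : ℕ → ℝ → ℝ}
  {v α α' θ θ' : ℝ → ℝ} {σ : ℝ}

theorem alpha₁_continuousOn (h : P.ConvergentStates B η εs vs πs αs θs σs αs' θs' v α α' θ θ' σ)
    (n : ℕ) : ContinuousOn (αs' n) (Icc (-P.H) P.H) := fun x hx =>
  ((h.est n).alpha₁_deriv x hx).continuousWithinAt

/-- Continuous expressions in `α`, `σ`, `α'` converge weakly*. -/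
theorem tendstoWeakL_comp (h : P.ConvergentStates B η εs vs πs αs θs σs αs' θs' v α α' θ θ' σ)
    {F : ℝ × ℝ × ℝ → ℝ} (hF : Continuous F) {f : ℕ → ℝ → ℝ} {g : ℝ → ℝ}
    (hf : ∀ n, ∀ x ∈ Icc (-P.H) P.H, f n x = F (αs n x, σs n, αs' n x))
    (hg : ∀ x ∈ Icc (-P.H) P.H, g x = F (α x, σ, α' x)) :
    TendstoWeakL P.H ∞ 1 f g := by
  obtain ⟨N, hN⟩ := (isCompact_Icc (a := -B) (b := B)).prod
    ((isCompact_Icc (a := -B) (b := B)).prod (isCompact_Icc (a := -B) (b := B)))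
    |>.exists_bound_of_continuousOn hF.continuousOn
  refine tendstoWeakL_of_pointwise (B := N) le_rfl (fun n => ?_) (fun n x hx => ?_) fun x hx => ?_
  · exact (hF.comp_continuousOn ((h.sol n).alpha_cont.prodMk
      (continuousOn_const.prodMk (h.alpha₁_continuousOn n)))).congr (hf n)
  · rw [hf n x hx]
    exact hN _ ⟨abs_le.1 ((h.est n).alpha_le x hx), abs_le.1 (h.est n).sigma_le,
      abs_le.1 ((h.est n).alpha₁_le x hx)⟩
  · rw [hg x hx]
    refine ((hF.tendsto _).comp ((h.α_lim x hx).prodMk_nhds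
      (h.σ_lim.prodMk_nhds (h.α'_lim x hx)))).congr fun n => (hf n x hx).symm

theorem alpha_hasDeriv (h : P.ConvergentStates B η εs vs πs αs θs σs αs' θs' v α α' θ θ' σ) :
    ∀ x ∈ Icc (-P.H) P.H, HasDerivWithinAt α (α' x) (Icc (-P.H) P.H) x :=
  hasDerivWithinAt_of_pointwise (fun n => (h.est n).alpha_deriv) h.alpha₁_continuousOn
    (fun n => (h.est n).alpha₁_le) h.α_lim h.α'_lim h.alpha'_continuousOn

theorem damageRhs_continuousOn (hP : P.Standing) {a : ℝ → ℝ} {s : ℝ}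
    (ha : ContinuousOn a (Icc (-P.H) P.H)) :
    ContinuousOn (fun x => P.damageRhs (a x) s) (Icc (-P.H) P.H) :=
  hP.damageRhs_cont.comp_continuousOn (ha.prodMk continuousOn_const)

/-- The damage equation does not contain the rate, so its right-hand side converges pointwise and
the limit equation holds everywhere without any convexity assumption. -/
theorem alpha'_hasDeriv (hP : P.Standing)
    (h : P.ConvergentStates B η εs vs πs αs θs σs αs' θs' v α α' θ θ' σ) :
    ∀ x ∈ Icc (-P.H) P.H,
      HasDerivWithinAt α' (P.damageRhs (α x) σ) (Icc (-P.H) P.H) x :=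
  hasDerivWithinAt_of_pointwise (u' := fun n x => P.damageRhs (αs n x) (σs n))
    (w' := fun x => P.damageRhs (α x) σ) (fun n => (h.est n).alpha₁_deriv)
    (fun n => damageRhs_continuousOn hP (h.sol n).alpha_cont) (fun n => (h.est n).damage_le)
    h.α'_lim (fun x hx => hP.tendsto_damageRhs (h.α_lim x hx) h.σ_lim) (damageRhs_continuousOn hP h.alpha_continuousOn)

theorem theta_hasDeriv (h : P.ConvergentStates B η εs vs πs αs θs σs αs' θs' v α α' θ θ' σ) :
    ∀ x ∈ Icc (-P.H) P.H, HasDerivWithinAt θ (θ' x) (Icc (-P.H) P.H) x :=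
  hasDerivWithinAt_of_pointwise (fun n => (h.est n).theta_deriv)
    (fun n x hx => ((h.est n).theta₁_deriv x hx).continuousWithinAt)
    (fun n => (h.est n).theta₁_le) h.θ_lim h.θ'_lim h.theta'_continuousOn

theorem tendstoWeakW_alpha (hP : P.Standing)
    (h : P.ConvergentStates B η εs vs πs αs θs σs αs' θs' v α α' θ θ' σ) :
    TendstoWeakW P.H ∞ 1 2 αs α := by
  refine ⟨h.tendstoWeakL_comp (F := fun z => z.1) (by fun_prop) (fun _ _ _ => rfl)
    (fun _ _ => rfl), αs', α', fun n => ?_, ?_, ?_⟩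
  · exact isWeakDeriv_of_hasDerivWithinAt hP.H_pos (h.est n).alpha_deriv (h.alpha₁_continuousOn n)
  · exact isWeakDeriv_of_hasDerivWithinAt hP.H_pos h.alpha_hasDeriv h.alpha'_continuousOn
  refine ⟨h.tendstoWeakL_comp (F := fun z => z.2.2) (by fun_prop) (fun _ _ _ => rfl)
    (fun _ _ => rfl), fun n x => P.damageRhs (αs n x) (σs n), fun x => P.damageRhs (α x) σ,
    fun n => ?_, ?_, ?_⟩
  · exact isWeakDeriv_of_hasDerivWithinAt hP.H_pos (h.est n).alpha₁_deriv
      (damageRhs_continuousOn hP (h.sol n).alpha_cont)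
  · exact isWeakDeriv_of_hasDerivWithinAt hP.H_pos (h.alpha'_hasDeriv hP)
      (damageRhs_continuousOn hP h.alpha_continuousOn)
  · exact h.tendstoWeakL_comp (F := fun z => P.damageRhs z.1 z.2.1)
      (hP.damageRhs_cont.comp (continuous_fst.prodMk (continuous_fst.comp continuous_snd)))
      (fun _ _ _ => rfl) (fun _ _ => rfl)

theorem strainSlope_continuousOn (hP : P.Standing) {a a' : ℝ → ℝ} {s : ℝ}
    (ha : ContinuousOn a (Icc (-P.H) P.H)) (ha' : ContinuousOn a' (Icc (-P.H) P.H)) :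
    ContinuousOn (fun x => P.strainSlope (a x) s (a' x)) (Icc (-P.H) P.H) :=
  hP.strainSlope_cont.comp_continuousOn (ha.prodMk (continuousOn_const.prodMk ha'))

/-- The strain and its derivatives are fixed continuous functions of `(α, σ, α')`, so they converge
pointwise and boundedly. Only the second derivative involves `C''`. -/
theorem tendstoWeakW_strain (hP : P.Standing)
    (h : P.ConvergentStates B η εs vs πs αs θs σs αs' θs' v α α' θ θ' σ) :
    TendstoWeakW P.H ∞ 1 1 εs (fun x => σ / P.C (α x)) ∧
      (ContDiff ℝ 2 P.C → TendstoWeakW P.H ∞ 1 2 εs (fun x => σ / P.C (α x))) := by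
  have hCne := hP.C_ne
  have hC : Continuous P.C := hP.C_smooth.continuous
  have h0 : TendstoWeakL P.H ∞ 1 εs (fun x => σ / P.C (α x)) :=
    h.tendstoWeakL_comp (F := fun z => z.2.1 / P.C z.1)
      (Continuous.div (by fun_prop) (by fun_prop) fun z => hCne _)
      (fun n x hx => by rw [eq_div_iff (hCne _), mul_comm]; exact (h.sol n).stress x hx)
      (fun _ _ => rfl)
  have hd : ∀ n, IsWeakDeriv P.H (εs n) fun x => P.strainSlope (αs n x) (σs n) (αs' n x) :=
    fun n => isWeakDeriv_of_hasDerivWithinAt hP.H_pos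
      (fun x hx => hP.hasDerivWithinAt_strain hx (h.sol n).stress ((h.est n).alpha_deriv x hx))
      (strainSlope_continuousOn hP (h.sol n).alpha_cont (h.alpha₁_continuousOn n))
  have hd' : IsWeakDeriv P.H (fun x => σ / P.C (α x)) fun x => P.strainSlope (α x) σ (α' x) :=
    isWeakDeriv_of_hasDerivWithinAt hP.H_pos
      (fun x hx => hP.hasDerivWithinAt_strain hx (fun y _ => mul_div_cancel₀ _ (hCne _))
        (h.alpha_hasDeriv x hx))
      (strainSlope_continuousOn hP h.alpha_continuousOn h.alpha'_continuousOn)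
  have h1 := h.tendstoWeakL_comp hP.strainSlope_cont
    (f := fun n x => P.strainSlope (αs n x) (σs n) (αs' n x))
    (g := fun x => P.strainSlope (α x) σ (α' x)) (fun _ _ _ => rfl) (fun _ _ => rfl)
  refine ⟨⟨h0, _, _, hd, hd', h1⟩, fun hC2 => ⟨h0, _, _, hd, hd', h1, ?_⟩⟩
  have hcc : ∀ (a a' : ℝ → ℝ) (s : ℝ), ContinuousOn a (Icc (-P.H) P.H) →
      ContinuousOn a' (Icc (-P.H) P.H) → ContinuousOn (fun x =>
        P.strainCurv (a x) s (a' x) (P.damageRhs (a x) s)) (Icc (-P.H) P.H) :=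
    fun a a' s ha ha' =>
      (hP.strainCurv_cont hC2).comp_continuousOn (ha.prodMk (continuousOn_const.prodMk ha'))
  refine ⟨fun n x => P.strainCurv (αs n x) (σs n) (αs' n x) (P.damageRhs (αs n x) (σs n)),
    fun x => P.strainCurv (α x) σ (α' x) (P.damageRhs (α x) σ), fun n => ?_, ?_, ?_⟩
  · exact isWeakDeriv_of_hasDerivWithinAt hP.H_pos
      (fun x hx => hP.hasDerivWithinAt_strainSlope hC2 ((h.est n).alpha_deriv x hx)
        ((h.est n).alpha₁_deriv x hx)) (hcc _ _ _ (h.sol n).alpha_cont (h.alpha₁_continuousOn n))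
  · exact isWeakDeriv_of_hasDerivWithinAt hP.H_pos
      (fun x hx => hP.hasDerivWithinAt_strainSlope hC2 (h.alpha_hasDeriv x hx)
        (h.alpha'_hasDeriv hP x hx)) (hcc _ _ _ h.alpha_continuousOn h.alpha'_continuousOn)
  · exact h.tendstoWeakL_comp (hP.strainCurv_cont hC2) (fun _ _ _ => rfl) (fun _ _ => rfl)

theorem tendstoH1_theta (hP : P.Standing)
    (h : P.ConvergentStates B η εs vs πs αs θs σs αs' θs' v α α' θ θ' σ) :
    TendstoH1 P.H θs θ ∧ MemW P.H ∞ 1 θ := by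
  have hc' : ∀ n, ContinuousOn (θs' n) (Icc (-P.H) P.H) := fun n x hx =>
    ((h.est n).theta₁_deriv x hx).continuousWithinAt
  have hθd := isWeakDeriv_of_hasDerivWithinAt hP.H_pos h.theta_hasDeriv h.theta'_continuousOn
  refine ⟨⟨tendstoL_two_of_pointwise (fun n => (h.sol n).theta_cont) (fun n => (h.est n).theta_le)
    h.θ_lim, θs', θ', fun n => isWeakDeriv_of_hasDerivWithinAt hP.H_pos (h.est n).theta_deriv
      (hc' n), hθd, tendstoL_two_of_pointwise hc' (fun n => (h.est n).theta₁_le) h.θ'_lim⟩, ?_⟩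
  exact ⟨(tendstoWeakL_of_pointwise (q := 1) le_rfl (fun n => (h.sol n).theta_cont)
      (fun n => (h.est n).theta_le) h.θ_lim).2.1, θ', hθd,
    (tendstoWeakL_of_pointwise (q := 1) le_rfl hc' (fun n => (h.est n).theta₁_le) h.θ'_lim).2.1⟩

/-- The limit may be any representative `π` of `p`, so that the continuous one can be used. -/
theorem tendstoWeakL_rate (hP : P.Standing)
    (h : P.ConvergentStates B η εs vs πs αs θs σs αs' θs' v α α' θ θ' σ) {p π : ℝ → ℝ}
    (hp : Measurable p) (hpB : ∀ x, |p x| ≤ B)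
    (hv : ∀ x ∈ Icc (-P.H) P.H, v x = v (-P.H) + ∫ y in (-P.H)..x, p y)
    (hπ : ∀ᵐ x ∂(volD P.H), p x = π x) : TendstoWeakL P.H 1 ∞ πs π := by
  refine ⟨fun n => MemLp.of_bound ((h.sol n).π_cont.aestronglyMeasurable measurableSet_Icc) B
    ((ae_mem_volD P.H).mono (h.est n).pi_le), (MemLp.of_bound hp.aestronglyMeasurable B
      (Eventually.of_forall hpB)).ae_eq hπ, fun g hg => ?_⟩
  obtain ⟨M, hM0, hM⟩ := exists_bound_of_memLp_top hg
  have := h.tendsto_integral_pi_mul hP hp hpB hv hg.1 hM0 hM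
  have heq : ∫ x, p x * g x ∂(volD P.H) = ∫ x, π x * g x ∂(volD P.H) :=
    integral_congr_ae (hπ.mono fun x hx => by simp only [hx])
  rwa [heq] at this

theorem tendstoWeakW_v (hP : P.Standing)
    (h : P.ConvergentStates B η εs vs πs αs θs σs αs' θs' v α α' θ θ' σ) {π : ℝ → ℝ}
    (hv : ∀ x ∈ Icc (-P.H) P.H, v x = v (-P.H) + ∫ y in (-P.H)..x, π y)
    (hπ : TendstoWeakL P.H 1 ∞ πs π) : TendstoWeakW P.H 1 ∞ 1 vs v :=
  ⟨tendstoWeakL_of_pointwise le_top (fun n x hx => ((h.sol n).rate x hx).continuousWithinAt)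
    (fun n => (h.est n).v_le) h.v_lim, πs, π,
    fun n => isWeakDeriv_of_hasDerivWithinAt hP.H_pos (h.sol n).rate (h.sol n).π_cont,
    isWeakDeriv_of_primitive hP.H_pos (memLp_one_iff_integrable.1 hπ.2.1) hv, hπ⟩

/-- If the limit rate is continuous, the limit satisfies the balance equations. -/
theorem balance (hP : P.Standing)
    (h : P.ConvergentStates B η εs vs πs αs θs σs αs' θs' v α α' θ θ' σ) {π : ℝ → ℝ}
    (hπ : ContinuousOn π (Icc (-P.H) P.H))
    (hv : ∀ x ∈ Icc (-P.H) P.H, v x = v (-P.H) + ∫ y in (-P.H)..x, π y)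
    (hθ' : ∀ x ∈ Icc (-P.H) P.H,
      θ' x = θ' (-P.H) + ∫ y in (-P.H)..x, P.agingRhs (π y) (θ y)) :
    P.Balance (fun x => σ / P.C (α x)) v π α θ σ := by
  have hstress : ∀ x, P.C (α x) * (σ / P.C (α x)) = σ := fun x => mul_div_cancel₀ _ (hP.C_ne _)
  have hl := left_mem_Icc.2 hP.neg_le
  have hr := right_mem_Icc.2 hP.neg_le
  have lim : ∀ {u : ℕ → ℝ} {c d : ℝ}, Tendsto u atTop (𝓝 c) → (∀ n, u n = d) → c = d :=
    fun hu hd => tendsto_nhds_unique hu (by rw [funext hd]; exact tendsto_const_nhds)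
  refine ⟨fun x _ => hstress x, fun x hx => ?_,
    fun x hx => hasDerivWithinAt_of_primitive hπ hv hx,
    ⟨fun x => P.damageRhs (α x) σ, ⟨α', h.alpha_hasDeriv, h.alpha'_hasDeriv hP⟩, fun x hx => ?_⟩,
    ⟨fun x => P.agingRhs (π x) (θ x), ⟨θ', h.theta_hasDeriv, fun x hx => ?_⟩, fun x hx => ?_⟩,
    (h.v_boundary hP).1, (h.v_boundary hP).2,
    lim (h.α_lim _ hl) fun n => (h.sol n).α_left, lim (h.α_lim _ hr) fun n => (h.sol n).α_right,
    lim (h.θ_lim _ hl) fun n => (h.sol n).θ_left, lim (h.θ_lim _ hr) fun n => (h.sol n).θ_right⟩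
  · exact (hasDerivWithinAt_const x _ σ).congr (fun y _ => hstress y) (hstress x)
  · have := hP.Gc_pos.ne'
    have := hP.ℓ_pos.ne'
    unfold damageRhs
    field_simp
  · exact hasDerivWithinAt_of_primitive (hP.agingRhs_cont.comp_continuousOn
      (hπ.prodMk h.theta_continuousOn)) hθ' hx
  · have := hP.κ_pos.ne'
    unfold agingRhs
    field_simp

end ConvergentStates

end Data

end FaultModel

/-! ### The proposition. -/

theorem proposition3p4 (P : FaultModel.Data) (hP : P.Standing)
    (hΦ : P.SuperlinearBound) (hm : P.UniformModulus)
    (η : ℕ → ℝ) (hη : ∀ n, 0 < η n) (hη0 : Tendsto η atTop (𝓝 0))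
    (εs vs πs αs θs : ℕ → ℝ → ℝ) (σs : ℕ → ℝ)
    (hsol : ∀ n, P.IsSteadyState (η n) (εs n) (vs n) (πs n) (αs n) (θs n) (σs n)) :
    ∃ (k : ℕ → ℕ) (ε v π α θ : ℝ → ℝ) (σ : ℝ), StrictMono k ∧
      -- convergence along the subsequence
      FaultModel.TendstoWeakW P.H ∞ 1 1 (fun n => εs (k n)) ε ∧
      (ContDiff ℝ 2 P.C → FaultModel.TendstoWeakW P.H ∞ 1 2 (fun n => εs (k n)) ε) ∧
      FaultModel.TendstoWeakW P.H 1 ∞ 1 (fun n => vs (k n)) v ∧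
      FaultModel.TendstoWeakL P.H 1 ∞ (fun n => πs (k n)) π ∧
      FaultModel.TendstoWeakW P.H ∞ 1 2 (fun n => αs (k n)) α ∧
      FaultModel.TendstoH1 P.H (fun n => θs (k n)) θ ∧ FaultModel.MemW P.H ∞ 1 θ ∧
      Tendsto (fun n => σs (k n)) atTop (𝓝 σ) ∧
      (∀ᵐ x ∂(FaultModel.volD P.H), σ ∈ P.flowSet (π x) (θ x)) ∧
      -- if `R(·, θ)` is strictly convex, the inverse of the flow rule is well defined, and the
      -- limit is a classical steady state with `η = 0`
      ((∀ t, StrictConvexOn ℝ univ fun p => P.R p t) →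
        (∀ s t p, P.flowInv s t = p ↔ s ∈ P.flowSet p t) ∧
        (∀ x ∈ Icc (-P.H) P.H, π x = P.flowInv σ (θ x)) ∧
        P.IsLimitSteadyState ε v π α θ σ ∧
        ContinuousOn π (Icc (-P.H) P.H) ∧ ContDiffOn ℝ 1 v (Icc (-P.H) P.H)) := by
  obtain ⟨k, hk, B, αs', θs', v, α, α', θ, θ', σ, h⟩ :=
    FaultModel.Data.exists_convergentStates hP hΦ hη hη0 hsol
  obtain ⟨p, hp, hpB, hps, hpv⟩ := h.exists_rate hP
  have hflow := h.ae_mem_flowSet hP hp hpB hpv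
  -- One `π` must serve both the general claims and the strictly convex ones, so the representative
  -- is fixed by cases beforehand: the pointwise inverse of the flow rule if `R` is strictly convex,
  -- and `p` otherwise.
  obtain ⟨π, hπp, hπc⟩ : ∃ π : ℝ → ℝ, (∀ᵐ x ∂(FaultModel.volD P.H), p x = π x) ∧
      ((∀ t, StrictConvexOn ℝ univ fun p => P.R p t) → ∀ x, π x = P.flowInv σ (θ x)) := by
    by_cases hc : ∀ t, StrictConvexOn ℝ univ fun p => P.R p t
    · exact ⟨fun x => P.flowInv σ (θ x),
        hflow.mono fun x hx => ((hP.flowInv_eq_iff hΦ hc _ _ _).2 hx).symm, fun _ _ => rfl⟩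
    · exact ⟨p, Eventually.of_forall fun _ => rfl, fun hc' => absurd hc' hc⟩
  have hπv : ∀ x ∈ Icc (-P.H) P.H, v x = v (-P.H) + ∫ y in (-P.H)..x, π y := fun x hx => by
    rw [← FaultModel.integral_congr_of_ae_volD hπp hx]
    exact hpv x hx
  have hweak := h.tendstoWeakL_rate hP hp hpB hpv hπp
  have hε := h.tendstoWeakW_strain hP
  have hθ := h.tendstoH1_theta hP
  refine ⟨k, fun x => σ / P.C (α x), v, π, α, θ, σ, hk, hε.1, hε.2, h.tendstoWeakW_v hP hπv hweak,
    hweak, h.tendstoWeakW_alpha hP, hθ.1, hθ.2, h.σ_lim, ?_, fun hc => ?_⟩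
  · filter_upwards [hflow, hπp] with x hx hx'
    rwa [← hx']
  · have hiff := hP.flowInv_eq_iff hΦ hc
    have hπcont : ContinuousOn π (Icc (-P.H) P.H) :=
      ((hP.flowInv_continuous hΦ hc σ).comp_continuousOn h.theta_continuousOn).congr
        fun x _ => hπc hc x
    have hθ' : ∀ x ∈ Icc (-P.H) P.H,
        θ' x = θ' (-P.H) + ∫ y in (-P.H)..x, P.agingRhs (π y) (θ y) := fun x hx => by
      rw [h.theta'_eq hP hp hpB hps hpv x hx, FaultModel.integral_congr_of_ae_volD
        (hπp.mono fun y hy => by rw [hy]) hx]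
    have hbal := h.balance hP hπcont hπv hθ'
    refine ⟨hiff, fun x _ => hπc hc x, ⟨hbal, fun x _ => ?_⟩, hπcont, ?_⟩
    · rw [← hP.mem_flowSet_iff, ← hiff]
      exact (hπc hc x).symm
    · have hud : UniqueDiffOn ℝ (Icc (-P.H) P.H) := uniqueDiffOn_Icc (by linarith [hP.H_pos])
      rw [contDiffOn_one_iff_derivWithin hud]
      exact ⟨fun x hx => (hbal.rate x hx).differentiableWithinAt,
        hπcont.congr fun x hx => (hbal.rate x hx).derivWithin (hud x hx)⟩
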